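/- An instance of Exact Matching (EM) on bipartite graphs consists of a simple bipartite graph $G$ on $n$ vertices, given with a bipartition $(A,B)$ of its vertex set, a colouring of its edges with the two colours red and blue, and an integer $k \ge 0$. The task is to find a perfect matching of $G$ with exactly $k$ red edges, or to report correctly that none exists. The bipartite independence number $\beta = \beta(G)$ is the largest $b$ such that $G$ has an independent set consisting of exactly $b$ vertices of $A$ and exactly $b$ vertices of $B$. **Theorem.** There are a function $f:\mathbb{N}\to\mathbb{N}$ with $f(\beta) = 2^{O(\beta+1)}$ and a deterministic algorithm which solves every instance of EM on bipartite graphs in time $n^{O(f(\beta))}$. More precisely, there are a single program of a deterministic random access machine (unit-cost addition, truncated subtraction, tests and indirect addressing on natural numbers, no multiplication), a function $f$ and constants $c, C$ with $f(b) \le 2^{c(b+1)}$ for all $b$, such that on every instance, given as $n$, $k$, the indicator vector of $A$ and the coloured adjacency matrix of $G$, the program halts with a correct answer after at most $\max(n,2)^{C f(\beta)}$ steps. The value of $\beta$ is not part of the input. -/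

import Mathlib

namespace RAM

/-! A deterministic random access machine with unit-cost addition, truncated subtraction and
indirect addressing (no multiplication), programmed with structured control flow. -/

/-- Memory: natural-number registers `reg 0, reg 1, …` and arrays `arr 0, arr 1, …`. -/
@[ext] structure State where
  reg : ℕ → ℕ
  arr : ℕ → ℕ → ℕ

/-- Arithmetic expressions; register and array names are fixed in the program text, array indices
are computed. -/
inductive Expr : Type
  | lit (c : ℕ)
  | var (x : ℕ)
  | get (a : ℕ) (i : Expr)
  | add (e₁ e₂ : Expr)
  | sub (e₁ e₂ : Expr)

/-- The value of an expression (subtraction is truncated at zero). -/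
def Expr.eval (s : State) : Expr → ℕ
  | lit c => c
  | var x => s.reg x
  | get a i => s.arr a (i.eval s)
  | add e₁ e₂ => e₁.eval s + e₂.eval s
  | sub e₁ e₂ => e₁.eval s - e₂.eval s

/-- Evaluating an expression costs one step for each of its operations and leaves. -/
def Expr.cost : Expr → ℕ
  | lit _ => 1
  | var _ => 1
  | get _ i => i.cost + 1
  | add e₁ e₂ => e₁.cost + e₂.cost + 1
  | sub e₁ e₂ => e₁.cost + e₂.cost + 1

/-- Programs. A test `e` succeeds when the value of `e` is nonzero. -/
inductive Prog : Type
  | nop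
  | assign (x : ℕ) (e : Expr)
  | store (a : ℕ) (i e : Expr)
  | seq (p q : Prog)
  | branch (e : Expr) (p q : Prog)
  | loop (e : Expr) (p : Prog)

/-- The effect of `reg x := v`. -/
def State.setReg (s : State) (x v : ℕ) : State :=
  { s with reg := Function.update s.reg x v }

/-- The effect of `arr a [i] := v`. -/
def State.setArr (s : State) (a i v : ℕ) : State :=
  { s with arr := Function.update s.arr a (Function.update (s.arr a) i v) }

/-- `Runs p s s' t`: started in the state `s`, the program `p` halts in the state `s'` after exactly
`t` steps. -/
inductive Runs : Prog → State → State → ℕ → Prop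
  | nop (s : State) : Runs .nop s s 1
  | assign (s : State) (x : ℕ) (e : Expr) :
      Runs (.assign x e) s (s.setReg x (e.eval s)) (e.cost + 1)
  | store (s : State) (a : ℕ) (i e : Expr) :
      Runs (.store a i e) s (s.setArr a (i.eval s) (e.eval s)) (i.cost + e.cost + 1)
  | seq {p q : Prog} {s s₁ s₂ : State} {t₁ t₂ : ℕ} :
      Runs p s s₁ t₁ → Runs q s₁ s₂ t₂ → Runs (.seq p q) s s₂ (t₁ + t₂)
  | branch_true {e : Expr} {p q : Prog} {s s₁ : State} {t : ℕ} :
      e.eval s ≠ 0 → Runs p s s₁ t → Runs (.branch e p q) s s₁ (e.cost + 1 + t)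
  | branch_false {e : Expr} {p q : Prog} {s s₁ : State} {t : ℕ} :
      e.eval s = 0 → Runs q s s₁ t → Runs (.branch e p q) s s₁ (e.cost + 1 + t)
  | loop_done {e : Expr} {p : Prog} {s : State} :
      e.eval s = 0 → Runs (.loop e p) s s (e.cost + 1)
  | loop_step {e : Expr} {p : Prog} {s s₁ s₂ : State} {t₁ t₂ : ℕ} :
      e.eval s ≠ 0 → Runs p s s₁ t₁ → Runs (.loop e p) s₁ s₂ t₂ →
        Runs (.loop e p) s s₂ (e.cost + 1 + t₁ + t₂)

/-- The machine is deterministic: the final state and the step count are unique. -/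
theorem Runs.deterministic {p : Prog} {s s₁ s₂ : State} {t₁ t₂ : ℕ}
    (h₁ : Runs p s s₁ t₁) (h₂ : Runs p s s₂ t₂) : s₁ = s₂ ∧ t₁ = t₂ := by
  induction h₁ generalizing s₂ t₂ with
  | nop s => cases h₂; simp
  | assign s x e => cases h₂; simp
  | store s a i e => cases h₂; simp
  | seq _ _ ih₁ ih₂ =>
    cases h₂ with
    | seq g₁ g₂ =>
      obtain ⟨rfl, rfl⟩ := ih₁ g₁
      obtain ⟨rfl, rfl⟩ := ih₂ g₂
      simp
  | branch_true h _ ih =>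
    cases h₂ with
    | branch_true _ g => obtain ⟨rfl, rfl⟩ := ih g; simp
    | branch_false h' _ => exact absurd h' h
  | branch_false h _ ih =>
    cases h₂ with
    | branch_true h' _ => exact absurd h h'
    | branch_false _ g => obtain ⟨rfl, rfl⟩ := ih g; simp
  | loop_done h =>
    cases h₂ with
    | loop_done _ => simp
    | loop_step h' _ _ => exact absurd h h'
  | loop_step h _ _ ih₁ ih₂ =>
    cases h₂ with
    | loop_done h' => exact absurd h' h
    | loop_step _ g₁ g₂ =>
      obtain ⟨rfl, rfl⟩ := ih₁ g₁
      obtain ⟨rfl, rfl⟩ := ih₂ g₂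
      simp

end RAM

/-- An instance of Exact Matching on bipartite graphs: a graph on `n` vertices with bipartition
`(A, Aᶜ)`, a colouring of its edges (the edges in `red` are red, all others are blue) and the
required number `k` of red edges. -/
structure BipartiteEM where
  n : ℕ
  G : SimpleGraph (Fin n)
  A : Set (Fin n)
  bipartite : G.IsBipartiteWith A Aᶜ
  red : Set (Sym2 (Fin n))
  k : ℕ

namespace BipartiteEM

/-- The bipartite independence number with respect to the bipartition `(A, Aᶜ)`: the largest `b` such
that some independent set contains exactly `b` vertices of `A` and exactly `b` vertices of `Aᶜ`. -/
noncomputable def beta (I : BipartiteEM) : ℕ :=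
  sSup {b : ℕ | ∃ S : Set (Fin I.n), I.G.IsIndepSet S ∧
    (S ∩ I.A).ncard = b ∧ (S ∩ I.Aᶜ).ncard = b}

/-- `M` is a perfect matching of the graph with exactly `k` red edges. -/
def IsSolution (I : BipartiteEM) (M : I.G.Subgraph) : Prop :=
  M.IsPerfectMatching ∧ (M.edgeSet ∩ I.red).ncard = I.k

open Classical in
/-- Entries of the coloured adjacency matrix: `0` for a non-edge, `1` for a blue edge, `2` for a red
edge. -/
noncomputable def code (I : BipartiteEM) (u v : Fin I.n) : ℕ :=
  if I.G.Adj u v then (if s(u, v) ∈ I.red then 2 else 1) else 0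

open Classical in
/-- The input in memory: `reg 0 = n`, `reg 1 = k`, `arr 0` is the indicator vector of `A`, `arr 1` is
the coloured adjacency matrix in row-major order (the entry for `(u, v)` is at `u * n + v`), and all
other cells are zero. -/
noncomputable def input (I : BipartiteEM) : RAM.State where
  reg x := if x = 0 then I.n else if x = 1 then I.k else 0
  arr a i :=
    if a = 0 then (if h : i < I.n then (if (⟨i, h⟩ : Fin I.n) ∈ I.A then 1 else 0) else 0)
    else if a = 1 then
      (if h : i < I.n * I.n then I.code (Fin.divNat ⟨i, h⟩) (Fin.modNat ⟨i, h⟩) else 0)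
    else 0

/-- The final memory is a correct answer: either `reg 2 = 1` and `arr 2` maps each vertex to its
partner in some solution, or `reg 2 = 0` and there is no solution. -/
def IsAnswer (I : BipartiteEM) (s : RAM.State) : Prop :=
  (s.reg 2 = 1 ∧ ∃ M : I.G.Subgraph, I.IsSolution M ∧
      ∀ u v : Fin I.n, M.Adj u v ↔ s.arr 2 u = v) ∨
  (s.reg 2 = 0 ∧ ¬ ∃ M : I.G.Subgraph, I.IsSolution M)

end BipartiteEM

/-! ### Permutations seen from a reference perfect matching -/

namespace ExactMatching

open Finset

set_option linter.unusedSectionVars false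

section Exchange

variable {V : Type*} [Fintype V] [DecidableEq V]

/-- The weight of a permutation: the sum of `r v (π v) - r v v`. -/
def gain (r : V → V → ℤ) (π : Equiv.Perm V) : ℤ := ∑ v, (r v (π v) - r v v)

/-- All pairs `(v, π v)` are edges. -/
def Good (E : V → V → Prop) (π : Equiv.Perm V) : Prop := ∀ v, E v (π v)

/-- Two sets of more than `b` vertices are joined by an edge. -/
def Dense (E : V → V → Prop) (b : ℕ) : Prop :=
  ∀ X Y : Finset V, b < X.card → b < Y.card → ∃ x ∈ X, ∃ y ∈ Y, E x y

theorem gain_one (r : V → V → ℤ) : gain r 1 = 0 := by simp [gain]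

/-- Density is applied to windows of b+1 consecutive terms of a sequence without repetition.
Choosing the windows prescribes the two ends of the edge up to an error of b, and prescribes its
direction. -/
theorem Dense.exists_edge {E : V → V → Prop} {b : ℕ} (h : Dense E b) {u : ℕ → V} {N : ℕ}
    (hu : Set.InjOn u (Set.Iio N)) {s t : ℕ} (hs : s + b < N) (ht : t + b < N) :
    ∃ i j, s ≤ i ∧ i ≤ s + b ∧ t ≤ j ∧ j ≤ t + b ∧ E (u i) (u j) := by
  have key : ∀ a, a + b < N → ((Icc a (a + b)).image u).card = b + 1 := by
    intro a ha
    rw [card_image_of_injOn]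
    · simp; omega
    · intro x hx y hy hxy
      simp only [coe_Icc, Set.mem_Icc] at hx hy
      exact hu (by simp; omega) (by simp; omega) hxy
  obtain ⟨x, hx, y, hy, hxy⟩ := h ((Icc s (s + b)).image u) ((Icc t (t + b)).image u)
    (by rw [key s hs]; omega) (by rw [key t ht]; omega)
  simp only [mem_image, mem_Icc] at hx hy
  obtain ⟨i, hi, rfl⟩ := hx
  obtain ⟨j, hj, rfl⟩ := hy
  exact ⟨i, j, hi.1, hi.2, hj.1, hj.2, hxy⟩

/-- The cyclic permutation of a segment. -/
theorem exists_segment_cycle {v : ℕ → V} {a c : ℕ} (hac : a ≤ c)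
    (hv : Set.InjOn v (Set.Icc a c)) :
    ∃ κ : Equiv.Perm V, (∀ t, a ≤ t → t < c → κ (v t) = v (t + 1)) ∧ κ (v c) = v a ∧
      ∀ u, (∀ t, a ≤ t → t ≤ c → u ≠ v t) → κ u = u := by
  induction c, hac using Nat.le_induction with
  | base =>
    refine ⟨1, ?_, by simp, by simp⟩
    intro t h1 h2; omega
  | succ c hac ih =>
    obtain ⟨κ, h1, h2, h3⟩ := ih (hv.mono (Set.Icc_subset_Icc le_rfl (Nat.le_succ c)))
    have hne : ∀ t t', a ≤ t → t ≤ c + 1 → a ≤ t' → t' ≤ c + 1 → t ≠ t' → v t ≠ v t' := by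
      intro t t' g1 g2 g3 g4 g5 h
      exact g5 (hv ⟨g1, g2⟩ ⟨g3, g4⟩ h)
    refine ⟨κ * Equiv.swap (v c) (v (c + 1)), ?_, ?_, ?_⟩
    · intro t ht1 ht2
      rcases Nat.lt_succ_iff_lt_or_eq.mp ht2 with h | rfl
      · rw [Equiv.Perm.mul_apply, Equiv.swap_apply_of_ne_of_ne, h1 t ht1 h]
        · exact hne _ _ (by omega) (by omega) (by omega) (by omega) (by omega)
        · exact hne _ _ (by omega) (by omega) (by omega) (by omega) (by omega)
      · rw [Equiv.Perm.mul_apply, Equiv.swap_apply_left]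
        apply h3
        intro s hs1 hs2
        exact hne _ _ (by omega) (by omega) (by omega) (by omega) (by omega)
    · rw [Equiv.Perm.mul_apply, Equiv.swap_apply_right, h2]
    · intro u hu
      rw [Equiv.Perm.mul_apply, Equiv.swap_apply_of_ne_of_ne (hu c hac (by omega))
        (hu (c + 1) (by omega) le_rfl)]
      exact h3 u fun t g1 g2 => hu t g1 (by omega)

/-- The prefix weights of a walk. -/
def pre (r : V → V → ℤ) (v : ℕ → V) (n : ℕ) : ℤ :=
  ∑ t ∈ range n, (r (v t) (v (t + 1)) - r (v t) (v t))

theorem pre_succ (r : V → V → ℤ) (v : ℕ → V) (n : ℕ) :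
    pre r v (n + 1) = pre r v n + (r (v n) (v (n + 1)) - r (v n) (v n)) := by
  rw [pre, pre, sum_range_succ]

theorem pre_sub (r : V → V → ℤ) (v : ℕ → V) {a c : ℕ} (h : a ≤ c) :
    pre r v c - pre r v a = ∑ t ∈ Ico a c, (r (v t) (v (t + 1)) - r (v t) (v t)) := by
  rw [pre, pre, sum_Ico_eq_sub _ h]

/-- Sums over all vertices of a function that vanishes off a segment. -/
theorem sum_segment {v : ℕ → V} {a c : ℕ} (hv : Set.InjOn v (Set.Icc a c)) (f : V → ℤ)
    (hf : ∀ u, (∀ t, a ≤ t → t ≤ c → u ≠ v t) → f u = 0) :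
    ∑ u, f u = ∑ t ∈ Icc a c, f (v t) := by
  rw [← sum_image (s := Icc a c) (g := v) (f := f) (by simpa using hv)]
  symm
  apply sum_subset (subset_univ _)
  intro u _ hu
  apply hf
  intro t h1 h2 h
  exact hu (mem_image.mpr ⟨t, mem_Icc.mpr ⟨h1, h2⟩, h.symm⟩)

theorem gain_segment_cycle (r : V → V → ℤ) {v : ℕ → V} {a c : ℕ} (hac : a ≤ c)
    (hv : Set.InjOn v (Set.Icc a c)) {κ : Equiv.Perm V}
    (h1 : ∀ t, a ≤ t → t < c → κ (v t) = v (t + 1)) (h2 : κ (v c) = v a)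
    (h3 : ∀ u, (∀ t, a ≤ t → t ≤ c → u ≠ v t) → κ u = u) :
    gain r κ = pre r v c - pre r v a + (r (v c) (v a) - r (v c) (v c)) := by
  rw [gain, sum_segment hv _ (fun u hu => by rw [h3 u hu, sub_self]),
    ← Finset.Ico_insert_right hac, sum_insert (by simp), pre_sub _ _ hac, h2, add_comm]
  congr 1
  apply sum_congr rfl
  intro t ht
  rw [mem_Ico] at ht
  rw [h1 t ht.1 ht.2]

theorem good_segment_cycle {E : V → V → Prop} (hE : ∀ v, E v v) {v : ℕ → V} {a c : ℕ}
    {κ : Equiv.Perm V}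
    (h1 : ∀ t, a ≤ t → t < c → κ (v t) = v (t + 1)) (h2 : κ (v c) = v a)
    (h3 : ∀ u, (∀ t, a ≤ t → t ≤ c → u ≠ v t) → κ u = u)
    (hc : E (v c) (v a)) (hs : ∀ t, a ≤ t → t < c → E (v t) (v (t + 1))) : Good E κ := by
  intro u
  by_cases hu : ∀ t, a ≤ t → t ≤ c → u ≠ v t
  · rw [h3 u hu]; exact hE u
  · push Not at hu
    obtain ⟨t, g1, g2, rfl⟩ := hu
    rcases g2.lt_or_eq with g | rfl
    · rw [h1 t g1 g]; exact hs t g1 g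
    · rw [h2]; exact hc

/-- Shortcutting a path of `θ` by an edge. -/
theorem exists_skip {E : V → V → Prop} (hE : ∀ v, E v v) (r : V → V → ℤ) {v : ℕ → V} {i j : ℕ}
    (hij : i + 2 ≤ j) (hv : Set.InjOn v (Set.Icc i j)) (hedge : E (v i) (v j))
    {θ : Equiv.Perm V} (hθ : Good E θ) (hstep : ∀ t, i ≤ t → t < j → θ (v t) = v (t + 1)) :
    ∃ ρ : Equiv.Perm V, (∀ u, (∀ t, i ≤ t → t < j → u ≠ v t) → ρ u = u) ∧ Good E (θ * ρ) ∧
      gain r (θ * ρ) - gain r θ =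
        r (v i) (v j) - r (v i) (v i) - (pre r v j - pre r v i) ∧
      θ (ρ (v (i + 1))) = v (i + 1) := by
  obtain ⟨j, rfl⟩ : ∃ j', j = j' + 1 := ⟨j - 1, by omega⟩
  have hv' : Set.InjOn v (Set.Icc i j) := hv.mono (Set.Icc_subset_Icc le_rfl (Nat.le_succ j))
  -- With `j` now denoting the last vertex to be bypassed, precomposing θ with the inverse of this
  -- cycle sends `v i` straight to `v (j + 1)` and turns `v (i + 1), …, v j` into fixed points, that
  -- is, gives them back their reference partners.
  obtain ⟨κ, h1, h2, h3⟩ := exists_segment_cycle (v := v) (a := i) (c := j) (by omega) hv'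
  have k2 : κ⁻¹ (v i) = v j := by rw [Equiv.Perm.inv_eq_iff_eq, h2]
  have k1 : ∀ t, i ≤ t → t < j → κ⁻¹ (v (t + 1)) = v t := by
    intro t g1 g2; rw [Equiv.Perm.inv_eq_iff_eq, h1 t g1 g2]
  have k3 : ∀ u, (∀ t, i ≤ t → t ≤ j → u ≠ v t) → κ⁻¹ u = u := by
    intro u hu; rw [Equiv.Perm.inv_eq_iff_eq, h3 u hu]
  have m1 : θ (κ⁻¹ (v i)) = v (j + 1) := by rw [k2, hstep j (by omega) (by omega)]
  have m2 : ∀ t, i ≤ t → t < j → θ (κ⁻¹ (v (t + 1))) = v (t + 1) := by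
    intro t g1 g2; rw [k1 t g1 g2, hstep t g1 (by omega)]
  refine ⟨κ⁻¹, fun u hu => k3 u fun t g1 g2 => hu t g1 (by omega), ?_, ?_, m2 i le_rfl (by omega)⟩
  · intro u
    rw [Equiv.Perm.mul_apply]
    by_cases hu : ∀ t, i ≤ t → t ≤ j → u ≠ v t
    · rw [k3 u hu]; exact hθ u
    · push Not at hu
      obtain ⟨t, g1, g2, rfl⟩ := hu
      rcases g1.eq_or_lt with rfl | g
      · rw [m1]; exact hedge
      · obtain ⟨t, rfl⟩ : ∃ t', t = t' + 1 := ⟨t - 1, by omega⟩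
        rw [m2 t (by omega) (by omega)]; exact hE _
  · rw [gain, gain, ← sum_sub_distrib, sum_segment hv', pre_sub _ _ (by omega)]
    · rw [← Finset.Ioc_insert_left (show i ≤ j by omega), sum_insert (by simp),
        ← sum_Ico_consecutive _ (show i ≤ i + 1 by omega) (show i + 1 ≤ j + 1 by omega)]
      simp only [Nat.Ico_succ_singleton, sum_singleton, Equiv.Perm.mul_apply, m1,
        hstep i le_rfl (by omega)]
      have : ∑ x ∈ Ioc i j, (r (v x) (θ (κ⁻¹ (v x))) - r (v x) (v x) -
          (r (v x) (θ (v x)) - r (v x) (v x))) =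
          - ∑ x ∈ Ico (i + 1) (j + 1), (r (v x) (v (x + 1)) - r (v x) (v x)) := by
        rw [← sum_neg_distrib]
        have : Ioc i j = Ico (i + 1) (j + 1) := by ext; simp
        rw [this]
        apply sum_congr rfl
        intro t ht
        rw [mem_Ico] at ht
        obtain ⟨t, rfl⟩ : ∃ t', t = t' + 1 := ⟨t - 1, by omega⟩
        rw [m2 t (by omega) (by omega), hstep (t + 1) (by omega) (by omega)]
        ring
      rw [this]; ring
    · intro u hu
      rw [Equiv.Perm.mul_apply, k3 u hu]; ring

/-- A modification of the perfect matching `θ` inside the set `s`. -/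
structure IsMove (E : V → V → Prop) (θ : Equiv.Perm V) (s : Finset V) (ρ : Equiv.Perm V) :
    Prop where
  fix : ∀ u, u ∉ s → ρ u = u
  good : Good E (θ * ρ)

theorem IsMove.mem {E : V → V → Prop} {θ ρ : Equiv.Perm V} {s : Finset V} (h : IsMove E θ s ρ)
    {u : V} (hu : u ∈ s) : ρ u ∈ s := by
  by_contra hn
  have := h.fix _ hn
  have := ρ.injective this
  rw [this] at hn
  exact hn hu

theorem gain_mul_disjoint (r : V → V → ℤ) {E : V → V → Prop} {θ ρ ρ' : Equiv.Perm V}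
    {s s' : Finset V} (h : IsMove E θ s ρ) (h' : IsMove E θ s' ρ') (hd : Disjoint s s') :
    gain r (θ * (ρ * ρ')) - gain r θ =
      (gain r (θ * ρ) - gain r θ) + (gain r (θ * ρ') - gain r θ) := by
  simp only [gain, ← sum_sub_distrib, ← sum_add_distrib, Equiv.Perm.mul_apply]
  apply sum_congr rfl
  intro v _
  by_cases hv : v ∈ s'
  · rw [h.fix (ρ' v) (disjoint_right.mp hd (h'.mem hv)), h.fix v (disjoint_right.mp hd hv)]
    ring
  · rw [h'.fix v hv]; ring

/-- Modifications inside disjoint sets can be carried out together. -/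
theorem exists_combined_move (r : V → V → ℤ) {E : V → V → Prop} {θ : Equiv.Perm V}
    (hθ : Good E θ) (S : Finset (Finset V)) (hS : (S : Set (Finset V)).PairwiseDisjoint id)
    (ρ : Finset V → Equiv.Perm V) (hρ : ∀ s ∈ S, IsMove E θ s (ρ s)) :
    ∃ σ, IsMove E θ (S.biUnion id) σ ∧ (∀ s ∈ S, ∀ v ∈ s, σ v = ρ s v) ∧
      gain r (θ * σ) - gain r θ = ∑ s ∈ S, (gain r (θ * ρ s) - gain r θ) := by
  classical
  induction S using Finset.induction_on with
  | empty =>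
    refine ⟨1, ⟨by simp, by simpa using hθ⟩, by simp, by simp⟩
  | insert s S hs ih =>
    obtain ⟨σ, h1, h2, h3⟩ := ih (hS.subset (by simp)) fun t ht => hρ t (by simp [ht])
    have hm := hρ s (by simp)
    have hd : Disjoint (S.biUnion id) s := by
      rw [disjoint_biUnion_left]
      intro t ht
      exact hS (by simp [ht]) (by simp) (by rintro rfl; exact hs ht)
    refine ⟨σ * ρ s, ⟨?_, ?_⟩, ?_, ?_⟩
    · intro u hu
      simp only [biUnion_insert, id, mem_union, not_or] at hu
      rw [Equiv.Perm.mul_apply, hm.fix u hu.1, h1.fix u hu.2]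
    · intro u
      by_cases hu : u ∈ s
      · rw [Equiv.Perm.mul_apply, Equiv.Perm.mul_apply,
          h1.fix _ (disjoint_right.mp hd (hm.mem hu))]
        exact hm.good u
      · rw [Equiv.Perm.mul_apply, Equiv.Perm.mul_apply, hm.fix u hu]
        exact h1.good u
    · intro t ht v hv
      rcases mem_insert.mp ht with rfl | ht
      · rw [Equiv.Perm.mul_apply, h1.fix _ (disjoint_right.mp hd (hm.mem hv))]
      · have : v ∉ s := disjoint_left.mp hd (mem_biUnion.mpr ⟨t, ht, hv⟩)
        rw [Equiv.Perm.mul_apply, hm.fix v this, h2 t ht v hv]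
    · rw [gain_mul_disjoint r h1 hm hd, h3, sum_insert hs, add_comm]

/-- A family of positive and negative integers has a zero-sum subfamily if both kinds are
numerous. -/
theorem exists_zero_sum {ι : Type*} [DecidableEq ι] (g : ι → ℤ) (K : ℕ) (P N : Finset ι)
    (hd : Disjoint P N) (hP : ∀ i ∈ P, 1 ≤ g i ∧ g i ≤ K) (hN : ∀ i ∈ N, 1 ≤ - g i ∧ - g i ≤ K)
    (hPc : K * K < P.card) (hNc : K * K < N.card) :
    ∃ S ⊆ P ∪ N, S.Nonempty ∧ ∑ i ∈ S, g i = 0 := by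
  have key : ∀ (T : Finset ι) (f : ι → ℤ), (∀ i ∈ T, 1 ≤ f i ∧ f i ≤ K) → K * K < T.card →
      ∃ a : ℕ, 1 ≤ a ∧ a ≤ K ∧ K < (T.filter fun i => f i = a).card := by
    intro T f hT hc
    obtain ⟨y, hy, h⟩ := exists_lt_card_fiber_of_mul_lt_card_of_maps_to
      (s := T) (t := Icc (1 : ℤ) K) (f := f) (n := K)
      (fun i hi => by simpa using hT i hi) (by simpa using hc)
    rw [mem_Icc] at hy
    lift y to ℕ using by omega
    exact ⟨y, by omega, by omega, h⟩
  -- By pigeonhole some value a occurs more than K times in P and some value -c more than K times in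
  -- N. As a, c ≤ K, there are c copies of a and a copies of -c, which cancel.
  obtain ⟨a, ha1, haK, ha⟩ := key P g hP hPc
  obtain ⟨c, hc1, hcK, hc⟩ := key N (fun i => - g i) hN hNc
  obtain ⟨P', hP', hP'c⟩ := exists_subset_card_eq (show c ≤ (P.filter fun i => g i = a).card by omega)
  obtain ⟨N', hN', hN'c⟩ := exists_subset_card_eq
    (show a ≤ (N.filter fun i => - g i = c).card by omega)
  refine ⟨P' ∪ N', union_subset_union (hP'.trans (filter_subset _ _)) (hN'.trans (filter_subset _ _)),
    ?_, ?_⟩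
  · have : P'.Nonempty := card_pos.mp (by omega)
    exact this.mono subset_union_left
  · rw [sum_union (disjoint_of_subset_left (hP'.trans (filter_subset _ _))
      (disjoint_of_subset_right (hN'.trans (filter_subset _ _)) hd)),
      sum_congr rfl (fun i hi => (mem_filter.mp (hP' hi)).2),
      sum_congr rfl (fun i hi => (show g i = - (c : ℤ) by have := (mem_filter.mp (hN' hi)).2; omega))]
    simp [hP'c, hN'c]; ring

end Exchange

end ExactMatching

/-! ### Cutting cycles into blocks, and the structure of long segments. -/

namespace ExactMatching

open Finset

set_option linter.unusedSectionVars false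

section Blocks

variable {V : Type*} [Fintype V] [DecidableEq V]

/-- The first `q` points of the orbit of `x`. -/
def orbitSegment (π : Equiv.Perm V) (x : V) (q : ℕ) : Finset V := (range q).image fun t => π^[t] x

/-- A block is a segment of an orbit; its length is below `2 * Q`, and it is a whole cycle unless
its length is at least `Q`. -/
def IsBlock (π : Equiv.Perm V) (Q : ℕ) (s : Finset V) : Prop :=
  ∃ x q, 0 < q ∧ q < 2 * Q ∧ Set.InjOn (fun t => π^[t] x) (Set.Iio q) ∧ s = orbitSegment π x q ∧
    (Q ≤ q ∨ π^[q] x = x)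

theorem card_orbitSegment {π : Equiv.Perm V} {x : V} {q : ℕ}
    (h : Set.InjOn (fun t => π^[t] x) (Set.Iio q)) : (orbitSegment π x q).card = q := by
  rw [orbitSegment, card_image_of_injOn (by simpa using h), card_range]

theorem IsBlock.card_lt {π : Equiv.Perm V} {Q : ℕ} {s : Finset V} (h : IsBlock π Q s) :
    s.card < 2 * Q := by
  obtain ⟨x, q, -, h1, h2, rfl, -⟩ := h
  rwa [card_orbitSegment h2]

/-- Segments of length Q are peeled off only while at least 2Q points are left, so the last piece
has length between Q and 2Q as well. -/
theorem exists_chop {π : Equiv.Perm V} {Q : ℕ} (hQ : 0 < Q) (q : ℕ) (x : V)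
    (hq : Set.InjOn (fun t => π^[t] x) (Set.Iio q)) (hQq : Q ≤ q) :
    ∃ B : Finset (Finset V), (B : Set (Finset V)).PairwiseDisjoint id ∧
      B.biUnion id = orbitSegment π x q ∧ ∀ s ∈ B, IsBlock π Q s := by
  induction q using Nat.strong_induction_on generalizing x with
  | _ q ih =>
    by_cases h : q < 2 * Q
    · refine ⟨{orbitSegment π x q}, by simp, by simp, ?_⟩
      intro s hs
      rw [mem_singleton] at hs
      exact ⟨x, q, by omega, h, hq, hs, Or.inl hQq⟩
    · obtain ⟨B, h1, h2, h3⟩ := ih (q - Q) (by omega) (π^[Q] x) (by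
        intro a ha c hc hac
        simp only [Set.mem_Iio] at ha hc
        simp only [← Function.iterate_add_apply] at hac
        have := hq (show a + Q ∈ Set.Iio q by simp; omega) (show c + Q ∈ Set.Iio q by simp; omega) hac
        omega) (by omega)
      have hd : Disjoint (orbitSegment π x Q) (B.biUnion id) := by
        rw [h2, disjoint_left]
        intro v hv hv'
        simp only [orbitSegment, mem_image, mem_range, ← Function.iterate_add_apply] at hv hv'
        obtain ⟨a, ha, rfl⟩ := hv
        obtain ⟨c, hc, hac⟩ := hv'
        have := hq (show c + Q ∈ Set.Iio q by simp; omega) (show a ∈ Set.Iio q by simp; omega) hac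
        omega
      refine ⟨insert (orbitSegment π x Q) B, ?_, ?_, ?_⟩
      · rw [coe_insert]
        apply h1.insert
        intro s hs _
        exact disjoint_of_subset_right (subset_biUnion_of_mem id hs) hd
      · rw [biUnion_insert, h2]
        ext v
        simp only [orbitSegment, id, mem_union, mem_image, mem_range, ← Function.iterate_add_apply]
        constructor
        · rintro (⟨a, ha, rfl⟩ | ⟨a, ha, rfl⟩)
          · exact ⟨a, by omega, rfl⟩
          · exact ⟨a + Q, by omega, rfl⟩
        · rintro ⟨a, ha, rfl⟩
          by_cases haQ : a < Q
          · exact Or.inl ⟨a, haQ, rfl⟩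
          · exact Or.inr ⟨a - Q, by omega, by congr 1; omega⟩
      · intro s hs
        rcases mem_insert.mp hs with rfl | hs
        · exact ⟨x, Q, hQ, by omega, hq.mono (Set.Iio_subset_Iio hQq), rfl, Or.inl le_rfl⟩
        · exact h3 s hs

theorem mem_orbitSegment_minimalPeriod {π : Equiv.Perm V} {x : V} {t : ℕ} :
    π^[t] x ∈ orbitSegment π x (Function.minimalPeriod π x) := by
  have hpos : 0 < Function.minimalPeriod π x :=
    Function.minimalPeriod_pos_of_mem_periodicPts
      (Function.mem_periodicPts.mpr ⟨orderOf π, orderOf_pos π, by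
        rw [Function.IsPeriodicPt, Function.IsFixedPt, Equiv.Perm.iterate_eq_pow, pow_orderOf_eq_one,
          Equiv.Perm.one_apply]⟩)
  rw [orbitSegment, mem_image]
  exact ⟨t % Function.minimalPeriod π x, mem_range.mpr (Nat.mod_lt _ hpos),
    Function.iterate_mod_minimalPeriod_eq⟩

/-- Induction on the size of T, removing the whole cycle of one point. Long cycles are chopped;
cycles shorter than Q are kept as blocks of their own. -/
theorem exists_blocks {π : Equiv.Perm V} {Q : ℕ} (hQ : 0 < Q) (T : Finset V)
    (hT : ∀ v, v ∈ T ↔ π v ∈ T) :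
    ∃ B : Finset (Finset V), (B : Set (Finset V)).PairwiseDisjoint id ∧
      B.biUnion id = T ∧ ∀ s ∈ B, IsBlock π Q s := by
  induction hc : T.card using Nat.strong_induction_on generalizing T with
  | _ n ih =>
    rcases T.eq_empty_or_nonempty with rfl | ⟨x, hx⟩
    · exact ⟨∅, by simp, by simp, by simp⟩
    · set p := Function.minimalPeriod π x with hp
      set C := orbitSegment π x p with hC
      have hxC : x ∈ C := mem_orbitSegment_minimalPeriod (t := 0)
      have hCne : 0 < p := by
        by_contra h
        rw [hC, show p = 0 by omega] at hxC
        simp [orbitSegment] at hxC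
      have hinj : Set.InjOn (fun t => π^[t] x) (Set.Iio p) :=
        Function.iterate_injOn_Iio_minimalPeriod
      have hCT : C ⊆ T := by
        intro v hv
        obtain ⟨t, -, rfl⟩ := mem_image.mp hv
        clear hv
        induction t with
        | zero => exact hx
        | succ t iht => rw [Function.iterate_succ_apply', ← hT]; exact iht
      have hCinv : ∀ v, v ∈ C ↔ π v ∈ C := by
        intro v
        constructor
        · intro hv
          obtain ⟨t, -, rfl⟩ := mem_image.mp hv
          rw [← Function.iterate_succ_apply' π]
          exact mem_orbitSegment_minimalPeriod
        · intro hv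
          obtain ⟨t, -, ht⟩ := mem_image.mp hv
          have : π (π^[t + p - 1] x) = π v := by
            rw [← Function.iterate_succ_apply' π, ← ht, show (t + p - 1).succ = t + p by omega]
            simp only [Function.iterate_add_apply]
            rw [Function.iterate_minimalPeriod]
          rw [← π.injective this]
          exact mem_orbitSegment_minimalPeriod
      have hB : ∃ B : Finset (Finset V), (B : Set (Finset V)).PairwiseDisjoint id ∧
          B.biUnion id = C ∧ ∀ s ∈ B, IsBlock π Q s := by
        by_cases h : Q ≤ p
        · exact exists_chop hQ p x hinj h
        · refine ⟨{C}, by simp, by simp, ?_⟩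
          intro s hs
          rw [mem_singleton] at hs
          exact ⟨x, p, hCne, by omega, hinj, hs, Or.inr Function.iterate_minimalPeriod⟩
      obtain ⟨B, h1, h2, h3⟩ := hB
      obtain ⟨B', g1, g2, g3⟩ := ih (T \ C).card (by
        rw [← hc]; exact card_lt_card (sdiff_ssubset hCT ⟨x, hxC⟩)) (T \ C) (by
        intro v; rw [mem_sdiff, mem_sdiff, ← hT, ← hCinv]) rfl
      refine ⟨B ∪ B', ?_, ?_, ?_⟩
      · rw [coe_union, Set.pairwiseDisjoint_union]
        refine ⟨h1, g1, ?_⟩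
        intro s hs t ht _
        refine disjoint_of_subset_left (subset_biUnion_of_mem id hs)
          (disjoint_of_subset_right (subset_biUnion_of_mem id ht) ?_)
        rw [h2, g2]; exact disjoint_sdiff
      · rw [union_biUnion, h2, g2, union_sdiff_of_subset hCT]
      · intro s hs
        rcases mem_union.mp hs with hs | hs
        · exact h3 s hs
        · exact g3 s hs

/-- A move inside `s` which restores the reference partner of some vertex. -/
structure IsShrink (E : V → V → Prop) (π : Equiv.Perm V) (s : Finset V) (ρ : Equiv.Perm V) : Prop
    extends IsMove E π s ρ where
  shrink : ∃ v ∈ s, π (ρ v) = v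

theorem abs_gain_sub_le {E : V → V → Prop} {r : V → V → ℤ} (hr : ∀ u v, r u v = 0 ∨ r u v = 1)
    {θ ρ : Equiv.Perm V} {s : Finset V} (h : IsMove E θ s ρ) :
    |gain r (θ * ρ) - gain r θ| ≤ s.card := by
  rw [gain, gain, ← sum_sub_distrib, ← sum_subset (subset_univ s)]
  · refine (abs_sum_le_sum_abs _ _).trans ((sum_le_card_nsmul s _ 1 ?_).trans (by simp))
    intro v _
    rw [abs_le]
    rcases hr v ((θ * ρ) v) with h1 | h1 <;> rcases hr v (θ v) with h2 | h2 <;> rw [h1, h2] <;> omega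
  · intro v _ hv
    rw [Equiv.Perm.mul_apply, h.fix v hv]; ring

theorem pre_lipschitz {r : V → V → ℤ} (hr : ∀ u v, r u v = 0 ∨ r u v = 1) (v : ℕ → V) {a c : ℕ}
    (h : a ≤ c) : |pre r v c - pre r v a| ≤ c - a := by
  induction c, h using Nat.le_induction with
  | base => simp
  | succ c hac ih =>
    rw [pre_succ, abs_le] at *
    push_cast
    rcases hr (v c) (v (c + 1)) with h1 | h1 <;> rcases hr (v c) (v c) with h2 | h2 <;>
      rw [h1, h2] <;> constructor <;> linarith [ih.1, ih.2]

/-- In a long segment that admits no move of gain zero and no move of negative gain, there is a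
move of positive gain, and the segment has negative weight or a local cycle of weight one. -/
theorem long_segment {E : V → V → Prop} (hE : ∀ v, E v v) {r : V → V → ℤ}
    (hr : ∀ u v, r u v = 0 ∨ r u v = 1) {b : ℕ} (hb : Dense E b) {π : Equiv.Perm V}
    (hπ : Good E π) {x : V} {q : ℕ} (hinj : Set.InjOn (fun t => π^[t] x) (Set.Iio q))
    (hq : 12 * (b + 1) * (4 * b + 4) < q)
    (h0 : ∀ ρ, IsShrink E π (orbitSegment π x q) ρ → 1 ≤ gain r (π * ρ) - gain r π) :
    (∃ ρ, IsShrink E π (orbitSegment π x q) ρ) ∧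
    (pre r (fun t => π^[t] x) q ≤ -1 ∨
      ∃ κ, IsMove E 1 (orbitSegment π x q) κ ∧ gain r κ = 1) := by
  set v : ℕ → V := fun t => π^[t] x with hv
  set s := orbitSegment π x q with hs
  have hstep : ∀ t, π (v t) = v (t + 1) := fun t => (Function.iterate_succ_apply' π t x).symm
  have hmem : ∀ t, t < q → v t ∈ s := fun t ht => mem_image.mpr ⟨t, mem_range.mpr ht, rfl⟩
  have hsub : ∀ i j, j < q → Set.InjOn v (Set.Icc i j) := fun i j hj =>
    hinj.mono fun t ht => lt_of_le_of_lt ht.2 hj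
  -- a skip
  have skip : ∀ i j, i + 2 ≤ j → j < q → E (v i) (v j) → ∃ ρ, IsShrink E π s ρ ∧
      gain r (π * ρ) - gain r π =
        r (v i) (v j) - r (v i) (v i) - (pre r v j - pre r v i) := by
    intro i j hij hj he
    obtain ⟨ρ, h1, h2, h3, h4⟩ := exists_skip hE r hij (hsub i j hj) he hπ fun t _ _ => hstep t
    refine ⟨ρ, ⟨⟨fun u hu => h1 u ?_, h2⟩, v (i + 1), hmem _ (by omega), h4⟩, h3⟩
    rintro t g1 g2 rfl
    exact hu (hmem t (by omega))
  have skip1 : ∀ i j, i + 2 ≤ j → j < q → E (v i) (v j) →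
      1 ≤ r (v i) (v j) - r (v i) (v i) - (pre r v j - pre r v i) := by
    intro i j hij hj he
    obtain ⟨ρ, h1, h2⟩ := skip i j hij hj he
    rw [← h2]; exact h0 ρ h1
  have hlip : ∀ a c : ℕ, a ≤ c → -((c : ℤ) - a) ≤ pre r v c - pre r v a ∧
      pre r v c - pre r v a ≤ c - a := fun a c hac => abs_le.mp (pre_lipschitz hr v hac)
  -- If the prefix weight rose by 2b+2, then i and j would be at least that far apart, and density
  -- would give a chord from within b after i to within b before j. The prefix weight still rises by
  -- at least 2 along the chord, so skipping would have negative gain.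
  have noAscent : ∀ i j, i < j → j < q → pre r v j - pre r v i < 2 * b + 2 := by
    intro i j hij hj
    by_contra hcon
    have := (hlip i j hij.le).2
    obtain ⟨i', j', h1, h2, h3, h4, h5⟩ := hb.exists_edge hinj (s := i) (t := j - b)
      (by omega) (by omega)
    have e1 := skip1 i' j' (by omega) (by omega) h5
    have e2 := (hlip i i' h1).2
    have e3 := (hlip j' j (by omega)).2
    rcases hr (v i') (v j') with h | h <;> rcases hr (v i') (v i') with g | g <;>
      rw [h, g] at e1 <;> omega
  -- Either some prefix weight recurs often, with the same colour of the reference edge, or the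
  -- prefix weights spread over a wide range.
  by_cases hflat : ∃ a c : ℤ, 4 * b + 4 <
      ((range q).filter fun t => pre r v t = a ∧ r (v t) (v t) = c).card
  · obtain ⟨a, c, hac⟩ := hflat
    obtain ⟨P, hP, hPc⟩ := exists_subset_card_eq (Nat.succ_le_of_lt hac)
    have hPe : ∃ p : ℕ → ℕ, (∀ i j, i < j → j < 4 * b + 5 → p i < p j) ∧
        ∀ i, i < 4 * b + 5 → p i ∈ P := by
      refine ⟨fun i => if h : i < 4 * b + 5 then P.orderEmbOfFin hPc ⟨i, h⟩ else 0, ?_, ?_⟩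
      · intro i j hij hj
        simp only [hj, show i < 4 * b + 5 by omega, dif_pos]
        exact (P.orderEmbOfFin hPc).strictMono hij
      · intro i hi
        simp only [hi, dif_pos]
        exact P.orderEmbOfFin_mem hPc _
    obtain ⟨p, hp, hpP⟩ := hPe
    have hpQ : ∀ i, i < 4 * b + 5 → p i < q ∧ pre r v (p i) = a ∧ r (v (p i)) (v (p i)) = c := by
      intro i hi
      have := hP (hpP i hi)
      simpa using this
    have hpinj : Set.InjOn (fun i => v (p i)) (Set.Iio (4 * b + 5)) := by
      intro i hi j hj hij
      simp only [Set.mem_Iio] at hi hj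
      have := hinj (hpQ i hi).1 (hpQ j hj).1 hij
      by_contra hne
      rcases Nat.lt_or_gt_of_ne hne with h | h
      · have := hp i j h hj; omega
      · have := hp j i h hi; omega
    -- The 4b+5 positions consist of four windows of b+1 and one spare index. They yield nested
    -- indices i0 < i < j < j0 with a forward chord from i to j and a backward chord from j0 to i0;
    -- the spare index 2b+2 keeps i and j at least two apart.
    obtain ⟨i, j, h1, h2, h3, h4, h5⟩ := hb.exists_edge hpinj (s := b + 1) (t := 2 * b + 3)
      (by omega) (by omega)
    obtain ⟨j0, i0, g1, g2, g3, g4, g5⟩ := hb.exists_edge hpinj (s := 3 * b + 4) (t := 0)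
      (by omega) (by omega)
    have o1 := hp i0 i (by omega) (by omega)
    have o2 := hp i (i + 1) (by omega) (by omega)
    have o2' := hp (i + 1) j (by omega) (by omega)
    have o3 := hp j j0 (by omega) (by omega)
    obtain ⟨qi, ai, ci⟩ := hpQ i (by omega)
    obtain ⟨qj, aj, cj⟩ := hpQ j (by omega)
    obtain ⟨qi0, ai0, ci0⟩ := hpQ i0 (by omega)
    obtain ⟨qj0, aj0, cj0⟩ := hpQ j0 (by omega)
    obtain ⟨ρ, hρ, hρg⟩ := skip (p i) (p j) (by omega) qj h5
    have e1 := skip1 (p i) (p j) (by omega) qj h5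
    -- Prefix weights agree at both ends, so the skip has gain `r (v (p i)) (v (p j)) - c`. For this
    -- to be at least 1 the chord must be red and the reference edges at all chosen positions blue.
    have hc0 : c = 0 ∧ r (v (p i)) (v (p j)) = 1 := by
      rw [ai, aj, ci] at e1
      rcases hr (v (p i)) (v (p j)) with h | h <;> rcases hr (v (p i)) (v (p i)) with g | g <;>
        rw [h] at e1 <;> rw [ci] at g <;> omega
    obtain ⟨rfl, hrij⟩ := hc0
    refine ⟨⟨ρ, hρ⟩, Or.inr ?_⟩
    obtain ⟨κ, k1, k2, k3⟩ := exists_segment_cycle (v := v) (a := p i0) (c := p j0) (by omega)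
      (hsub _ _ qj0)
    have kg := gain_segment_cycle r (by omega) (hsub _ _ qj0) k1 k2 k3
    have kgood : Good E κ := good_segment_cycle hE k1 k2 k3 g5 fun t _ _ => by
      rw [← hstep]; exact hπ _
    have kfix : ∀ u, u ∉ s → κ u = u := by
      intro u hu
      apply k3
      rintro t _ g2 rfl
      exact hu (hmem t (by omega))
    rw [ai0, aj0, cj0] at kg
    -- The cycle closed by the backward chord has the value of that chord as its gain. If the chord
    -- is red, this is 1. If it is blue, the gain is 0, and skipping along the red forward chord
    -- inside the cycle raises it to 1.
    rcases hr (v (p j0)) (v (p i0)) with h | h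
    · obtain ⟨τ, t1, t2, t3, t4⟩ := exists_skip hE r (i := p i) (j := p j) (by omega)
        (hsub _ _ qj) h5 kgood fun t g1 g2 => k1 t (by omega) (by omega)
      refine ⟨κ * τ, ⟨?_, by simpa using t2⟩, ?_⟩
      · intro u hu
        rw [Equiv.Perm.mul_apply, t1 u, kfix u hu]
        rintro t _ g2 rfl
        exact hu (hmem t (by omega))
      · rw [ai, aj, ci, hrij] at t3
        rw [h] at kg
        linarith
    · exact ⟨κ, ⟨kfix, by simpa using kgood⟩, by rw [kg, h]; ring⟩
  · push Not at hflat
    have hne : (range q).Nonempty := ⟨0, by simp; omega⟩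
    obtain ⟨i, hi, himax⟩ := exists_max_image (range q) (pre r v) hne
    obtain ⟨j, hj, hjmin⟩ := exists_min_image (range q) (pre r v) hne
    rw [mem_range] at hi hj
    -- Each pair of a prefix weight and a reference colour occurs at most 4b+4 times. With at most
    -- 6(b+1) prefix weights and two colours, q could not exceed 12(b+1)(4b+4).
    have hrange : 6 * (b + 1) ≤ pre r v i - pre r v j := by
      by_contra hcon
      push Not at hcon
      have : (range q).card ≤ (4 * b + 4) * ((Icc (pre r v j) (pre r v i)) ×ˢ
          ({0, 1} : Finset ℤ)).card := by
        apply card_le_mul_card_image_of_maps_to (f := fun t => (pre r v t, r (v t) (v t)))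
        · intro t ht
          simp only [mem_product, mem_Icc, mem_insert, mem_singleton]
          exact ⟨⟨hjmin t ht, himax t ht⟩, hr _ _⟩
        · rintro ⟨a, c⟩ _
          simpa using hflat a c
      rw [card_range, card_product, Int.card_Icc] at this
      have h2 : ({0, 1} : Finset ℤ).card = 2 := by decide
      have h3 : (pre r v i + 1 - pre r v j).toNat ≤ 6 * (b + 1) := by omega
      rw [h2] at this
      have h4 : (4 * b + 4) * ((pre r v i + 1 - pre r v j).toNat * 2) ≤
          (4 * b + 4) * ((6 * (b + 1)) * 2) := by gcongr
      nlinarith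
    have hij : i < j := by
      rcases lt_trichotomy i j with h | h | h
      · exact h
      · subst h; omega
      · have := noAscent j i h hi; omega
    constructor
    · have := (hlip i j hij.le).1
      obtain ⟨i', j', h1, h2, h3, h4, h5⟩ := hb.exists_edge hinj (s := i) (t := j - b)
        (by omega) (by omega)
      obtain ⟨ρ, hρ, -⟩ := skip i' j' (by omega) (by omega) h5
      exact ⟨ρ, hρ⟩
    -- The walk starts at 0, rises by less than 2b+2 to its maximum, drops by at least 6(b+1) to its
    -- minimum, again rises by less than 2b+2, and makes one last step of size at most 1. It
    -- therefore ends below zero.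
    · left
      have e1 : pre r v i - pre r v 0 < 2 * b + 2 := by
        rcases Nat.eq_zero_or_pos i with rfl | h
        · omega
        · exact noAscent 0 i h hi
      have e2 : pre r v (q - 1) - pre r v j < 2 * b + 2 := by
        rcases Nat.lt_or_ge j (q - 1) with h | h
        · exact noAscent j (q - 1) h (by omega)
        · rw [show q - 1 = j by omega]; omega
      have e3 := (hlip (q - 1) q (by omega)).2
      have e4 : pre r v 0 = 0 := by simp [pre]
      push_cast [show 1 ≤ q by omega] at e3
      omega

end Blocks

end ExactMatching

/-! ### Nearby solutions, and shortening the distance of two perfect matchings. -/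

namespace ExactMatching

open Finset

set_option linter.unusedSectionVars false

section Near

variable {V : Type*} [Fintype V] [DecidableEq V]

/-- The length from which a segment of an orbit is rich in shortcuts. -/
def blockLen (b : ℕ) : ℕ := 12 * (b + 1) * (4 * b + 4) + 1

theorem sum_orbitSegment (r : V → V → ℤ) {π : Equiv.Perm V} {x : V} {q : ℕ}
    (hinj : Set.InjOn (fun t => π^[t] x) (Set.Iio q)) :
    ∑ v ∈ orbitSegment π x q, (r v (π v) - r v v) = pre r (fun t => π^[t] x) q := by
  rw [orbitSegment, sum_image (by simpa using hinj), pre]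
  apply sum_congr rfl
  intro t _
  rw [Function.iterate_succ_apply']

/-- Long blocks are covered by `long_segment`. A shorter block is a whole cycle, and restoring the
reference on all of it is a move whose gain is minus the weight of the block; by hypothesis this is
at least 1. -/
theorem block_dichotomy {E : V → V → Prop} (hE : ∀ v, E v v) {r : V → V → ℤ}
    (hr : ∀ u v, r u v = 0 ∨ r u v = 1) {b : ℕ} (hb : Dense E b) {π : Equiv.Perm V}
    (hπ : Good E π) {s : Finset V} (hs : IsBlock π (blockLen b) s)
    (h0 : ∀ ρ, IsShrink E π s ρ → 1 ≤ gain r (π * ρ) - gain r π) :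
    (∃ ρ, IsShrink E π s ρ) ∧
    (∑ v ∈ s, (r v (π v) - r v v) ≤ -1 ∨ ∃ κ, IsMove E 1 s κ ∧ gain r κ = 1) := by
  obtain ⟨x, q, hq0, hq1, hinj, rfl, hq⟩ := hs
  rw [sum_orbitSegment r hinj]
  by_cases hlong : blockLen b ≤ q
  · exact long_segment hE hr hb hπ hinj (Nat.lt_of_succ_le hlong) h0
  have hclosed := hq.resolve_left hlong
  set v : ℕ → V := fun t => π^[t] x with hv
  have hstep : ∀ t, π (v t) = v (t + 1) := fun t => (Function.iterate_succ_apply' π t x).symm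
  have hinj' : Set.InjOn v (Set.Icc 0 (q - 1)) := hinj.mono fun t ht => by
    have := ht.2; simp; omega
  obtain ⟨κ, k1, k2, k3⟩ := exists_segment_cycle (v := v) (Nat.zero_le (q - 1)) hinj'
  have hlast : v (q - 1 + 1) = v 0 := by rw [Nat.sub_add_cancel hq0]; exact hclosed
  have hκ : ∀ t, t < q → κ (v t) = π (v t) := by
    intro t ht
    rw [hstep]
    rcases Nat.lt_or_ge t (q - 1) with h | h
    · exact k1 t (Nat.zero_le _) h
    · obtain rfl : t = q - 1 := by omega
      rw [k2, hlast]
  have hsurj : ∀ t, t < q → π (κ⁻¹ (v t)) = v t := by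
    intro t ht
    obtain ⟨t', ht', h⟩ : ∃ t' < q, v t = κ (v t') := by
      rcases Nat.eq_zero_or_pos t with rfl | h
      · exact ⟨q - 1, by omega, k2.symm⟩
      · refine ⟨t - 1, by omega, ?_⟩
        rw [k1 (t - 1) (Nat.zero_le _) (by omega), Nat.sub_add_cancel h]
    rw [h, show κ⁻¹ (κ (v t')) = v t' from κ.symm_apply_apply _, hκ t' ht']
  have kfix : ∀ u, u ∉ orbitSegment π x q → κ⁻¹ u = u := by
    intro u hu
    rw [Equiv.Perm.inv_eq_iff_eq, k3 u]
    rintro t _ h rfl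
    exact hu (mem_image.mpr ⟨t, mem_range.mpr (by omega), rfl⟩)
  have hshr : IsShrink E π (orbitSegment π x q) κ⁻¹ := by
    refine ⟨⟨kfix, ?_⟩, v 0, mem_image.mpr ⟨0, mem_range.mpr hq0, rfl⟩, hsurj 0 hq0⟩
    intro u
    rw [Equiv.Perm.mul_apply]
    by_cases hu : u ∈ orbitSegment π x q
    · obtain ⟨t, ht, rfl⟩ := mem_image.mp hu
      rw [hsurj t (mem_range.mp ht)]; exact hE _
    · rw [kfix u hu]; exact hπ u
  refine ⟨⟨_, hshr⟩, Or.inl ?_⟩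
  have h1 := h0 _ hshr
  have h2 : gain r (π * κ⁻¹) - gain r π = - pre r v q := by
    rw [← sum_orbitSegment r hinj, gain, gain, ← sum_sub_distrib,
      ← sum_subset (subset_univ (orbitSegment π x q)), ← sum_neg_distrib]
    · apply sum_congr rfl
      intro u hu
      obtain ⟨t, ht, rfl⟩ := mem_image.mp hu
      rw [Equiv.Perm.mul_apply, hsurj t (mem_range.mp ht)]; ring
    · intro u _ hu
      rw [Equiv.Perm.mul_apply, kfix u hu]; ring
  omega

theorem gain_compl (r : V → V → ℤ) (π : Equiv.Perm V) :
    gain (fun u v => 1 - r u v) π = - gain r π := by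
  rw [gain, gain, ← sum_neg_distrib]
  exact sum_congr rfl fun v _ => by ring

/-- A bound for the distance of the nearest solution. -/
def nearBound (b L : ℕ) : ℕ :=
  2 * blockLen b * (2 * blockLen b + 1) * (2 * (2 * blockLen b * (2 * blockLen b) + 1) + 3 * L)

theorem card_biUnion_blocks_le {π : Equiv.Perm V} {Q : ℕ} {B : Finset (Finset V)}
    (hB : ∀ s ∈ B, IsBlock π Q s) : (B.biUnion id).card ≤ B.card * (2 * Q) :=
  card_biUnion_le_card_mul _ _ _ fun s hs => (hB s hs).card_lt.le

/-- The sum over a finite set of bounded integers most of which are at most `-1`. -/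
theorem sum_le_of_mostly_neg {ι : Type*} [DecidableEq ι] (B X : Finset ι) (f : ι → ℤ) (K : ℕ)
    (hK : ∀ i ∈ B, f i ≤ K) (hX : ∀ i ∈ B, i ∉ X → f i ≤ -1) :
    ∑ i ∈ B, f i + B.card ≤ X.card * (K + 1) := by
  have : ∀ i ∈ B, f i + 1 ≤ if i ∈ X then (K + 1 : ℤ) else 0 := by
    intro i hi
    split_ifs with h
    · have := hK i hi; omega
    · have := hX i hi h; omega
  have h1 := sum_le_sum this
  rw [sum_add_distrib, ← sum_filter, sum_const, sum_const, nsmul_eq_mul, nsmul_eq_mul, mul_one] at h1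
  refine h1.trans ?_
  have : (B.filter fun i => i ∈ X).card ≤ X.card := card_le_card fun i hi => (mem_filter.mp hi).2
  gcongr

/-- If there is a solution, and there are nearby perfect matchings on both sides of the target,
then there is a nearby solution. -/
theorem exists_near_solution {E : V → V → Prop} (hE : ∀ v, E v v) {r : V → V → ℤ}
    (hr : ∀ u v, r u v = 0 ∨ r u v = 1) {b : ℕ} (hb : Dense E b) {L : ℕ} {d : ℕ}
    {τ : Equiv.Perm V} (hτ : Good E τ) (hτL : τ.support.card ≤ L) (hτd : d ≤ gain r τ)
    {π₀ : Equiv.Perm V} (hπ₀ : Good E π₀) (hπ₀d : gain r π₀ = d) :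
    ∃ π, Good E π ∧ gain r π = d ∧ π.support.card ≤ nearBound b L := by
  classical
  obtain ⟨π, hπ, hmin⟩ := exists_min_image
    ((univ : Finset (Equiv.Perm V)).filter fun π => Good E π ∧ gain r π = d)
    (fun π => π.support.card) ⟨π₀, by simp [hπ₀, hπ₀d]⟩
  simp only [mem_filter, mem_univ, true_and] at hπ hmin
  obtain ⟨hπ, hπd⟩ := hπ
  by_contra hno
  push Not at hno
  set Q := blockLen b with hQ
  set K := 2 * Q with hK
  have hQ1 : 1 ≤ Q := by rw [hQ, blockLen]; omega
  have hgτ : gain r τ ≤ L := by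
    have h1 : IsMove E 1 τ.support τ := ⟨fun u hu => Equiv.Perm.notMem_support.mp hu, by simpa using hτ⟩
    have := abs_gain_sub_le hr h1
    rw [one_mul, gain_one, sub_zero] at this
    have := (abs_le.mp this).2
    omega
  obtain ⟨B, hBd, hBU, hB⟩ := exists_blocks (π := π) (Q := Q) hQ1 π.support fun v => by
    rw [Equiv.Perm.mem_support, Equiv.Perm.mem_support]
    exact not_congr π.injective.eq_iff.symm
  have hBsub : ∀ s ∈ B, s ⊆ π.support := fun s hs => hBU ▸ subset_biUnion_of_mem id hs
  have hcard : ∀ s ∈ B, s.card ≤ K := fun s hs => (hB s hs).card_lt.le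
  -- no nonempty family of moves has total gain zero
  have hzero : ∀ S ⊆ B, S.Nonempty → ∀ ρ : Finset V → Equiv.Perm V, (∀ s ∈ S, IsShrink E π s (ρ s)) →
      ∑ s ∈ S, (gain r (π * ρ s) - gain r π) ≠ 0 := by
    rintro S hS ⟨s, hs⟩ ρ hρ hsum
    obtain ⟨σ, h1, h2, h3⟩ := exists_combined_move r hπ S (hBd.subset hS) ρ
      fun s hs => (hρ s hs).toIsMove
    obtain ⟨v, hv, hv'⟩ := (hρ s hs).shrink
    -- The combined move acts inside the support of π and turns `v` into a fixed point, so the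
    -- support shrinks strictly.
    have hlt : (π * σ).support.card < π.support.card := by
      apply card_lt_card
      rw [ssubset_iff_of_subset]
      · refine ⟨v, hBsub s (hS hs) hv, ?_⟩
        rw [Equiv.Perm.notMem_support, Equiv.Perm.mul_apply, h2 s hs v hv, hv']
      · intro u hu
        by_contra hn
        rw [Equiv.Perm.mem_support, Equiv.Perm.mul_apply, h1.fix, ← Equiv.Perm.mem_support] at hu
        · exact hn hu
        · intro h
          obtain ⟨t, ht, ht'⟩ := mem_biUnion.mp h
          exact hn (hBsub t (hS ht) ht')
    have := hmin (π * σ) ⟨h1.good, by rw [hsum] at h3; omega⟩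
    omega
  have hne : ∀ s ∈ B, ∀ ρ, IsShrink E π s ρ → gain r (π * ρ) - gain r π ≠ 0 := by
    intro s hs ρ hρ
    have := hzero {s} (by simpa using hs) ⟨s, by simp⟩ (fun _ => ρ) (by simpa using hρ)
    simpa using this
  have hnet : ∑ s ∈ B, ∑ v ∈ s, (r v (π v) - r v v) = d := by
    rw [← hπd, gain]
    refine (sum_biUnion (f := fun v => r v (π v) - r v v) (t := id) hBd).symm.trans ?_
    rw [hBU]
    apply sum_subset (subset_univ _)
    intro v _ hv
    rw [Equiv.Perm.notMem_support.mp hv, sub_self]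
  have hnetK : ∀ s ∈ B, |∑ v ∈ s, (r v (π v) - r v v)| ≤ K := by
    intro s hs
    refine (abs_sum_le_sum_abs _ _).trans ((sum_le_card_nsmul s _ 1 ?_).trans ?_)
    · intro v _
      rw [abs_le]
      rcases hr v (π v) with h1 | h1 <;> rcases hr v v with h2 | h2 <;> rw [h1, h2] <;> omega
    · have := hcard s hs; simp; omega
  have hBcard : π.support.card ≤ B.card * K := hBU ▸ card_biUnion_blocks_le hB
  have hLarge := hno π hπ hπd
  rw [nearBound, ← hQ, ← hK] at hLarge
  -- Blocks have at most K points, so a support larger than `nearBound` forces more blocks than the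
  -- bound reached by the counting at the end of either case below.
  have hBbig : (K + 1) * (2 * (K * K + 1) + 3 * L) < B.card := by
    by_contra h
    push Not at h
    have h1 := Nat.mul_le_mul_right K h
    have h2 : (K + 1) * (2 * (K * K + 1) + 3 * L) * K = K * (K + 1) * (2 * (K * K + 1) + 3 * L) := by
      ring
    omega
  have hdL : d ≤ L := by omega
  set Pos := B.filter fun s => ∃ ρ, IsShrink E π s ρ ∧ 1 ≤ gain r (π * ρ) - gain r π with hPos
  set Neg := B.filter fun s => ∃ ρ, IsShrink E π s ρ ∧ 1 ≤ -(gain r (π * ρ) - gain r π) with hNeg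
  -- A block may have moves of both signs. Reserving K²+1 blocks for positive moves still leaves
  -- more than K² others for negative ones, as `exists_zero_sum` requires.
  have hsmall : Pos.card < 2 * (K * K + 1) ∨ Neg.card < 2 * (K * K + 1) := by
    by_contra hcon
    push Not at hcon
    obtain ⟨P', hP', hP'c⟩ := exists_subset_card_eq (show K * K + 1 ≤ Pos.card by omega)
    have hN'c : K * K < (Neg \ P').card := by
      have := le_card_sdiff P' Neg; omega
    have hch : ∀ s ∈ P' ∪ (Neg \ P'), s ∈ B ∧ ∃ ρ, IsShrink E π s ρ ∧
        (s ∈ P' → 1 ≤ gain r (π * ρ) - gain r π) ∧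
        (s ∉ P' → 1 ≤ -(gain r (π * ρ) - gain r π)) := by
      intro s hs
      by_cases h : s ∈ P'
      · obtain ⟨hB, ρ, h1, h2⟩ := mem_filter.mp (hP' h)
        exact ⟨hB, ρ, h1, fun _ => h2, fun h' => absurd h h'⟩
      · obtain ⟨hB, ρ, h1, h2⟩ := mem_filter.mp (mem_sdiff.mp ((mem_union.mp hs).resolve_left h)).1
        exact ⟨hB, ρ, h1, fun h' => absurd h' h, fun _ => h2⟩
    have : ∀ s : Finset V, ∃ ρ, s ∈ P' ∪ (Neg \ P') → s ∈ B ∧ IsShrink E π s ρ ∧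
        (s ∈ P' → 1 ≤ gain r (π * ρ) - gain r π) ∧
        (s ∉ P' → 1 ≤ -(gain r (π * ρ) - gain r π)) := by
      intro s
      by_cases hs : s ∈ P' ∪ (Neg \ P')
      · obtain ⟨h1, ρ, h2⟩ := hch s hs
        exact ⟨ρ, fun _ => ⟨h1, h2⟩⟩
      · exact ⟨1, fun h => absurd h hs⟩
    choose ρ hρ using this
    have hbd : ∀ s ∈ P' ∪ (Neg \ P'), |gain r (π * ρ s) - gain r π| ≤ K := by
      intro s hs
      have h1 := abs_gain_sub_le hr (hρ s hs).2.1.toIsMove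
      have h2 := hcard s (hρ s hs).1
      omega
    obtain ⟨S, hS, hSne, hS0⟩ := exists_zero_sum (fun s => gain r (π * ρ s) - gain r π) K P' (Neg \ P')
      disjoint_sdiff
      (fun s hs => by
        have h := mem_union_left (Neg \ P') hs
        exact ⟨(hρ s h).2.2.1 hs, (abs_le.mp (hbd s h)).2⟩)
      (fun s hs => by
        have h := mem_union_right P' hs
        refine ⟨(hρ s h).2.2.2 (mem_sdiff.mp hs).2, ?_⟩
        have := (abs_le.mp (hbd s h)).1
        omega)
      (by omega) hN'c
    exact hzero S (fun s hs => (hρ s (hS hs)).1) hSne ρ (fun s hs => (hρ s (hS hs)).2.1) hS0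
  -- many local cycles of weight one
  have hlocal : ∀ (θ : Equiv.Perm V) (e : ℤ) (C : Finset (Finset V)) (n : ℕ), C ⊆ B → Good E θ →
      n ≤ C.card → (∀ s ∈ C, ∀ v ∈ s, θ v = v) →
      (∀ s ∈ C, ∃ κ, IsMove E 1 s κ ∧ gain r κ = e) →
      ∃ π, Good E π ∧ gain r π = gain r θ + n * e ∧ π.support.card ≤ θ.support.card + n * K := by
    intro θ e C n hCB hθ hn hfix hC
    obtain ⟨C', hC', hC'n⟩ := exists_subset_card_eq hn
    have : ∀ s : Finset V, ∃ κ, s ∈ C → IsMove E 1 s κ ∧ gain r κ = e := by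
      intro s
      by_cases hs : s ∈ C
      · obtain ⟨κ, h⟩ := hC s hs; exact ⟨κ, fun _ => h⟩
      · exact ⟨1, fun h => absurd h hs⟩
    choose κ hκ using this
    have hsame : ∀ s ∈ C, ∀ v ∈ s, θ (κ s v) = κ s v := fun s hs v hv =>
      hfix s hs _ ((hκ s hs).1.mem hv)
    have hmv : ∀ s ∈ C, IsMove E θ s (κ s) := by
      intro s hs
      refine ⟨(hκ s hs).1.fix, fun v => ?_⟩
      by_cases hv : v ∈ s
      · rw [Equiv.Perm.mul_apply, hsame s hs v hv]; exact (hκ s hs).1.good v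
      · rw [Equiv.Perm.mul_apply, (hκ s hs).1.fix v hv]; exact hθ v
    have hgn : ∀ s ∈ C, gain r (θ * κ s) - gain r θ = e := by
      intro s hs
      rw [← (hκ s hs).2, gain, gain, gain, ← sum_sub_distrib]
      apply sum_congr rfl
      intro v _
      by_cases hv : v ∈ s
      · rw [Equiv.Perm.mul_apply, hsame s hs v hv, hfix s hs v hv]; ring
      · rw [Equiv.Perm.mul_apply, (hκ s hs).1.fix v hv]; ring
    obtain ⟨σ, h1, -, h3⟩ := exists_combined_move r hθ C' (hBd.subset (hC'.trans hCB)) κ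
      fun s hs => hmv s (hC' hs)
    refine ⟨θ * σ, h1.good, ?_, ?_⟩
    · rw [sum_congr rfl (fun s hs => hgn s (hC' hs)), sum_const, hC'n, nsmul_eq_mul] at h3
      linarith
    · have : (θ * σ).support ⊆ θ.support ∪ C'.biUnion id := by
        intro v hv
        rw [mem_union]
        by_contra hn
        push Not at hn
        rw [Equiv.Perm.mem_support, Equiv.Perm.mul_apply, h1.fix v hn.2] at hv
        exact hn.1 (Equiv.Perm.mem_support.mpr hv)
      refine (card_le_card this).trans ((card_union_le _ _).trans ?_)
      have := card_biUnion_blocks_le fun s hs => hB s (hCB (hC' hs))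
      rw [hC'n, ← hK] at this
      omega
  have hboundK : L + L * K ≤ K * (K + 1) * (2 * (K * K + 1) + 3 * L) := by
    have hK1 : 1 ≤ K := by omega
    calc L + L * K = 1 * (K + 1) * L := by ring
      _ ≤ K * (K + 1) * (2 * (K * K + 1) + 3 * L) := by gcongr; omega
  have hdK : d * K ≤ L * K := Nat.mul_le_mul_right _ hdL
  rcases hsmall with hsmall | hsmall
  · -- few blocks with a move of positive gain
    set C := B.filter fun s => ∃ κ, IsMove E 1 s κ ∧ gain r κ = -1 with hC
    -- The blocks are disjoint, so at most L of them meet the support of τ. Of 2L blocks with a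
    -- local cycle of gain -1, at least L are thus untouched by τ, and applying `gain r τ - d ≤ L`
    -- of these cycles to τ gives a nearby solution.
    have hCc : C.card < 2 * L := by
      by_contra hcon
      push Not at hcon
      set D := C.filter fun s => Disjoint s τ.support with hD
      have hDc : L ≤ D.card := by
        have h1 : (C.filter fun s => ¬ Disjoint s τ.support).card ≤ τ.support.card := by
          have : ∀ s ∈ C.filter (fun s => ¬ Disjoint s τ.support), ∃ v ∈ s, v ∈ τ.support :=
            fun s hs => not_disjoint_iff.mp (mem_filter.mp hs).2
          have hV : Nonempty V := (card_pos.mp (Nat.zero_lt_of_lt hLarge)).to_type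
          choose! f hf using this
          apply card_le_card_of_injOn f (fun s hs => (hf s hs).2)
          intro s hs t ht hst
          by_contra hne
          have hs' := (mem_filter.mp (mem_filter.mp hs).1).1
          have ht' := (mem_filter.mp (mem_filter.mp ht).1).1
          have := hBd hs' ht' hne
          exact disjoint_left.mp this (hf s hs).1 (hst ▸ (hf t ht).1)
        have h2 : D.card + (C.filter fun s => ¬ Disjoint s τ.support).card = C.card := by
          rw [hD]
          convert card_filter_add_card_filter_not (s := C) (fun s => Disjoint s τ.support)
        omega
      obtain ⟨e, he⟩ : ∃ e : ℕ, gain r τ = d + e := ⟨(gain r τ - d).toNat, by omega⟩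
      obtain ⟨π', h1, h2, h3⟩ := hlocal τ (-1) D e
        ((filter_subset _ _).trans (filter_subset _ _)) hτ (by omega)
        (fun s hs v hv => Equiv.Perm.notMem_support.mp (disjoint_left.mp (mem_filter.mp hs).2 hv))
        (fun s hs => (mem_filter.mp (mem_filter.mp hs).1).2)
      have := hno π' h1 (by rw [h2, he]; ring)
      rw [nearBound, ← hQ, ← hK] at this
      have : e * K ≤ L * K := Nat.mul_le_mul_right _ (by omega)
      omega
    have hsum := sum_le_of_mostly_neg B (Pos ∪ C) (fun s => - ∑ v ∈ s, (r v (π v) - r v v)) K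
      (fun s hs => by have := (abs_le.mp (hnetK s hs)).1; omega)
      (fun s hs hsX => by
        rw [mem_union, not_or] at hsX
        -- Exchanging the two colours negates all gains, so the dichotomy also serves blocks all of
        -- whose moves have negative gain.
        have := (block_dichotomy hE (r := fun u v => 1 - r u v)
          (fun u v => by rcases hr u v with h | h <;> rw [h] <;> simp) hb hπ (hB s hs) (by
            intro ρ hρ
            rw [gain_compl, gain_compl]
            have h1 := hne s hs ρ hρ
            have h2 : ¬ 1 ≤ gain r (π * ρ) - gain r π := fun h =>
              hsX.1 (mem_filter.mpr ⟨hs, ρ, hρ, h⟩)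
            omega)).2
        rcases this with h | ⟨κ, h1, h2⟩
        · rw [← sum_neg_distrib]
          refine le_trans (le_of_eq ?_) h
          exact sum_congr rfl fun v _ => by ring
        · rw [gain_compl] at h2
          exact absurd (mem_filter.mpr ⟨hs, κ, h1, by omega⟩) hsX.2)
    rw [sum_neg_distrib, hnet] at hsum
    have hX : (Pos ∪ C).card ≤ 2 * (K * K + 1) + 2 * L := (card_union_le _ _).trans (by omega)
    have hX' : (Pos ∪ C).card * (K + 1) ≤ (2 * (K * K + 1) + 2 * L) * (K + 1) :=
      Nat.mul_le_mul_right _ hX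
    -- The blocks outside `Pos ∪ C` have weight at least 1 and the others at least -K, while all
    -- weights add up to d.
    have : B.card ≤ d + (2 * (K * K + 1) + 2 * L) * (K + 1) := by
      zify at hX' ⊢; linarith
    have h4 : d ≤ L * (K + 1) := hdL.trans (Nat.le_mul_of_pos_right _ (by omega))
    have h5 : (K + 1) * (2 * (K * K + 1) + 3 * L) =
      L * (K + 1) + (2 * (K * K + 1) + 2 * L) * (K + 1) := by ring
    omega
  · -- few blocks with a move of negative gain
    set C := B.filter fun s => ∃ κ, IsMove E 1 s κ ∧ gain r κ = 1 with hC
    -- Applied to the reference matching itself, d disjoint local cycles of gain 1 would give a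
    -- nearby solution.
    have hCc : C.card < d := by
      by_contra hcon
      push Not at hcon
      obtain ⟨π', h1, h2, h3⟩ := hlocal 1 1 C d (filter_subset _ _)
        (fun v => hE v) hcon (fun _ _ _ _ => rfl) (fun s hs => (mem_filter.mp hs).2)
      have := hno π' h1 (by rw [h2, gain_one]; ring)
      rw [nearBound, ← hQ, ← hK] at this
      rw [Equiv.Perm.support_one, card_empty] at h3
      omega
    have hsum := sum_le_of_mostly_neg B (Neg ∪ C) (fun s => ∑ v ∈ s, (r v (π v) - r v v)) K
      (fun s hs => (abs_le.mp (hnetK s hs)).2)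
      (fun s hs hsX => by
        rw [mem_union, not_or] at hsX
        have := (block_dichotomy hE hr hb hπ (hB s hs) (by
            intro ρ hρ
            have h1 := hne s hs ρ hρ
            have h2 : ¬ 1 ≤ -(gain r (π * ρ) - gain r π) := fun h =>
              hsX.1 (mem_filter.mpr ⟨hs, ρ, hρ, h⟩)
            omega)).2
        rcases this with h | ⟨κ, h1, h2⟩
        · exact h
        · exact absurd (mem_filter.mpr ⟨hs, κ, h1, h2⟩) hsX.2)
    rw [hnet] at hsum
    have hX : (Neg ∪ C).card ≤ 2 * (K * K + 1) + 3 * L := (card_union_le _ _).trans (by omega)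
    have hX' : (Neg ∪ C).card * (K + 1) ≤ (2 * (K * K + 1) + 3 * L) * (K + 1) :=
      Nat.mul_le_mul_right _ hX
    have : B.card ≤ (2 * (K * K + 1) + 3 * L) * (K + 1) := by
      zify at hX' ⊢; linarith
    have h5 : (K + 1) * (2 * (K * K + 1) + 3 * L) = (2 * (K * K + 1) + 3 * L) * (K + 1) := by ring
    omega

/-- Two distant perfect matchings: the first can be moved a little towards the second. -/
theorem exists_closer {E : V → V → Prop} (hE : ∀ v, E v v) {b : ℕ} (hb : Dense E b)
    {π : Equiv.Perm V} (hπ : Good E π) (hlarge : 2 * b + 2 < π.support.card) :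
    ∃ σ, Good E σ ∧ σ.support.card ≤ 2 * b + 2 ∧
      (univ.filter fun v => σ v ≠ π v).card < π.support.card := by
  obtain ⟨x, hx⟩ : π.support.Nonempty := card_pos.mp (by omega)
  have hxs := Equiv.Perm.mem_support.mp hx
  set v : ℕ → V := fun t => π^[t] x with hv
  set p := Function.minimalPeriod π x with hp
  have hstep : ∀ t, π (v t) = v (t + 1) := fun t => (Function.iterate_succ_apply' π t x).symm
  have hinj : Set.InjOn v (Set.Iio p) := Function.iterate_injOn_Iio_minimalPeriod
  have hmv : ∀ t, π (v t) ≠ v t := by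
    intro t
    induction t with
    | zero => exact hxs
    | succ t ih => rw [← hstep]; exact fun h => ih (π.injective h)
  -- closing a segment of the cycle suffices
  suffices h : ∃ a c, a ≤ c ∧ c ≤ a + (2 * b + 1) ∧ c < p ∧ E (v c) (v a) ∧
      (a < c ∨ π (v c) = v a) by
    obtain ⟨a, c, hac, hc, hcp, he, hlt⟩ := h
    have hinj' : Set.InjOn v (Set.Icc a c) := hinj.mono fun t ht => lt_of_le_of_lt ht.2 hcp
    obtain ⟨κ, k1, k2, k3⟩ := exists_segment_cycle hac hinj'
    refine ⟨κ, good_segment_cycle hE k1 k2 k3 he fun t _ _ => by rw [← hstep]; exact hπ _, ?_, ?_⟩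
    · have : κ.support ⊆ (Icc a c).image v := by
        intro u hu
        by_contra hn
        exact Equiv.Perm.mem_support.mp hu (k3 u fun t h1 h2 h =>
          hn (mem_image.mpr ⟨t, mem_Icc.mpr ⟨h1, h2⟩, h.symm⟩))
      refine (card_le_card this).trans (card_image_le.trans ?_)
      rw [Nat.card_Icc]; omega
    · apply card_lt_card
      -- At `v a` the permutation κ follows π, and π moves `v a`. Hence the disagreement of κ and π
      -- is a proper subset of the support of π.
      have hκa : κ (v a) = π (v a) := by
        rcases hlt with h | h
        · rw [k1 a le_rfl h, hstep]
        · rcases hac.lt_or_eq with h' | rfl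
          · rw [k1 a le_rfl h', hstep]
          · rw [k2, h]
      rw [ssubset_iff_of_subset]
      · exact ⟨v a, Equiv.Perm.mem_support.mpr (hmv a), by simp [hκa]⟩
      · intro u hu
        rw [mem_filter] at hu
        rw [Equiv.Perm.mem_support]
        intro hu'
        apply hu.2
        rw [hu', k3 u]
        rintro t _ _ rfl
        exact hmv t hu'
  -- A long cycle has an edge from one of its positions b+1, …, 2b+1 back to one of 0, …, b. A cycle
  -- of length at most 2b+1 is taken whole and closed by its own last edge.
  by_cases hlong : 2 * b + 2 ≤ p
  · obtain ⟨j, i, h1, h2, h3, h4, h5⟩ := hb.exists_edge hinj (s := b + 1) (t := 0) (by omega) (by omega)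
    exact ⟨i, j, by omega, by omega, by omega, h5, by omega⟩
  · have hp0 : 0 < p := by
      have := mem_orbitSegment_minimalPeriod (π := π) (x := x) (t := 0)
      by_contra h
      rw [← hp, show p = 0 by omega] at this
      simp [orbitSegment] at this
    have hclose : π (v (p - 1)) = v 0 := by
      rw [hstep, Nat.sub_add_cancel hp0]
      exact Function.iterate_minimalPeriod
    exact ⟨0, p - 1, by omega, by omega, by omega, hclose ▸ hπ _, Or.inr hclose⟩

end Near

end ExactMatching

/-! ### Perfect matchings as functions on natural numbers -/

namespace ExactMatching

open Finset

/-- `f` describes a perfect matching of the `m × m` bipartite graph with coloured adjacency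
matrix `c`. -/
def IsPM (m : ℕ) (c : ℕ → ℕ → ℕ) (f : ℕ → ℕ) : Prop :=
  (∀ i < m, f i < m ∧ c i (f i) ≠ 0) ∧ Set.InjOn f (Set.Iio m)

/-- The number of red edges. -/
def redCount (m : ℕ) (c : ℕ → ℕ → ℕ) (f : ℕ → ℕ) : ℕ := ((range m).filter fun i => c i (f i) = 2).card

/-- The number of differences. -/
def diffs (m : ℕ) (f g : ℕ → ℕ) : ℕ := ((range m).filter fun i => f i ≠ g i).card

/-- Any two sets of more than `b` rows and columns contain an edge. -/
def NoIndep (m : ℕ) (c : ℕ → ℕ → ℕ) (b : ℕ) : Prop :=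
  ∀ X Y : Finset ℕ, X ⊆ range m → Y ⊆ range m → b < X.card → b < Y.card →
    ∃ x ∈ X, ∃ y ∈ Y, c x y ≠ 0

/-- A permutation as a function on natural numbers. -/
def funOf {m : ℕ} (σ : Equiv.Perm (Fin m)) (i : ℕ) : ℕ := if h : i < m then σ ⟨i, h⟩ else 0

theorem funOf_val {m : ℕ} (σ : Equiv.Perm (Fin m)) (i : Fin m) : funOf σ i = σ i := by
  simp [funOf]

theorem IsPM.exists_perm {m : ℕ} {c : ℕ → ℕ → ℕ} {f : ℕ → ℕ} (h : IsPM m c f) :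
    ∃ σ : Equiv.Perm (Fin m), ∀ i : Fin m, (σ i : ℕ) = f i := by
  have hinj : Function.Injective fun i : Fin m => (⟨f i, (h.1 i i.2).1⟩ : Fin m) := by
    intro i j hij
    exact Fin.ext (h.2 i.2 j.2 (Fin.ext_iff.mp hij))
  exact ⟨Equiv.ofBijective _ (Finite.injective_iff_bijective.mp hinj), fun i => rfl⟩

theorem isPM_funOf {m : ℕ} {c : ℕ → ℕ → ℕ} {σ : Equiv.Perm (Fin m)}
    (h : ∀ i : Fin m, c i (σ i) ≠ 0) : IsPM m c (funOf σ) := by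
  refine ⟨fun i hi => ?_, fun i hi j hj hij => ?_⟩
  · have := funOf_val σ ⟨i, hi⟩
    simp only at this
    rw [this]
    exact ⟨(σ _).2, h ⟨i, hi⟩⟩
  · have h1 := funOf_val σ ⟨i, hi⟩
    have h2 := funOf_val σ ⟨j, hj⟩
    simp only at h1 h2
    rw [h1, h2] at hij
    exact Fin.ext_iff.mp (σ.injective (Fin.ext hij))

theorem redCount_eq (m : ℕ) (c : ℕ → ℕ → ℕ) (f : ℕ → ℕ) :
    (redCount m c f : ℤ) = ∑ i : Fin m, if c i (f i) = 2 then 1 else 0 := by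
  rw [redCount, card_filter, Finset.sum_range]
  push_cast
  rfl

theorem diffs_eq (m : ℕ) (f g : ℕ → ℕ) :
    diffs m f g = ((univ : Finset (Fin m)).filter fun i : Fin m => f i ≠ g i).card := by
  rw [diffs, card_filter, card_filter, Finset.sum_range]

theorem diffs_le (m : ℕ) (f g : ℕ → ℕ) : diffs m f g ≤ m :=
  (card_filter_le _ _).trans (card_range m).le

/-- Naming every column after its partner under φ makes the reference matching the identity and
preserves the sizes of sets. -/
theorem NoIndep.dense {m : ℕ} {c : ℕ → ℕ → ℕ} {b : ℕ} (h : NoIndep m c b)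
    (φ : Equiv.Perm (Fin m)) : Dense (fun x y : Fin m => c x (φ y) ≠ 0) b := by
  intro X Y hX hY
  have hinj : Function.Injective fun y : Fin m => ((φ y : Fin m) : ℕ) :=
    Fin.val_injective.comp φ.injective
  obtain ⟨x, hx, y, hy, hxy⟩ := h (X.image Fin.val) (Y.image fun y => ((φ y : Fin m) : ℕ))
    (by intro x hx; obtain ⟨z, -, rfl⟩ := mem_image.mp hx; exact mem_range.mpr z.2)
    (by intro x hx; obtain ⟨z, -, rfl⟩ := mem_image.mp hx; exact mem_range.mpr (φ z).2)
    (by rwa [card_image_of_injective _ Fin.val_injective])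
    (by rwa [card_image_of_injective _ hinj])
  obtain ⟨x, hx', rfl⟩ := mem_image.mp hx
  obtain ⟨y, hy', rfl⟩ := mem_image.mp hy
  exact ⟨x, hx', y, hy', hxy⟩

section Transfer

variable {m : ℕ} {c : ℕ → ℕ → ℕ} {f g : ℕ → ℕ} {φ γ : Equiv.Perm (Fin m)}

/-- The permutation φ⁻¹γ sends a row to the row whose f-partner is its g-partner; this is g seen
from f. -/
theorem gain_transfer (hφ : ∀ i : Fin m, (φ i : ℕ) = f i) (hγ : ∀ i : Fin m, (γ i : ℕ) = g i) :
    gain (fun x y : Fin m => if c x (φ y) = 2 then 1 else 0) (φ⁻¹ * γ) =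
      redCount m c g - redCount m c f := by
  rw [gain, redCount_eq, redCount_eq, ← sum_sub_distrib]
  apply sum_congr rfl
  intro i _
  rw [Equiv.Perm.mul_apply, show φ (φ⁻¹ (γ i)) = γ i from φ.apply_symm_apply _, hφ, hγ]

theorem support_transfer (hφ : ∀ i : Fin m, (φ i : ℕ) = f i) (hγ : ∀ i : Fin m, (γ i : ℕ) = g i) :
    (φ⁻¹ * γ).support.card = diffs m f g := by
  rw [diffs_eq]
  congr 1
  ext i
  rw [Equiv.Perm.mem_support, mem_filter, Equiv.Perm.mul_apply, Ne, Equiv.Perm.inv_eq_iff_eq,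
    ← hφ, ← hγ, Ne, Fin.val_inj, eq_comm]
  simp

theorem good_transfer (hγ : ∀ i : Fin m, (γ i : ℕ) = g i) (hg : IsPM m c g) :
    Good (fun x y : Fin m => c x (φ y) ≠ 0) (φ⁻¹ * γ) := by
  intro i
  rw [Equiv.Perm.mul_apply, show φ (φ⁻¹ (γ i)) = γ i from φ.apply_symm_apply _, hγ]
  exact (hg.1 i i.2).2

end Transfer

/-- The matching with at most k red edges serves as reference, which makes the deficit d a natural
number. -/
theorem exists_near_pm {m : ℕ} {c : ℕ → ℕ → ℕ} {b k L : ℕ} (hb : NoIndep m c b) {f g h : ℕ → ℕ}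
    (hf : IsPM m c f) (hg : IsPM m c g) (hh : IsPM m c h) (hfg : diffs m f g ≤ L)
    (hfk : redCount m c f ≤ k) (hgk : k ≤ redCount m c g) (hhk : redCount m c h = k) :
    ∃ h', IsPM m c h' ∧ redCount m c h' = k ∧ diffs m f h' ≤ nearBound b L := by
  obtain ⟨φ, hφ⟩ := hf.exists_perm
  obtain ⟨γ, hγ⟩ := hg.exists_perm
  obtain ⟨η, hη⟩ := hh.exists_perm
  obtain ⟨d, rfl⟩ := Nat.exists_eq_add_of_le hfk
  obtain ⟨π, h1, h2, h3⟩ := exists_near_solution (E := fun x y : Fin m => c x (φ y) ≠ 0)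
    (fun v => by rw [hφ]; exact (hf.1 v v.2).2)
    (r := fun x y : Fin m => if c x (φ y) = 2 then 1 else 0)
    (fun u v => by split_ifs <;> simp) (hb.dense φ) (L := L) (d := d)
    (good_transfer hγ hg) (by rwa [support_transfer hφ hγ]) (by rw [gain_transfer hφ hγ]; omega)
    (good_transfer hη hh) (by rw [gain_transfer hφ hη]; omega)
  have e : φ⁻¹ * (φ * π) = π := by group
  have hpm : IsPM m c (funOf (φ * π)) := isPM_funOf fun i => h1 i
  have hv : ∀ i : Fin m, ((φ * π) i : ℕ) = funOf (φ * π) i := fun i => (funOf_val _ i).symm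
  refine ⟨_, hpm, ?_, ?_⟩
  · have := gain_transfer (c := c) hφ hv
    rw [e, h2] at this
    omega
  · rwa [← support_transfer hφ hv, e]

theorem exists_closer_pm {m : ℕ} {c : ℕ → ℕ → ℕ} {b : ℕ} (hb : NoIndep m c b) {f g : ℕ → ℕ}
    (hf : IsPM m c f) (hg : IsPM m c g) (hfg : 2 * b + 2 < diffs m f g) :
    ∃ h, IsPM m c h ∧ diffs m f h ≤ 2 * b + 2 ∧ diffs m h g < diffs m f g := by
  obtain ⟨φ, hφ⟩ := hf.exists_perm
  obtain ⟨γ, hγ⟩ := hg.exists_perm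
  obtain ⟨σ, h1, h2, h3⟩ := exists_closer (E := fun x y : Fin m => c x (φ y) ≠ 0)
    (fun v => by rw [hφ]; exact (hf.1 v v.2).2) (hb.dense φ) (good_transfer hγ hg)
    (by rwa [support_transfer hφ hγ])
  have e : φ⁻¹ * (φ * σ) = σ := by group
  have hpm : IsPM m c (funOf (φ * σ)) := isPM_funOf fun i => h1 i
  have hv : ∀ i : Fin m, ((φ * σ) i : ℕ) = funOf (φ * σ) i := fun i => (funOf_val _ i).symm
  refine ⟨_, hpm, ?_, ?_⟩
  · rwa [← support_transfer hφ hv, e]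
  · rw [support_transfer hφ hγ] at h3
    refine lt_of_le_of_lt (le_of_eq ?_) h3
    rw [diffs_eq]
    congr 1
    ext i
    rw [mem_filter, mem_filter, Equiv.Perm.mul_apply, Ne, Ne, ← hv, ← hγ, Fin.val_inj,
      Equiv.Perm.mul_apply, Equiv.Perm.eq_inv_iff_eq]

/-- For L = 2b+2 the bound is a polynomial of degree 8 in b+1. Its coefficient is below 2^40 and b+1
≤ 2^b, so the exponent 40(b+1) is ample. -/
theorem nearBound_le (b : ℕ) : nearBound b (2 * b + 2) ≤ 2 ^ (40 * (b + 1)) := by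
  have h1 : b + 1 ≤ 2 ^ b := Nat.lt_two_pow_self
  set B := b + 1 with hB
  have hB1 : 1 ≤ B := by omega
  have hlen : blockLen b ≤ 49 * B ^ 2 := by
    rw [blockLen, show 4 * b + 4 = 4 * B by omega]
    nlinarith
  have hK : 2 * blockLen b ≤ 98 * B ^ 2 := by omega
  have hK1 : 2 * blockLen b + 1 ≤ 99 * B ^ 2 := by nlinarith
  have hlast : 2 * (2 * blockLen b * (2 * blockLen b) + 1) + 3 * (2 * b + 2) ≤ 20000 * B ^ 4 := by
    have h2 : 2 * blockLen b * (2 * blockLen b) ≤ 98 * B ^ 2 * (98 * B ^ 2) := Nat.mul_le_mul hK hK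
    have h3 : B ≤ B ^ 4 := Nat.le_self_pow (by norm_num) B
    have h4 : 98 * B ^ 2 * (98 * B ^ 2) = 9604 * B ^ 4 := by ring
    omega
  calc nearBound b (2 * b + 2) ≤ 98 * B ^ 2 * (99 * B ^ 2) * (20000 * B ^ 4) := by
        rw [nearBound]; gcongr
    _ = 194040000 * B ^ 8 := by ring
    _ ≤ 2 ^ 40 * (2 ^ b) ^ 8 := by gcongr; norm_num
    _ = 2 ^ (40 + 8 * b) := by rw [← pow_mul, ← pow_add]; ring_nf
    _ ≤ 2 ^ (40 * B) := Nat.pow_le_pow_right (by norm_num) (by omega)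

end ExactMatching

/-! ### The auction algorithm for the assignment problem -/

namespace ExactMatching

open Finset

/-- The invariant of the auction: `p` are the prices of the objects, `own j = i + 1` and
`asg i = j + 1` if the object `j` is assigned to `i`. -/
structure AuctionInv (m W : ℕ) (w : ℕ → ℕ → ℕ) (p own asg : ℕ → ℕ) : Prop where
  link : ∀ i < m, ∀ j < m, asg i = j + 1 ↔ own j = i + 1
  asg_le : ∀ i < m, asg i ≤ m
  own_le : ∀ j < m, own j ≤ m
  free : ∀ j < m, own j = 0 → p j = 0
  slack : ∀ i < m, ∀ j < m, asg i = j + 1 → ∀ l < m, w i l + p j ≤ w i j + p l + 1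
  price_le : ∀ j < m, p j ≤ W + 1

theorem AuctionInv.init {m W : ℕ} {w : ℕ → ℕ → ℕ} {p own asg : ℕ → ℕ} (hp : ∀ j < m, p j = 0)
    (ho : ∀ j < m, own j = 0) (ha : ∀ i < m, asg i = 0) : AuctionInv m W w p own asg where
  link i hi j hj := by rw [ha i hi, ho j hj]; omega
  asg_le i hi := by rw [ha i hi]; omega
  own_le i hi := by rw [ho i hi]; omega
  free j hj _ := hp j hj
  slack i hi j hj h := by rw [ha i hi] at h; omega
  price_le j hj := by rw [hp j hj]; omega

/-- If every object had an owner, distinct objects would have distinct owners, and by counting every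
person would own one. -/
theorem AuctionInv.exists_free {m W : ℕ} {w : ℕ → ℕ → ℕ} {p own asg : ℕ → ℕ}
    (h : AuctionInv m W w p own asg) {i : ℕ} (hi : i < m) (hai : asg i = 0) :
    ∃ j < m, own j = 0 := by
  by_contra hcon
  push Not at hcon
  have hmaps : ∀ j ∈ range m, own j - 1 ∈ range m := by
    intro j hj
    rw [mem_range] at *
    have := h.own_le j hj; have := hcon j hj; omega
  have hinj : Set.InjOn (fun j => own j - 1) (range m) := by
    intro j hj l hl hjl
    simp only [coe_range, Set.mem_Iio] at hj hl hjl
    have h1 := hcon j hj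
    have h2 := hcon l hl
    have h3 := mem_range.mp (hmaps j (mem_range.mpr hj))
    have a1 := (h.link (own j - 1) h3 j hj).mpr (by omega)
    have a2 := (h.link (own j - 1) h3 l hl).mpr (by omega)
    omega
  obtain ⟨j, hj, hji⟩ := surj_on_of_inj_on_of_card_le (fun j _ => own j - 1) hmaps
    (fun a b ha hb hab => hinj ha hb hab) le_rfl i (mem_range.mpr hi)
  rw [mem_range] at hj
  have h1 := hcon j hj
  have := (h.link i hi j hj).mpr (by omega)
  omega

-- Raising the price of the best object by 1 costs its new owner at most 1 of slack, and only helps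
-- the other owners, for whom a rival object became dearer. A person still unassigned means an
-- object still free, at price 0; the best object is no worse than that one, so its price before the
-- bid is at most W.
open Function in
theorem AuctionInv.step {m W : ℕ} {w : ℕ → ℕ → ℕ} {p own asg asg₁ : ℕ → ℕ}
    (hw : ∀ i < m, ∀ j < m, w i j ≤ W)
    (h : AuctionInv m W w p own asg) {i j : ℕ} (hi : i < m) (hai : asg i = 0) (hj : j < m)
    (hbest : ∀ l < m, w i l + p j ≤ w i j + p l)
    (hasg : asg₁ = if own j = 0 then asg else update asg (own j - 1) 0) :
    AuctionInv m W w (update p j (p j + 1)) (update own j (i + 1)) (update asg₁ i (j + 1)) := by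
  obtain ⟨l₀, hl₀, hl₀'⟩ := h.exists_free hi hai
  have hpj : p j ≤ W := by
    have h1 := hbest l₀ hl₀
    rw [h.free l₀ hl₀ hl₀'] at h1
    have := hw i hi j hj
    omega
  -- the new assignment on persons different from `i`
  have hval : ∀ x < m, x ≠ i → asg₁ x = if asg x = j + 1 then 0 else asg x := by
    intro x hx hxi
    have hl := h.link x hx j hj
    rw [hasg]
    by_cases h0 : own j = 0
    · rw [if_pos h0, if_neg (by rw [hl]; omega)]
    · rw [if_neg h0]
      by_cases hxo : x = own j - 1
      · rw [← hxo, update_self, if_pos (hl.mpr (by omega))]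
      · rw [update_of_ne hxo, if_neg (by rw [hl]; omega)]
  have hle : ∀ x, p x ≤ update p j (p j + 1) x := by
    intro x
    by_cases hx : x = j
    · subst hx; simp
    · rw [update_of_ne hx]
  constructor
  · intro x hx y hy
    by_cases hxi : x = i
    · subst hxi
      by_cases hyj : y = j
      · subst hyj; simp
      · have := h.link x hx y hy
        rw [update_self, update_of_ne hyj, ← this]
        omega
    · rw [update_of_ne hxi, hval x hx hxi]
      have h1 := h.link x hx y hy
      by_cases hyj : y = j
      · subst hyj
        rw [update_self]
        split_ifs <;> constructor <;> intro h3 <;> first | omega | exact h3.elim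
      · rw [update_of_ne hyj, ← h1]
        split_ifs <;> constructor <;> intro h3 <;> first | omega | exact h3.elim
  · intro x hx
    by_cases hxi : x = i
    · subst hxi; rw [update_self]; omega
    · rw [update_of_ne hxi, hval x hx hxi]
      have := h.asg_le x hx
      split_ifs <;> omega
  · intro x hx
    by_cases hxj : x = j
    · subst hxj; rw [update_self]; omega
    · rw [update_of_ne hxj]; exact h.own_le x hx
  · intro x hx hx0
    by_cases hxj : x = j
    · subst hxj; rw [update_self] at hx0; omega
    · rw [update_of_ne hxj] at *; exact h.free x hx hx0
  · intro x hx y hy hxy l hl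
    by_cases hxi : x = i
    · subst hxi
      rw [update_self] at hxy
      obtain rfl : y = j := by omega
      have h1 := hbest l hl
      have h2 := hle l
      rw [update_self]; omega
    · rw [update_of_ne hxi, hval x hx hxi] at hxy
      split_ifs at hxy with hc
      have hyj : y ≠ j := by rintro rfl; exact hc hxy
      have h1 := h.slack x hx y hy hxy l hl
      have h2 := hle l
      rw [update_of_ne hyj]; omega
  · intro x hx
    by_cases hxj : x = j
    · subst hxj; rw [update_self]; omega
    · rw [update_of_ne hxj]; exact h.price_le x hx

open Function in
theorem sum_update_succ {m j : ℕ} (hj : j < m) (p : ℕ → ℕ) :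
    ∑ x ∈ range m, update p j (p j + 1) x = ∑ x ∈ range m, p x + 1 := by
  rw [sum_update_of_mem (mem_range.mpr hj), ← add_sum_erase _ _ (mem_range.mpr hj),
    sdiff_singleton_eq_erase]
  omega

theorem AuctionInv.sum_le {m W : ℕ} {w : ℕ → ℕ → ℕ} {p own asg : ℕ → ℕ}
    (h : AuctionInv m W w p own asg) : ∑ x ∈ range m, p x ≤ m * (W + 1) :=
  (sum_le_card_nsmul _ _ (W + 1) fun x hx => h.price_le x (mem_range.mp hx)).trans (by simp)

theorem sum_comp_injOn {m : ℕ} {g : ℕ → ℕ} (hg : ∀ i < m, g i < m) (hi : Set.InjOn g (Set.Iio m))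
    (p : ℕ → ℕ) : ∑ i ∈ range m, p (g i) = ∑ i ∈ range m, p i := by
  have hi' : Set.InjOn g (range m) := by simpa using hi
  have : (range m).image g = range m := by
    apply eq_of_subset_of_card_le
    · intro x hx
      obtain ⟨i, hi, rfl⟩ := mem_image.mp hx
      exact mem_range.mpr (hg i (mem_range.mp hi))
    · rw [card_image_of_injOn hi']
  conv_rhs => rw [← this, sum_image hi']

/-- Sum the slackness inequalities over all persons. Both assignments use every object once, so the
prices cancel and a loss of 1 per person remains. -/
theorem AuctionInv.optimal {m W : ℕ} {w : ℕ → ℕ → ℕ} {p own asg : ℕ → ℕ}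
    (h : AuctionInv m W w p own asg) (hall : ∀ i < m, asg i ≠ 0) :
    (∀ i < m, asg i - 1 < m) ∧ Set.InjOn (fun i => asg i - 1) (Set.Iio m) ∧
    ∀ g : ℕ → ℕ, (∀ i < m, g i < m) → Set.InjOn g (Set.Iio m) →
      ∑ i ∈ range m, w i (g i) ≤ ∑ i ∈ range m, w i (asg i - 1) + m := by
  have hlt : ∀ i < m, asg i - 1 < m := by
    intro i hi
    have := hall i hi; have := h.asg_le i hi; omega
  have hinj : Set.InjOn (fun i => asg i - 1) (Set.Iio m) := by
    intro x hx y hy hxy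
    simp only [Set.mem_Iio] at hx hy hxy
    have h1 := hall x hx
    have h2 := hall y hy
    have a1 := (h.link x hx (asg x - 1) (hlt x hx)).mp (by omega)
    have a2 := (h.link y hy (asg x - 1) (hlt x hx)).mp (by omega)
    omega
  refine ⟨hlt, hinj, fun g hg hgi => ?_⟩
  have h1 : ∑ i ∈ range m, (w i (g i) + p (asg i - 1)) ≤
      ∑ i ∈ range m, (w i (asg i - 1) + p (g i) + 1) := by
    apply Finset.sum_le_sum
    intro i hi
    rw [mem_range] at hi
    have := hall i hi
    exact h.slack i hi (asg i - 1) (hlt i hi) (by omega) (g i) (hg i hi)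
  have h2 := sum_comp_injOn hg hgi p
  have h3 := sum_comp_injOn hlt hinj p
  simp only [sum_add_distrib, sum_const, card_range, smul_eq_mul, mul_one] at h1
  omega

/-- Weights whose near-optimal assignments are perfect matchings with a maximum number of edges of
the colour `bonus`. -/
def auctionWeight (m bonus : ℕ) (c : ℕ → ℕ → ℕ) (i j : ℕ) : ℕ :=
  if c i j = 0 then 0 else (m + 1) * (m + 1) + if c i j = bonus then m + 1 else 0

theorem auctionWeight_le (m bonus : ℕ) (c : ℕ → ℕ → ℕ) (i j : ℕ) :
    auctionWeight m bonus c i j ≤ (m + 1) * (m + 1) + (m + 1) := by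
  rw [auctionWeight]; split_ifs <;> omega

theorem bonus_optimal {m bonus : ℕ} {c : ℕ → ℕ → ℕ} (hbonus : bonus ≠ 0) {f g : ℕ → ℕ}
    (hf : ∀ i < m, f i < m) (hfi : Set.InjOn f (Set.Iio m)) (hg : IsPM m c g)
    (hopt : ∑ i ∈ range m, auctionWeight m bonus c i (g i) ≤
      ∑ i ∈ range m, auctionWeight m bonus c i (f i) + m) :
    IsPM m c f ∧ ((range m).filter fun i => c i (g i) = bonus).card ≤
      ((range m).filter fun i => c i (f i) = bonus).card := by
  have hsum : ∀ h : ℕ → ℕ, ∑ i ∈ range m, auctionWeight m bonus c i (h i) =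
      ((range m).filter fun i => c i (h i) ≠ 0).card * ((m + 1) * (m + 1)) +
      ((range m).filter fun i => c i (h i) = bonus).card * (m + 1) := by
    intro h
    rw [card_filter, card_filter, sum_mul, sum_mul, ← sum_add_distrib]
    apply sum_congr rfl
    intro i _
    rw [auctionWeight]
    by_cases h0 : c i (h i) = 0
    · simp [h0, hbonus.symm]
    · by_cases h1 : c i (h i) = bonus <;> simp [h0, h1, hbonus]
  rw [hsum, hsum, filter_true_of_mem (s := range m) (p := fun i => c i (g i) ≠ 0)
    (fun i hi => (hg.1 i (mem_range.mp hi)).2), card_range] at hopt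
  set cg := ((range m).filter fun i => c i (g i) = bonus).card with hcg
  set cf := ((range m).filter fun i => c i (f i) = bonus).card with hcf
  set ef := ((range m).filter fun i => c i (f i) ≠ 0).card with hef
  have hcf' : cf ≤ m := (card_filter_le _ _).trans (card_range m).le
  have hef' : ef ≤ m := (card_filter_le _ _).trans (card_range m).le
  -- One missing edge costs (m+1)², more than all bonuses and the tolerance together, since m(m+1) +
  -- m < (m+1)².
  have hefm : ef = m := by
    by_contra hne
    have h1 : ef + 1 ≤ m := by omega
    have h2 : (ef + 1) * ((m + 1) * (m + 1)) ≤ m * ((m + 1) * (m + 1)) := Nat.mul_le_mul_right _ h1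
    have h3 : cf * (m + 1) ≤ m * (m + 1) := Nat.mul_le_mul_right _ hcf'
    nlinarith
  refine ⟨⟨fun i hi => ⟨hf i hi, ?_⟩, hfi⟩, ?_⟩
  · have : (range m).filter (fun i => c i (f i) ≠ 0) = range m :=
      eq_of_subset_of_card_le (filter_subset _ _) (by rw [card_range, ← hef, hefm])
    have h1 : i ∈ (range m).filter (fun i => c i (f i) ≠ 0) := by rw [this]; exact mem_range.mpr hi
    exact (mem_filter.mp h1).2
  · rw [hefm] at hopt
    -- One missing bonus costs m+1, which exceeds the tolerance m.
    by_contra hcon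
    push Not at hcon
    have h2 : (cf + 1) * (m + 1) ≤ cg * (m + 1) := Nat.mul_le_mul_right _ hcon
    nlinarith

/-- Turns a maximum number of blue edges into a minimum number of red ones. -/
theorem redCount_add_blue {m : ℕ} {c : ℕ → ℕ → ℕ} (hc : ∀ i < m, ∀ j < m, c i j ≤ 2) {f : ℕ → ℕ}
    (hf : IsPM m c f) :
    redCount m c f + ((range m).filter fun i => c i (f i) = 1).card = m := by
  have h1 := card_filter_add_card_filter_not (s := range m) (fun i => c i (f i) = 2)
  rw [card_range] at h1
  rw [redCount]
  conv_rhs => rw [← h1]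
  congr 2
  apply filter_congr
  intro i hi
  rw [mem_range] at hi
  have h2 := hf.1 i hi
  have h3 := hc i hi _ h2.1
  omega

end ExactMatching

/-! ### Total correctness of programs with polynomial time bounds -/

namespace RAM

open Finset

/-- The registers a program may write to. -/
def Prog.wr : Prog → ℕ → Bool
  | .nop, _ => false
  | .assign x _, y => x == y
  | .store _ _ _, _ => false
  | .seq p q, y => p.wr y || q.wr y
  | .branch _ p q, y => p.wr y || q.wr y
  | .loop _ p, y => p.wr y

/-- The arrays a program may write to. -/
def Prog.wa : Prog → ℕ → Bool
  | .nop, _ => false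
  | .assign _ _, _ => false
  | .store a _ _, b => a == b
  | .seq p q, b => p.wa b || q.wa b
  | .branch _ p q, b => p.wa b || q.wa b
  | .loop _ p, b => p.wa b

/-- The states agree except where `p` may write. -/
structure Frame (p : Prog) (s s' : State) : Prop where
  reg : ∀ x, p.wr x = false → s'.reg x = s.reg x
  arr : ∀ a, p.wa a = false → s'.arr a = s.arr a

theorem Frame.refl (p : Prog) (s : State) : Frame p s s := ⟨fun _ _ => rfl, fun _ _ => rfl⟩

theorem Frame.trans {p : Prog} {s₁ s₂ s₃ : State} (h : Frame p s₁ s₂) (h' : Frame p s₂ s₃) :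
    Frame p s₁ s₃ :=
  ⟨fun x hx => (h'.reg x hx).trans (h.reg x hx), fun a ha => (h'.arr a ha).trans (h.arr a ha)⟩

theorem Frame.mono {p q : Prog} {s s' : State} (h : Frame p s s')
    (hr : ∀ x, q.wr x = false → p.wr x = false) (ha : ∀ a, q.wa a = false → p.wa a = false) :
    Frame q s s' :=
  ⟨fun x hx => h.reg x (hr x hx), fun a h' => h.arr a (ha a h')⟩

theorem Frame.setReg {p : Prog} {s : State} {x v : ℕ} (h : p.wr x = true) :
    Frame p s (s.setReg x v) := by
  refine ⟨fun y hy => ?_, fun _ _ => rfl⟩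
  have : y ≠ x := by rintro rfl; rw [h] at hy; cases hy
  simp [State.setReg, this]

theorem Frame.setArr {p : Prog} {s : State} {a i v : ℕ} (h : p.wa a = true) :
    Frame p s (s.setArr a i v) := by
  refine ⟨fun _ _ => rfl, fun b hb => ?_⟩
  have : b ≠ a := by rintro rfl; rw [h] at hb; cases hb
  simp [State.setArr, this]

/-- What a program leaves alone can be read off its text: `wr` and `wa` evaluate to `false`, so most
later preservation claims are proved by `rfl`. -/
theorem Runs.frame {p : Prog} {s s' : State} {t : ℕ} (h : Runs p s s' t) : Frame p s s' := by
  induction h with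
  | nop s => exact Frame.refl _ _
  | assign s x e => exact Frame.setReg (by simp [Prog.wr])
  | store s a i e => exact Frame.setArr (by simp [Prog.wa])
  | seq _ _ ih₁ ih₂ =>
    exact (ih₁.mono (by simp +contextual [Prog.wr]) (by simp +contextual [Prog.wa])).trans
      (ih₂.mono (by simp +contextual [Prog.wr]) (by simp +contextual [Prog.wa]))
  | branch_true _ _ ih =>
    exact ih.mono (by simp +contextual [Prog.wr]) (by simp +contextual [Prog.wa])
  | branch_false _ _ ih =>
    exact ih.mono (by simp +contextual [Prog.wr]) (by simp +contextual [Prog.wa])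
  | loop_done _ => exact Frame.refl _ _
  | loop_step _ _ _ ih₁ ih₂ =>
    exact (ih₁.mono (by simp +contextual [Prog.wr]) (by simp +contextual [Prog.wa])).trans ih₂

/-- Started in `s`, the program `p` halts after at most `N ^ e` steps in a state with `Q`. -/
def Ex (N : ℕ) (p : Prog) (s : State) (e : ℕ) (Q : State → Prop) : Prop :=
  ∃ s' t, Runs p s s' t ∧ t ≤ N ^ e ∧ Q s'

section Rules

variable {N : ℕ} {p q : Prog} {s : State} {a b e : ℕ} {Q Q' : State → Prop}

theorem Ex.mono (hN : 2 ≤ N) (h : Ex N p s a Q) (hae : a ≤ e) (hQ : ∀ s', Q s' → Frame p s s' → Q' s') :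
    Ex N p s e Q' := by
  obtain ⟨s', t, h1, h2, h3⟩ := h
  exact ⟨s', t, h1, h2.trans (Nat.pow_le_pow_right (by omega) hae), hQ s' h3 h1.frame⟩

/-- As N ≥ 2, one further factor N absorbs the sum of two smaller powers. Sequential composition
then needs only a larger exponent. -/
theorem add_le_pow (hN : 2 ≤ N) {x y : ℕ} (hx : x ≤ N ^ a) (hy : y ≤ N ^ b) (ha : a < e) (hb : b < e) :
    x + y ≤ N ^ e := by
  obtain ⟨e, rfl⟩ : ∃ e', e = e' + 1 := ⟨e - 1, by omega⟩
  have h1 : N ^ a ≤ N ^ e := Nat.pow_le_pow_right (by omega) (by omega)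
  have h2 : N ^ b ≤ N ^ e := Nat.pow_le_pow_right (by omega) (by omega)
  rw [pow_succ]
  nlinarith

theorem const_le_pow (hN : 2 ≤ N) {x : ℕ} (hx : x ≤ 2 ^ a) : x ≤ N ^ a :=
  hx.trans (Nat.pow_le_pow_left hN a)

theorem Ex.nop (hN : 2 ≤ N) (h : Q s) : Ex N .nop s e Q :=
  ⟨s, 1, .nop s, Nat.one_le_pow _ _ (by omega), h⟩

theorem Ex.assign (hN : 2 ≤ N) {x : ℕ} {r : Expr} (hc : r.cost + 1 ≤ 2 ^ e)
    (h : Q (s.setReg x (r.eval s))) : Ex N (.assign x r) s e Q :=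
  ⟨_, _, .assign s x r, const_le_pow hN hc, h⟩

theorem Ex.store (hN : 2 ≤ N) {x : ℕ} {i r : Expr} (hc : i.cost + r.cost + 1 ≤ 2 ^ e)
    (h : Q (s.setArr x (i.eval s) (r.eval s))) : Ex N (.store x i r) s e Q :=
  ⟨_, _, .store s x i r, const_le_pow hN hc, h⟩

theorem Ex.seq (hN : 2 ≤ N) (h1 : Ex N p s a Q) (ha : a < e) (hb : b < e)
    (h2 : ∀ s₁, Q s₁ → Frame p s s₁ → Ex N q s₁ b Q') : Ex N (.seq p q) s e Q' := by
  obtain ⟨s₁, t₁, r1, l1, q1⟩ := h1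
  obtain ⟨s₂, t₂, r2, l2, q2⟩ := h2 s₁ q1 r1.frame
  exact ⟨s₂, _, .seq r1 r2, add_le_pow hN l1 l2 ha hb, q2⟩

theorem Ex.assign_seq (hN : 2 ≤ N) {x : ℕ} {r : Expr} (hc : r.cost + 1 ≤ 2 ^ a) (ha : a < e)
    (hb : b < e) (h : Ex N q (s.setReg x (r.eval s)) b Q) : Ex N (.seq (.assign x r) q) s e Q :=
  ⟨_, _, .seq (.assign s x r) h.choose_spec.choose_spec.1,
    add_le_pow hN (const_le_pow hN hc) h.choose_spec.choose_spec.2.1 ha hb,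
    h.choose_spec.choose_spec.2.2⟩

theorem Ex.store_seq (hN : 2 ≤ N) {x : ℕ} {i r : Expr} (hc : i.cost + r.cost + 1 ≤ 2 ^ a)
    (ha : a < e) (hb : b < e) (h : Ex N q (s.setArr x (i.eval s) (r.eval s)) b Q) :
    Ex N (.seq (.store x i r) q) s e Q :=
  ⟨_, _, .seq (.store s x i r) h.choose_spec.choose_spec.1,
    add_le_pow hN (const_le_pow hN hc) h.choose_spec.choose_spec.2.1 ha hb,
    h.choose_spec.choose_spec.2.2⟩

theorem Ex.branch (hN : 2 ≤ N) {r : Expr} (hc : r.cost + 1 ≤ 2 ^ a) (ha : a < e) (hb : b < e)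
    (h1 : r.eval s ≠ 0 → Ex N p s b Q) (h2 : r.eval s = 0 → Ex N q s b Q) :
    Ex N (.branch r p q) s e Q := by
  by_cases h : r.eval s = 0
  · obtain ⟨s', t, r1, l1, q1⟩ := h2 h
    exact ⟨s', _, .branch_false h r1, add_le_pow hN (const_le_pow hN hc) l1 ha hb, q1⟩
  · obtain ⟨s', t, r1, l1, q1⟩ := h1 h
    exact ⟨s', _, .branch_true h r1, add_le_pow hN (const_le_pow hN hc) l1 ha hb, q1⟩

/-- Loops with an invariant `I` and a variant `μ`. -/
theorem Ex.loop (hN : 2 ≤ N) {r : Expr} {d : ℕ} (I : State → Prop) (μ : State → ℕ)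
    (hc : r.cost + 1 ≤ 2 ^ a) (h0 : I s) (hμ : μ s ≤ N ^ d) (he : a + d + 3 ≤ e)
    (hstep : ∀ s₁, Frame p s s₁ → I s₁ → r.eval s₁ ≠ 0 →
      Ex N p s₁ a fun s₂ => I s₂ ∧ μ s₂ < μ s₁) :
    Ex N (.loop r p) s e fun s' => I s' ∧ r.eval s' = 0 := by
  have key : ∀ n s₁, μ s₁ = n → Frame p s s₁ → I s₁ → ∃ s' t, Runs (.loop r p) s₁ s' t ∧
      t ≤ (n + 1) * (N ^ a + N ^ a) ∧ I s' ∧ r.eval s' = 0 := by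
    intro n
    induction n using Nat.strong_induction_on with
    | _ n ih =>
      intro s₁ hn hF hI
      by_cases h : r.eval s₁ = 0
      · refine ⟨s₁, _, .loop_done h, ?_, hI, h⟩
        have := const_le_pow hN hc
        nlinarith
      · obtain ⟨s₂, t₂, r2, l2, I2, m2⟩ := hstep s₁ hF hI h
        obtain ⟨s₃, t₃, r3, l3, I3⟩ := ih (μ s₂) (by omega) s₂ rfl (hF.trans r2.frame) I2
        refine ⟨s₃, _, .loop_step h r2 r3, ?_, I3⟩
        have := const_le_pow hN hc
        have h5 : (μ s₂ + 1) * (N ^ a + N ^ a) ≤ n * (N ^ a + N ^ a) :=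
          Nat.mul_le_mul_right _ (by omega)
        nlinarith
  obtain ⟨s', t, h1, h2, h3⟩ := key _ s rfl (Frame.refl _ _) h0
  refine ⟨s', t, h1, h2.trans ?_, h3⟩
  have hd : 1 ≤ N ^ d := Nat.one_le_pow _ _ (by omega)
  calc (μ s + 1) * (N ^ a + N ^ a) ≤ (N ^ d * N) * (N ^ a * N) := by
        apply Nat.mul_le_mul <;> nlinarith [Nat.one_le_pow a N (by omega)]
    _ = N ^ (a + d + 2) := by ring
    _ ≤ N ^ e := Nat.pow_le_pow_right (by omega) (by omega)

end Rules

/-- Run `p` for all values of the register `x` below the value of `r`. -/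
def Prog.for (x : ℕ) (r : Expr) (p : Prog) : Prog :=
  .seq (.assign x (.lit 0)) (.loop (.sub r (.var x)) (.seq p (.assign x (.add (.var x) (.lit 1)))))

/-- The loop register is written before the first and after every execution of the body, so the
invariant has to be insensitive to it; the counter enters as a separate argument. -/
theorem Ex.for {N : ℕ} (hN : 2 ≤ N) {x : ℕ} {r : Expr} {p : Prog} {s : State} {n a d e : ℕ}
    (Inv : ℕ → State → Prop) (hx : p.wr x = false) (hc : r.cost + 4 ≤ 2 ^ a) (hn : n ≤ N ^ d)
    (he : a + d + 6 ≤ e)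
    (hr : ∀ s', Frame (Prog.for x r p) s s' → r.eval s' = n)
    (hInv : ∀ i s' v, Inv i s' → Inv i (s'.setReg x v)) (h0 : Inv 0 s)
    (hstep : ∀ i s', i < n → Frame (Prog.for x r p) s s' → s'.reg x = i → Inv i s' →
      Ex N p s' a fun s'' => Inv (i + 1) s'') :
    Ex N (Prog.for x r p) s e (Inv n) := by
  have hwx : (Prog.for x r p).wr x = true := by simp [Prog.for, Prog.wr]
  refine Ex.assign_seq (a := 1) (b := (a + 1) + d + 3) hN (by simp [Expr.cost]) (by omega) (by omega) ?_
  have hF0 : Frame (Prog.for x r p) s (s.setReg x ((Expr.lit 0).eval s)) := Frame.setReg hwx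
  refine Ex.mono hN (Ex.loop (a := a + 1) (d := d) hN
    (fun s' => s'.reg x ≤ n ∧ Inv (s'.reg x) s') (fun s' => n - s'.reg x) ?_ ?_ ?_ le_rfl ?_)
    le_rfl ?_
  · simp only [Expr.cost]; rw [pow_succ]; omega
  · simpa [State.setReg, Expr.eval] using hInv 0 s 0 h0
  · exact (Nat.sub_le _ _).trans hn
  · rintro s₁ hF ⟨hle, hI⟩ hne
    have hF1 : Frame (Prog.for x r p) s s₁ := hF0.trans
      (hF.mono (by simp [Prog.for, Prog.wr]) (by simp [Prog.for, Prog.wa]))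
    rw [Expr.eval, hr s₁ hF1] at hne
    simp only [Expr.eval] at hne
    refine Ex.seq hN (hstep _ s₁ (by omega) hF1 rfl hI) (by omega) (b := a) (by omega) ?_
    intro s₂ hI2 hF2
    have hx2 := hF2.reg x hx
    refine Ex.assign hN (by simp only [Expr.cost]; omega) ?_
    have : (s₂.setReg x ((Expr.add (.var x) (.lit 1)).eval s₂)).reg x = s₁.reg x + 1 := by
      simp [State.setReg, Expr.eval, hx2]
    rw [this]
    exact ⟨⟨by omega, hInv _ _ _ hI2⟩, by omega⟩
  · rintro s' ⟨⟨hle, hI⟩, h⟩ hF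
    have hF1 : Frame (Prog.for x r p) s s' := hF0.trans
      (hF.mono (by simp [Prog.for, Prog.wr]) (by simp [Prog.for, Prog.wa]))
    rw [Expr.eval, hr s' hF1] at h
    simp only [Expr.eval] at h
    rwa [show s'.reg x = n by omega] at hI

/-- Increase the register `y` by the number of values of the register `x` below `r` for which the
test succeeds. -/
def count (x y : ℕ) (r test : Expr) : Prog :=
  .for x r (.branch test (.assign y (.add (.var y) (.lit 1))) .nop)

theorem count_spec {N : ℕ} (hN : 2 ≤ N) {x y : ℕ} {r test : Expr} {s : State} {n a d e : ℕ}
    (φ : ℕ → Prop) [DecidablePred φ] (hxy : x ≠ y) (hc : r.cost + test.cost + 4 ≤ 2 ^ a)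
    (hn : n ≤ N ^ d) (he : a + d + 7 ≤ e)
    (hr : ∀ s', Frame (count x y r test) s s' → r.eval s' = n)
    (ht : ∀ i s', i < n → Frame (count x y r test) s s' → s'.reg x = i → (test.eval s' ≠ 0 ↔ φ i)) :
    Ex N (count x y r test) s e
      fun s' => s'.reg y = s.reg y + ((range n).filter φ).card := by
  have h4 : 4 ≤ 2 ^ a := by omega
  have ha : 2 ≤ a := by
    by_contra h
    have : 2 ^ a ≤ 2 ^ 1 := Nat.pow_le_pow_right (by norm_num) (by omega)
    omega
  refine Ex.for (a := a + 1) (d := d) hN (fun i s' => s'.reg y = s.reg y + ((range i).filter φ).card)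
    (by simp [Prog.wr, hxy.symm]) ?_ hn (by omega) hr ?_ (by simp) ?_
  · rw [pow_succ]; omega
  · intro i s' v h
    simpa [State.setReg, hxy.symm] using h
  · intro i s' hi hF hxi hI
    have := ht i s' hi hF hxi
    refine Ex.branch hN (a := a) (b := a) (by omega) (by omega) (by omega) ?_ ?_
    · intro h
      refine Ex.assign hN (by simp [Expr.cost]; omega) ?_
      rw [range_add_one, filter_insert, if_pos (this.mp h), card_insert_of_notMem (by simp)]
      simp [State.setReg, Expr.eval, hI]; omega
    · intro h
      refine Ex.nop hN ?_
      rw [range_add_one, filter_insert, if_neg (fun h' => this.mpr h' h)]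
      exact hI

open Function in
/-- The array obtained by writing `V i` at `I i` for `i = 0, …, n - 1`. -/
def writes (I V : ℕ → ℕ) (f : ℕ → ℕ) : ℕ → ℕ → ℕ
  | 0 => f
  | n + 1 => update (writes I V f n) (I n) (V n)

theorem writes_of_ne {I V f : ℕ → ℕ} {n x : ℕ} (h : ∀ i < n, x ≠ I i) : writes I V f n x = f x := by
  induction n with
  | zero => rfl
  | succ n ih =>
    rw [writes, Function.update_of_ne (h n (by omega)), ih fun i hi => h i (by omega)]

theorem writes_of_inj {I V f : ℕ → ℕ} {n i : ℕ} (hI : Set.InjOn I (Set.Iio n)) (hi : i < n) :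
    writes I V f n (I i) = V i := by
  induction n with
  | zero => omega
  | succ n ih =>
    rcases Nat.lt_succ_iff_lt_or_eq.mp hi with h | rfl
    · have : I i ≠ I n := by
        intro heq
        have := hI (show i ∈ Set.Iio (n + 1) by simp; omega) (show n ∈ Set.Iio (n + 1) by simp) heq
        omega
      rw [writes, Function.update_of_ne this,
        ih (hI.mono (Set.Iio_subset_Iio (Nat.le_succ n))) h]
    · rw [writes, Function.update_self]

theorem writes_id {V f : ℕ → ℕ} {n i : ℕ} (hi : i < n) : writes (fun i => i) V f n i = V i :=
  writes_of_inj (I := fun i => i) (fun _ _ _ _ h => h) hi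

theorem writes_mem {I V f : ℕ → ℕ} {P : ℕ → Prop} {n x : ℕ} (hf : P (f x)) (hV : ∀ i < n, P (V i)) :
    P (writes I V f n x) := by
  induction n with
  | zero => exact hf
  | succ n ih =>
    rw [writes]
    by_cases h : x = I n
    · rw [h, Function.update_self]; exact hV n (by omega)
    · rw [Function.update_of_ne h]; exact ih fun i hi => hV i (by omega)

/-- Write `v` at `i` in the array `A` for all values of the register `x` below `r`. -/
def storeAll (x : ℕ) (r : Expr) (A : ℕ) (i v : Expr) : Prog := .for x r (.store A i v)

theorem storeAll_spec {N : ℕ} (hN : 2 ≤ N) {x A : ℕ} {r i v : Expr} {s : State} {n a d e : ℕ}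
    (I V : ℕ → ℕ) (hc : r.cost + i.cost + v.cost + 4 ≤ 2 ^ a)
    (hn : n ≤ N ^ d) (he : a + d + 6 ≤ e)
    (hr : ∀ s', Frame (storeAll x r A i v) s s' → r.eval s' = n)
    (ht : ∀ j s', j < n → Frame (storeAll x r A i v) s s' → s'.reg x = j →
      i.eval s' = I j ∧ v.eval s' = V j) :
    Ex N (storeAll x r A i v) s e fun s' => s'.arr A = writes I V (s.arr A) n := by
  refine Ex.for (a := a) (d := d) hN (fun j s' => s'.arr A = writes I V (s.arr A) j)
    (by simp [Prog.wr]) (by omega) hn he hr (fun j s' w h => by simpa [State.setReg] using h) rfl ?_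
  intro j s' hj hF hxj hI
  obtain ⟨h1, h2⟩ := ht j s' hj hF hxj
  refine Ex.store hN (by omega) ?_
  simp [State.setArr, h1, h2, hI, writes]

end RAM

/-! ### Exhaustive search over tuples of digits -/

namespace RAM

open Finset

/-- The number with the digits `d 0, …, d (n - 1)` to the base `B`. -/
def val (B : ℕ) (d : ℕ → ℕ) : ℕ → ℕ
  | 0 => 0
  | n + 1 => val B d n + d n * B ^ n

theorem val_congr {B n : ℕ} {d d' : ℕ → ℕ} (h : ∀ i < n, d i = d' i) : val B d n = val B d' n := by
  induction n with
  | zero => rfl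
  | succ n ih => rw [val, val, ih fun i hi => h i (by omega), h n (by omega)]

theorem val_zero {B n : ℕ} {d : ℕ → ℕ} (h : ∀ i < n, d i = 0) : val B d n = 0 := by
  induction n with
  | zero => rfl
  | succ n ih => rw [val, ih fun i hi => h i (by omega), h n (by omega)]; simp

theorem val_lt {B n : ℕ} {d : ℕ → ℕ} (h : ∀ i < n, d i < B) : val B d n < B ^ n := by
  induction n with
  | zero => simp [val]
  | succ n ih =>
    have h1 := ih fun i hi => h i (by omega)
    have h2 : (d n + 1) * B ^ n ≤ B * B ^ n := Nat.mul_le_mul_right _ (h n (by omega))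
    rw [val, pow_succ]
    nlinarith

theorem val_inj {B n : ℕ} {d d' : ℕ → ℕ} (h : ∀ i < n, d i < B) (h' : ∀ i < n, d' i < B)
    (he : val B d n = val B d' n) : ∀ i < n, d i = d' i := by
  induction n with
  | zero => intro i hi; omega
  | succ n ih =>
    have h1 := val_lt (n := n) fun i hi => h i (by omega)
    have h2 := val_lt (n := n) fun i hi => h' i (by omega)
    rw [val, val] at he
    have hn : d n = d' n := by
      have e1 : (val B d n + d n * B ^ n) / B ^ n = d n := by
        rw [Nat.add_mul_div_right _ _ (by omega), Nat.div_eq_of_lt h1, zero_add]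
      have e2 : (val B d' n + d' n * B ^ n) / B ^ n = d' n := by
        rw [Nat.add_mul_div_right _ _ (by omega), Nat.div_eq_of_lt h2, zero_add]
      rw [← e1, ← e2, he]
    rw [hn] at he
    intro i hi
    rcases Nat.lt_succ_iff_lt_or_eq.mp hi with hi | rfl
    · exact ih (fun i hi => h i (by omega)) (fun i hi => h' i (by omega)) (by omega) i hi
    · exact hn

/-- Increase the number with the digits in the array 23; the register 13 receives the carry. -/
def increment : Prog :=
  .seq (.assign 13 (.lit 1)) (.for 33 (.var 30)
    (.seq (.store 23 (.var 33) (.add (.get 23 (.var 33)) (.var 13)))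
      (.branch (.sub (.var 31) (.get 23 (.var 33))) (.assign 13 (.lit 0))
        (.store 23 (.var 33) (.lit 0)))))

theorem increment_spec {N : ℕ} (hN : 2 ≤ N) {s : State} {len B d : ℕ} (hlen : len ≤ N ^ d)
    (h30 : s.reg 30 = len) (h31 : s.reg 31 = B) (hd : ∀ i < len, s.arr 23 i < B) :
    Ex N increment s (d + 13) fun s' => (∀ i < len, s'.arr 23 i < B) ∧ s'.reg 13 ≤ 1 ∧
      val B (s'.arr 23) len + s'.reg 13 * B ^ len = val B (s.arr 23) len + 1 := by
  refine Ex.assign_seq (a := 1) (b := d + 12) hN (by simp [Expr.cost]) (by omega) (by omega) ?_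
  set s₀ := s.setReg 13 ((Expr.lit 1).eval s) with hs₀
  refine Ex.mono (a := d + 12) hN (Ex.for (a := 6) (d := d) (n := len) hN
    (fun i s' => (∀ j < len, s'.arr 23 j < B) ∧ (∀ j, i ≤ j → s'.arr 23 j = s.arr 23 j) ∧
      s'.reg 13 ≤ 1 ∧ val B (s'.arr 23) i + s'.reg 13 * B ^ i = val B (s.arr 23) i + 1)
    rfl (by simp [Expr.cost]) hlen (by omega) ?_ ?_ ?_ ?_) le_rfl ?_
  · intro s' hF
    rw [Expr.eval, hF.reg 30 rfl, ← h30]; rfl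
  · intro i s' v h
    simpa [State.setReg] using h
  · refine ⟨hd, fun j _ => rfl, by simp [hs₀, State.setReg, Expr.eval], ?_⟩
    simp [hs₀, State.setReg, Expr.eval, val]
  · rintro i s' hi hF hxi ⟨g1, g2, g3, g4⟩
    have e31 : s'.reg 31 = B := by rw [hF.reg 31 rfl, ← h31]; rfl
    have gi := g1 i hi
    have gi' := g2 i le_rfl
    refine Ex.store_seq (a := 3) (b := 5) hN (by simp [Expr.cost]) (by omega) (by omega) ?_
    have hv : ∀ x, val B (Function.update (s'.arr 23) i x) i = val B (s'.arr 23) i := fun x =>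
      val_congr fun j hj => Function.update_of_ne (by omega) _ _
    have hv' : ∀ x y, val B (Function.update (Function.update (s'.arr 23) i x) i y) i =
        val B (s'.arr 23) i := fun x y => by rw [Function.update_idem, hv]
    refine Ex.branch (a := 3) (b := 2) hN (by simp [Expr.cost]) (by omega) (by omega) ?_ ?_
    · intro hne
      simp only [Expr.eval, State.setArr, Function.update_self, hxi, e31] at hne
      refine Ex.assign hN (by simp [Expr.cost]) ?_
      simp only [Expr.eval, State.setReg, State.setArr, Function.update_self, hxi]
      refine ⟨?_, ?_, by omega, ?_⟩
      · intro j hj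
        by_cases hji : j = i
        · subst hji; rw [Function.update_self]; omega
        · rw [Function.update_of_ne hji]; exact g1 j hj
      · intro j hj
        rw [Function.update_of_ne (by omega)]; exact g2 j (by omega)
      · rw [val, val, hv, Function.update_self, ← gi']
        linarith
    · intro he
      simp only [Expr.eval, State.setArr, Function.update_self, hxi, e31] at he
      have hc1 : s'.reg 13 = 1 := by omega
      refine Ex.store hN (by simp [Expr.cost]) ?_
      simp only [Expr.eval, State.setArr, Function.update_self, hxi]
      refine ⟨?_, ?_, by omega, ?_⟩
      · intro j hj
        by_cases hji : j = i
        · subst hji; rw [Function.update_self]; omega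
        · rw [Function.update_of_ne hji, Function.update_of_ne hji]; exact g1 j hj
      · intro j hj
        rw [Function.update_of_ne (by omega), Function.update_of_ne (by omega)]; exact g2 j (by omega)
      · have h1 : B ^ i * B = B ^ i * (s'.arr 23 i + 1) := congrArg (B ^ i * ·) (by omega)
        rw [hc1] at g4
        rw [val, val, hv', Function.update_self, ← gi', hc1, pow_succ]
        linarith
  · rintro s' ⟨g1, g2, g3, g4⟩ _
    exact ⟨g1, g3, g4⟩

/-- Search for a tuple of digits for which `test` sets the register 12. -/
def search (test : Prog) : Prog :=
  .seq (storeAll 33 (.var 30) 23 (.var 33) (.lit 0))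
    (.seq (.assign 13 (.lit 0)) (.seq test
      (.loop (.sub (.lit 1) (.add (.var 12) (.var 13)))
        (.seq increment (.branch (.var 13) .nop test)))))

/-- Tuples are tried in the order of their values to the base B. While nothing is found and no carry
has left the top digit, all tuples up to the current value have failed, and `B ^ len` minus this
value is the variant. `Inv` must ignore the cells which the search itself writes, and `Φ` all digits
beyond the first `len`. -/
theorem search_spec {N : ℕ} (hN : 2 ≤ N) {test : Prog} {s : State} {len B a d d' : ℕ}
    (Inv : State → Prop) (Φ : (ℕ → ℕ) → Prop) (Found : State → Prop)
    (hlen : len ≤ N ^ d') (hB : 1 ≤ B) (hBlen : B ^ len ≤ N ^ d)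
    (h13 : test.wr 13 = false) (h23 : test.wa 23 = false)
    (hreg : ∀ s', Inv s' → s'.reg 30 = len ∧ s'.reg 31 = B)
    (hInv : ∀ s' s'', Inv s' → (∀ x, x ≠ 12 → x ≠ 13 → x ≠ 33 → s''.reg x = s'.reg x) →
      (∀ x, x ≠ 23 → s''.arr x = s'.arr x) → Inv s'')
    (hΦ : ∀ u v : ℕ → ℕ, (∀ i < len, u i = v i) → Φ u → Φ v)
    (htest : ∀ s', Inv s' → (∀ i < len, s'.arr 23 i < B) → Ex N test s' a fun s'' => Inv s'' ∧
      (s''.reg 12 = 0 → ¬ Φ (s'.arr 23)) ∧ (s''.reg 12 ≠ 0 → Found s''))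
    (h0 : Inv s) :
    Ex N (search test) s (a + d + d' + 30) fun s' => Inv s' ∧
      ((s'.reg 12 ≠ 0 ∧ Found s') ∨ (s'.reg 12 = 0 ∧ ∀ u, (∀ i < len, u i < B) → ¬ Φ u)) := by
  refine Ex.seq (a := d' + 9) (b := a + d + d' + 29) hN
    (storeAll_spec (a := 3) (d := d') (n := len) hN (fun i => i) (fun _ => 0)
      (by simp [Expr.cost]) hlen (by omega) ?_ ?_) (by omega) (by omega) ?_
  · intro s' hF; rw [Expr.eval, hF.reg 30 rfl, (hreg s h0).1]
  · intro j s' _ _ hj; exact ⟨hj, rfl⟩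
  intro s₁ q1 F1
  have I1 : Inv s₁ := by
    refine hInv s s₁ h0 (fun x _ _ h33 => F1.reg x ?_) fun x hx => F1.arr x ?_
    · simp [storeAll, Prog.for, Prog.wr]; omega
    · simp [storeAll, Prog.for, Prog.wa]; omega
  have hz : ∀ i < len, s₁.arr 23 i = 0 := by
    intro i hi
    rw [q1, writes_id hi]
  refine Ex.assign_seq (a := 1) (b := a + d + d' + 28) hN (by simp [Expr.cost]) (by omega) (by omega) ?_
  set s₂ := s₁.setReg 13 ((Expr.lit 0).eval s₁) with hs₂
  have I2 : Inv s₂ := by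
    refine hInv s₁ s₂ I1 (fun x _ h13 _ => ?_) fun x hx => rfl
    simp [hs₂, State.setReg, h13]
  have z2 : ∀ i < len, s₂.arr 23 i = 0 := hz
  refine Ex.seq (b := a + d + d' + 27) hN (htest s₂ I2 (fun i hi => by rw [z2 i hi]; omega)) (by omega) (by omega) ?_
  rintro s₃ ⟨I3, n3, f3⟩ F3
  have e23 : s₃.arr 23 = s₂.arr 23 := F3.arr 23 h23
  have e13 : s₃.reg 13 = 0 := by rw [F3.reg 13 h13]; simp [hs₂, State.setReg, Expr.eval]
  -- the loop
  refine Ex.mono hN (Ex.loop (a := a + d' + 16) (d := d) (e := a + d + d' + 27) hN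
    (fun s' => Inv s' ∧ (∀ i < len, s'.arr 23 i < B) ∧
      (s'.reg 12 = 0 → ∀ u, (∀ i < len, u i < B) →
        (s'.reg 13 = 0 → val B u len ≤ val B (s'.arr 23) len) → ¬ Φ u) ∧
      (s'.reg 12 ≠ 0 → Found s'))
    (fun s' => if s'.reg 13 = 0 then B ^ len - val B (s'.arr 23) len else 0)
    ?_ ?_ ?_ (by omega) ?_) le_rfl ?_
  · simp only [Expr.cost]
    calc 6 ≤ 2 ^ 16 := by norm_num
      _ ≤ _ := Nat.pow_le_pow_right (by norm_num) (by omega)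
  · refine ⟨I3, fun i hi => by rw [e23, z2 i hi]; omega, fun h12 u hu hle hΦu => ?_, f3⟩
    have hv : val B u len = val B (s₂.arr 23) len := by
      have := hle e13
      rw [e23, val_zero z2] at this
      rw [val_zero z2]; omega
    exact n3 h12 (hΦ u _ (val_inj hu (fun i hi => by rw [z2 i hi]; omega) hv) hΦu)
  · split_ifs
    · exact (Nat.sub_le _ _).trans hBlen
  · rintro s₄ _ ⟨I4, g4, n4, f4⟩ hne
    simp only [Expr.eval] at hne
    have z12 : s₄.reg 12 = 0 := by omega
    have z13 : s₄.reg 13 = 0 := by omega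
    refine Ex.seq (a := d' + 13) (b := a + d' + 15) hN (increment_spec hN hlen (hreg s₄ I4).1 (hreg s₄ I4).2 g4)
      (by omega) (by omega) ?_
    rintro s₅ ⟨g5, c5, v5⟩ F5
    have I5 : Inv s₅ := by
      refine hInv s₄ s₅ I4 (fun x _ h13 h33 => F5.reg x ?_) fun x hx => F5.arr x ?_
      · simp [increment, Prog.for, Prog.wr]; omega
      · simp [increment, Prog.for, Prog.wa]; omega
    have z12' : s₅.reg 12 = 0 := by rw [F5.reg 12 rfl, z12]
    have hlt4 := val_lt g4
    have hlt5 := val_lt g5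
    refine Ex.branch (a := 2) (b := a + d' + 14) hN (by simp [Expr.cost]) (by omega) (by omega) ?_ ?_
    · intro h
      simp only [Expr.eval] at h
      have h1 : s₅.reg 13 = 1 := by omega
      rw [h1] at v5
      -- A carry out of the top digit means that the tuple just tried had the value `B ^ len - 1`,
      -- so no tuple is left.
      refine Ex.nop hN ⟨⟨I5, g5, fun _ u hu _ => ?_, fun h => absurd z12' h⟩, ?_⟩
      · refine n4 z12 u hu fun _ => ?_
        have := val_lt hu
        omega
      · rw [if_neg h, if_pos z13]; omega
    · intro h
      simp only [Expr.eval] at h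
      rw [h] at v5
      refine Ex.mono hN (htest s₅ I5 g5) (by omega) ?_
      rintro s₆ ⟨I6, n6, f6⟩ F6
      have e23 : s₆.arr 23 = s₅.arr 23 := F6.arr 23 h23
      have e13 : s₆.reg 13 = s₅.reg 13 := F6.reg 13 h13
      rw [e23, e13, h, if_pos rfl, if_pos z13]
      refine ⟨⟨I6, g5, fun h12 u hu hle hΦu => ?_, f6⟩, by omega⟩
      have hle := hle rfl
      rcases Nat.lt_or_ge (val B (s₄.arr 23) len) (val B u len) with hlt | hge
      · exact n6 h12 (hΦ u _ (val_inj hu g5 (by omega)) hΦu)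
      · exact n4 z12 u hu (fun _ => hge) hΦu
  · rintro s' ⟨⟨I', g', n', f'⟩, h⟩ _
    simp only [Expr.eval] at h
    refine ⟨I', ?_⟩
    by_cases h12 : s'.reg 12 = 0
    · refine Or.inr ⟨h12, fun u hu => n' h12 u hu fun h13 => by omega⟩
    · exact Or.inl ⟨h12, f' h12⟩

end RAM

/-! ### The auction algorithm as a program -/

namespace RAM

open Finset ExactMatching

/-- The colour of the pair `(i, j)` as found in memory: the array 3 holds the beginnings of the rows of
the matrix in the array 1, the arrays 4 and 5 list the vertices of the two sides. -/
def colour (s : State) (i j : ℕ) : ℕ := s.arr 1 (s.arr 3 (s.arr 4 i) + s.arr 5 j)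

/-- The expression for `colour`. -/
def codeE (i j : Expr) : Expr := .get 1 (.add (.get 3 (.get 4 i)) (.get 5 j))

theorem eval_codeE (s : State) (i j : Expr) :
    (codeE i j).eval s = colour s (i.eval s) (j.eval s) := rfl

/-- Nonzero if the values differ. -/
def neqE (i j : Expr) : Expr := .add (.sub i j) (.sub j i)

theorem eval_neqE (s : State) (i j : Expr) : (neqE i j).eval s ≠ 0 ↔ i.eval s ≠ j.eval s := by
  simp only [neqE, Expr.eval]; omega

/-- Nonzero if the values agree. -/
def eqE (i j : Expr) : Expr := .sub (.lit 1) (neqE i j)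

theorem eval_eqE (s : State) (i j : Expr) : (eqE i j).eval s ≠ 0 ↔ i.eval s = j.eval s := by
  simp only [eqE, neqE, Expr.eval]; omega

/-- The memory holds the `m × m` coloured adjacency matrix `c` and the target `k`. -/
structure Ctx (m k : ℕ) (c : ℕ → ℕ → ℕ) (s : State) : Prop where
  size : s.reg 3 = m
  target : s.reg 1 = k
  code : ∀ i < m, ∀ j < m, colour s i j = c i j

theorem Ctx.congr {m k : ℕ} {c : ℕ → ℕ → ℕ} {s s' : State} (h : Ctx m k c s)
    (h3 : s'.reg 3 = s.reg 3) (h1 : s'.reg 1 = s.reg 1)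
    (ha : ∀ a, a = 1 ∨ a = 3 ∨ a = 4 ∨ a = 5 → s'.arr a = s.arr a) : Ctx m k c s' := by
  refine ⟨h3.trans h.size, h1.trans h.target, fun i hi j hj => ?_⟩
  rw [← h.code i hi j hj, colour, colour, ha 1 (by simp), ha 3 (by simp), ha 4 (by simp),
    ha 5 (by simp)]

theorem Ctx.frame {m k : ℕ} {c : ℕ → ℕ → ℕ} {s s' : State} {p : Prog} (h : Ctx m k c s)
    (hF : Frame p s s')
    (hp : (p.wr 3 || p.wr 1 || p.wa 1 || p.wa 3 || p.wa 4 || p.wa 5) = false) : Ctx m k c s' := by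
  simp only [Bool.or_eq_false_iff] at hp
  refine h.congr (hF.reg 3 (by tauto)) (hF.reg 1 (by tauto)) ?_
  rintro a (rfl | rfl | rfl | rfl) <;> exact hF.arr _ (by tauto)

/-- Compute the weight of the pair given by the registers 40 and 42. -/
def weightP (bonus : ℕ) : Prog :=
  .branch (codeE (.var 40) (.var 42))
    (.branch (eqE (codeE (.var 40) (.var 42)) (.lit bonus))
      (.assign 45 (.add (.var 47) (.var 46))) (.assign 45 (.var 47)))
    (.assign 45 (.lit 0))

section

variable {N m k : ℕ} {c : ℕ → ℕ → ℕ} {s : State}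

theorem weightP_spec (hN : 2 ≤ N) (hs : Ctx m k c s) {bonus i j : ℕ} (hi : s.reg 40 = i)
    (hj : s.reg 42 = j) (him : i < m) (hjm : j < m) (h46 : s.reg 46 = m + 1)
    (h47 : s.reg 47 = (m + 1) * (m + 1)) :
    Ex N (weightP bonus) s 7 fun s' => s'.reg 45 = auctionWeight m bonus c i j := by
  have e : (codeE (.var 40) (.var 42)).eval s = c i j := by
    rw [eval_codeE, ← hs.code i him j hjm, ← hi, ← hj]; rfl
  refine Ex.branch (a := 6) (b := 6) hN (by simp [codeE, Expr.cost]) (by omega) (by omega) ?_ ?_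
  · intro h
    rw [e] at h
    refine Ex.branch (a := 5) (b := 5) hN (by simp [codeE, eqE, neqE, Expr.cost]) (by omega) (by omega) ?_ ?_
    · intro h'
      rw [eval_eqE, e] at h'
      refine Ex.assign hN (by simp [Expr.cost]) ?_
      simp [State.setReg, Expr.eval, auctionWeight, h46, h47, show c i j = bonus from h',
        show bonus ≠ 0 from fun h0 => h (h'.trans h0)]
    · intro h'
      have h' := fun h'' => (eval_eqE _ _ _).mpr h'' h'
      rw [e] at h'
      refine Ex.assign hN (by simp [Expr.cost]) ?_
      have h' : ¬ c i j = bonus := h'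
      simp [State.setReg, Expr.eval, auctionWeight, h, h47, h']
  · intro h
    rw [e] at h
    refine Ex.assign hN (by simp [Expr.cost]) ?_
    simp [State.setReg, Expr.eval, auctionWeight, h]

/-- Look for an unassigned person. -/
def findFree : Prog :=
  .seq (.assign 48 (.lit 0)) (.for 41 (.var 3)
    (.branch (.get 8 (.var 41)) .nop (.seq (.assign 48 (.lit 1)) (.assign 40 (.var 41)))))

theorem findFree_spec (hN : 2 ≤ N) (hm : m ≤ N) (hs : s.reg 3 = m) :
    Ex N findFree s 13 fun s' => (s'.reg 48 = 0 ∧ ∀ i < m, s.arr 8 i ≠ 0) ∨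
      (s'.reg 48 ≠ 0 ∧ s'.reg 40 < m ∧ s.arr 8 (s'.reg 40) = 0) := by
  refine Ex.assign_seq (a := 1) (b := 12) hN (by simp [Expr.cost]) (by omega) (by omega) ?_
  refine Ex.mono (a := 12) hN (Ex.for (a := 5) (d := 1) (n := m) hN
    (fun i s' => (s'.reg 48 = 0 ∧ ∀ i' < i, s.arr 8 i' ≠ 0) ∨
      (s'.reg 48 ≠ 0 ∧ s'.reg 40 < m ∧ s.arr 8 (s'.reg 40) = 0))
    rfl (by simp [Expr.cost]) (by simpa using hm) (by omega) ?_ ?_ ?_ ?_) le_rfl (fun s' h _ => h)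
  · intro s' hF
    rw [Expr.eval, hF.reg 3 rfl, ← hs]; rfl
  · intro i s' v h
    simpa [State.setReg] using h
  · exact Or.inl ⟨by simp [State.setReg, Expr.eval], by omega⟩
  · intro i s' hi hF hx hI
    have h8 : s'.arr 8 = s.arr 8 := (hF.arr 8 rfl).trans rfl
    refine Ex.branch (a := 4) (b := 4) hN (by simp [Expr.cost]) (by omega) (by omega) ?_ ?_
    · intro h
      simp only [Expr.eval, hx, h8] at h
      refine Ex.nop hN ?_
      rcases hI with ⟨h1, h2⟩ | h1
      · refine Or.inl ⟨h1, fun i' hi' => ?_⟩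
        rcases Nat.lt_succ_iff_lt_or_eq.mp hi' with h3 | rfl
        · exact h2 i' h3
        · exact h
      · exact Or.inr h1
    · intro h
      simp only [Expr.eval, hx, h8] at h
      refine Ex.assign_seq (a := 1) (b := 2) hN (by simp [Expr.cost]) (by omega) (by omega) ?_
      refine Ex.assign hN (by simp [Expr.cost]) (Or.inr ?_)
      simp [State.setReg, Expr.eval, hx, hi, h]

/-- Find the object which is best for the person in the register 40. -/
def findBest (bonus : ℕ) : Prog :=
  .seq (.assign 42 (.lit 0)) (.seq (weightP bonus) (.seq (.assign 44 (.var 45))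
    (.seq (.assign 43 (.lit 0)) (.for 42 (.var 3) (.seq (weightP bonus)
      -- Weight minus price is compared with the prices moved to the opposite sides, where truncated
      -- subtraction does no harm.
      (.branch (.sub (.add (.var 45) (.get 6 (.var 43))) (.add (.var 44) (.get 6 (.var 42))))
        (.seq (.assign 43 (.var 42)) (.assign 44 (.var 45))) .nop))))))

theorem findBest_spec (hN : 2 ≤ N) (hm : m ≤ N) (hs : Ctx m k c s) {bonus i : ℕ}
    (hi : s.reg 40 = i) (him : i < m) (h46 : s.reg 46 = m + 1) (h47 : s.reg 47 = (m + 1) * (m + 1)) :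
    Ex N (findBest bonus) s 20 fun s' => s'.reg 43 < m ∧ ∀ l < m,
      auctionWeight m bonus c i l + s.arr 6 (s'.reg 43) ≤
        auctionWeight m bonus c i (s'.reg 43) + s.arr 6 l := by
  refine Ex.assign_seq (a := 1) (b := 19) hN (by simp [Expr.cost]) (by omega) (by omega) ?_
  have hs1 : Ctx m k c (s.setReg 42 ((Expr.lit 0).eval s)) :=
    hs.congr rfl rfl (fun _ _ => rfl)
  refine Ex.seq (b := 18) hN (weightP_spec hN hs1 (i := i) (j := 0) hi rfl him (by omega) h46 h47)
    (by omega) (by omega) ?_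
  intro s₂ h2 F2
  refine Ex.assign_seq (a := 1) (b := 17) hN (by simp [Expr.cost]) (by omega) (by omega) ?_
  refine Ex.assign_seq (a := 1) (b := 16) hN (by simp [Expr.cost]) (by omega) (by omega) ?_
  refine Ex.mono (a := 16) hN (Ex.for (a := 9) (d := 1) (n := m) hN
    (fun j s' => s'.reg 43 < m ∧ s'.reg 44 = auctionWeight m bonus c i (s'.reg 43) ∧ ∀ l < j,
      auctionWeight m bonus c i l + s.arr 6 (s'.reg 43) ≤
        auctionWeight m bonus c i (s'.reg 43) + s.arr 6 l)
    rfl (by simp [Expr.cost]) (by simpa using hm) (by omega) ?_ ?_ ?_ ?_) le_rfl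
    (fun s' h _ => ⟨h.1, h.2.2⟩)
  · intro s' hF
    rw [Expr.eval, hF.reg 3 rfl, ← hs.size]
    exact F2.reg 3 rfl
  · intro i s' v h
    simpa [State.setReg] using h
  · refine ⟨?_, ?_, by omega⟩
    · simp [State.setReg, Expr.eval]; omega
    · simpa [State.setReg, Expr.eval] using h2
  · rintro j s' hj hF hx ⟨g1, g2, g3⟩
    have hs' : Ctx m k c s' := ((hs1.frame F2 rfl).congr
      (s' := s') (hF.reg 3 rfl) (hF.reg 1 rfl) (by rintro a (rfl | rfl | rfl | rfl) <;> exact hF.arr _ rfl))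
    have r40 : s'.reg 40 = i := ((hF.reg 40 rfl).trans (F2.reg 40 rfl)).trans hi
    have r46 : s'.reg 46 = m + 1 := ((hF.reg 46 rfl).trans (F2.reg 46 rfl)).trans h46
    have r47 : s'.reg 47 = (m + 1) * (m + 1) := ((hF.reg 47 rfl).trans (F2.reg 47 rfl)).trans h47
    have a6 : s'.arr 6 = s.arr 6 := (hF.arr 6 rfl).trans (F2.arr 6 rfl)
    refine Ex.seq (b := 8) hN (weightP_spec hN hs' r40 hx him hj r46 r47) (by omega) (by omega) ?_
    intro s₄ h4 F4
    have r43 : s₄.reg 43 = s'.reg 43 := F4.reg 43 rfl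
    have r44 : s₄.reg 44 = s'.reg 44 := F4.reg 44 rfl
    have r42 : s₄.reg 42 = j := (F4.reg 42 rfl).trans hx
    have a64 : s₄.arr 6 = s.arr 6 := (F4.arr 6 rfl).trans a6
    refine Ex.branch (a := 5) (b := 5) hN (by simp [Expr.cost]) (by omega) (by omega) ?_ ?_
    · intro h
      simp only [Expr.eval, h4, r43, r44, r42, a64, g2] at h
      refine Ex.assign_seq (a := 1) (b := 1) hN (by simp [Expr.cost]) (by omega) (by omega) ?_
      refine Ex.assign hN (by simp [Expr.cost]) ?_
      simp only [State.setReg, Expr.eval, r42]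
      refine ⟨by simpa using hj, by simpa using h4, ?_⟩
      intro l hl
      simp only [Function.update_of_ne (show (43 : ℕ) ≠ 44 by norm_num), Function.update_self]
      rcases Nat.lt_succ_iff_lt_or_eq.mp hl with h3 | rfl
      · have := g3 l h3; omega
      · exact le_rfl
    · intro h
      simp only [Expr.eval, h4, r43, r44, r42, a64, g2] at h
      refine Ex.nop hN ?_
      rw [r43, r44]
      refine ⟨g1, g2, ?_⟩
      intro l hl
      rcases Nat.lt_succ_iff_lt_or_eq.mp hl with h3 | rfl
      · exact g3 l h3
      · omega

/-- Assign the object in the register 43 to the person in the register 40. -/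
def bid : Prog :=
  .seq (.branch (.get 7 (.var 43)) (.store 8 (.sub (.get 7 (.var 43)) (.lit 1)) (.lit 0)) .nop)
    (.seq (.store 7 (.var 43) (.add (.var 40) (.lit 1)))
      (.seq (.store 8 (.var 40) (.add (.var 43) (.lit 1)))
        (.store 6 (.var 43) (.add (.get 6 (.var 43)) (.lit 1)))))

open Function in
theorem bid_spec (hN : 2 ≤ N) {i j : ℕ} (hi : s.reg 40 = i) (hj : s.reg 43 = j) :
    Ex N bid s 10 fun s' => s'.arr 6 = update (s.arr 6) j (s.arr 6 j + 1) ∧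
      s'.arr 7 = update (s.arr 7) j (i + 1) ∧
      s'.arr 8 = update (if s.arr 7 j = 0 then s.arr 8 else update (s.arr 8) (s.arr 7 j - 1) 0) i (j + 1) := by
  refine Ex.seq (a := 5) (b := 9) (Q := fun s' => s'.arr 8 = if s.arr 7 j = 0 then s.arr 8 else
    update (s.arr 8) (s.arr 7 j - 1) 0) hN ?_ (by omega) (by omega) ?_
  · refine Ex.branch (a := 3) (b := 3) hN (by simp [Expr.cost]) (by omega) (by omega) ?_ ?_
    · intro h
      simp only [Expr.eval, hj] at h
      refine Ex.store hN (by simp [Expr.cost]) ?_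
      simp [State.setArr, Expr.eval, hj, h]
    · intro h
      simp only [Expr.eval, hj] at h
      exact Ex.nop hN (by simp [h])
  · intro s₁ h1 F1
    have r40 : s₁.reg 40 = i := (F1.reg 40 rfl).trans hi
    have r43 : s₁.reg 43 = j := (F1.reg 43 rfl).trans hj
    have a6 : s₁.arr 6 = s.arr 6 := F1.arr 6 rfl
    have a7 : s₁.arr 7 = s.arr 7 := F1.arr 7 rfl
    refine Ex.store_seq (a := 3) (b := 8) hN (by simp [Expr.cost]) (by omega) (by omega) ?_
    refine Ex.store_seq (a := 3) (b := 7) hN (by simp [Expr.cost]) (by omega) (by omega) ?_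
    refine Ex.store hN (by simp [Expr.cost]) ?_
    simp [State.setArr, Expr.eval, r40, r43, a6, a7, h1]

/-- Compute a perfect matching with a maximum number of edges of the colour `bonus`. -/
def auction (bonus dst : ℕ) : Prog :=
  .seq (.assign 46 (.add (.var 3) (.lit 1))) (.seq (.assign 47 (.lit 0))
    -- The square (m+1)² is obtained by repeated addition.
    (.seq (.for 41 (.var 46) (.assign 47 (.add (.var 47) (.var 46))))
      (.seq (storeAll 41 (.var 3) 6 (.var 41) (.lit 0))
        (.seq (storeAll 41 (.var 3) 7 (.var 41) (.lit 0))
          (.seq (storeAll 41 (.var 3) 8 (.var 41) (.lit 0))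
            (.seq findFree (.seq (.loop (.var 48) (.seq (findBest bonus) (.seq bid findFree)))
              (storeAll 41 (.var 3) dst (.var 41) (.sub (.get 8 (.var 41)) (.lit 1))))))))))

/-- Every bid raises the sum of the prices by 1, and this sum stays at most m(W+1), which bounds the
number of rounds. The auction halts whether or not a perfect matching exists; the array written has
entries below m in any case. -/
theorem auction_spec (hN : 2 ≤ N) (hm : m ≤ N) (hs : Ctx m k c s) {bonus dst : ℕ} (hbonus : bonus ≠ 0)
    (hdst : 20 ≤ dst) :
    Ex N (auction bonus dst) s 60 fun s' => (∀ i < m, s'.arr dst i < m) ∧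
      ∀ g, IsPM m c g → IsPM m c (s'.arr dst) ∧
        ((range m).filter fun i => c i (g i) = bonus).card ≤
          ((range m).filter fun i => c i (s'.arr dst i) = bonus).card := by
  have hm1 : m + 1 ≤ N ^ 2 := by nlinarith
  set W := (m + 1) * (m + 1) + (m + 1) with hW
  have hWN : m * (W + 1) + 1 ≤ N ^ 8 := by
    have h1 : (m + 1) * (m + 1) ≤ N ^ 2 * N ^ 2 := Nat.mul_le_mul hm1 hm1
    have h2 : N ^ 2 * N ^ 2 = N ^ 4 := by ring
    have h4 : 4 ≤ N ^ 2 := by nlinarith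
    have h5 : N ^ 2 ≤ N ^ 4 := Nat.pow_le_pow_right (by omega) (by omega)
    have h6 : W + 2 ≤ N ^ 4 * N ^ 2 := by nlinarith
    have h7 : (m + 1) * (W + 2) ≤ N ^ 2 * (N ^ 4 * N ^ 2) := Nat.mul_le_mul hm1 h6
    have h8 : N ^ 2 * (N ^ 4 * N ^ 2) = N ^ 8 := by ring
    nlinarith
  refine Ex.assign_seq (a := 2) (b := 59) hN (by simp [Expr.cost]) (by omega) (by omega) ?_
  refine Ex.assign_seq (a := 2) (b := 58) hN (by simp [Expr.cost]) (by omega) (by omega) ?_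
  set s₁ := (s.setReg 46 _).setReg 47 _ with hs₁
  have c1 : Ctx m k c s₁ := hs.congr rfl rfl fun _ _ => rfl
  have r1 : s₁.reg 46 = m + 1 := by simp [hs₁, State.setReg, Expr.eval, hs.size]
  refine Ex.seq (a := 11) (b := 57) (Q := fun s' => s'.reg 47 = (m + 1) * (m + 1)) hN
    (Ex.for (a := 3) (d := 2) (n := m + 1) hN (fun i s' => s'.reg 47 = i * (m + 1))
      rfl (by simp [Expr.cost]) hm1 (by omega) ?_ ?_ ?_ ?_) (by omega) (by omega) ?_
  · intro s' hF
    rw [Expr.eval, hF.reg 46 rfl, r1]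
  · intro i s' v h
    simpa [State.setReg] using h
  · simp [hs₁, State.setReg, Expr.eval]
  · intro i s' hi hF hx h
    refine Ex.assign hN (by simp [Expr.cost]) ?_
    have : s'.reg 46 = m + 1 := (hF.reg 46 rfl).trans r1
    simp [State.setReg, Expr.eval, h, this]; ring
  intro s₂ h47 F2
  have c2 : Ctx m k c s₂ := c1.frame F2 rfl
  have r2 : s₂.reg 46 = m + 1 := (F2.reg 46 rfl).trans r1
  have hm' : m ≤ N ^ 1 := by simpa using hm
  refine Ex.seq (a := 10) (b := 56) hN (storeAll_spec (a := 3) (d := 1) (n := m) hN (fun i => i) (fun _ => 0)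
      (by simp [Expr.cost]) hm' (by omega) ?_ ?_) (by omega) (by omega) ?_
  · intro s' hF; rw [Expr.eval, hF.reg 3 rfl, c2.size]
  · intro j s' _ _ hj; exact ⟨hj, rfl⟩
  intro s₃ h6 F3
  have c3 : Ctx m k c s₃ := c2.frame F3 rfl
  refine Ex.seq (a := 10) (b := 55) hN (storeAll_spec (a := 3) (d := 1) (n := m) hN (fun i => i) (fun _ => 0)
      (by simp [Expr.cost]) hm' (by omega) ?_ ?_) (by omega) (by omega) ?_
  · intro s' hF; rw [Expr.eval, hF.reg 3 rfl, c3.size]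
  · intro j s' _ _ hj; exact ⟨hj, rfl⟩
  intro s₄ h7 F4
  have c4 : Ctx m k c s₄ := c3.frame F4 rfl
  refine Ex.seq (a := 10) (b := 54) hN (storeAll_spec (a := 3) (d := 1) (n := m) hN (fun i => i) (fun _ => 0)
      (by simp [Expr.cost]) hm' (by omega) ?_ ?_) (by omega) (by omega) ?_
  · intro s' hF; rw [Expr.eval, hF.reg 3 rfl, c4.size]
  · intro j s' _ _ hj; exact ⟨hj, rfl⟩
  intro s₅ h8 F5
  have c5 : Ctx m k c s₅ := c4.frame F5 rfl
  have I5 : AuctionInv m W (auctionWeight m bonus c) (s₅.arr 6) (s₅.arr 7) (s₅.arr 8) := by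
    apply AuctionInv.init
    · intro j hj
      rw [F5.arr 6 rfl, F4.arr 6 rfl, h6, writes_id hj]
    · intro j hj
      rw [F5.arr 7 rfl, h7, writes_id hj]
    · intro j hj
      rw [h8, writes_id hj]
  refine Ex.seq (b := 53) hN (findFree_spec hN hm c5.size) (by omega) (by omega) ?_
  intro s₆ h48 F6
  have c6 : Ctx m k c s₆ := c5.frame F6 rfl
  have r46 : s₆.reg 46 = m + 1 := by
    rw [F6.reg 46 rfl, F5.reg 46 rfl, F4.reg 46 rfl, F3.reg 46 rfl, r2]
  have r47 : s₆.reg 47 = (m + 1) * (m + 1) := by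
    rw [F6.reg 47 rfl, F5.reg 47 rfl, F4.reg 47 rfl, F3.reg 47 rfl, h47]
  have I6 : AuctionInv m W (auctionWeight m bonus c) (s₆.arr 6) (s₆.arr 7) (s₆.arr 8) := by
    rw [F6.arr 6 rfl, F6.arr 7 rfl, F6.arr 8 rfl]; exact I5
  have e8 : s₆.arr 8 = s₅.arr 8 := F6.arr 8 rfl
  rw [← e8] at h48
  refine Ex.seq (b := 11) hN (Ex.loop (a := 22) (d := 8) (e := 52) hN
    (fun s' => AuctionInv m W (auctionWeight m bonus c) (s'.arr 6) (s'.arr 7) (s'.arr 8) ∧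
      ((s'.reg 48 = 0 ∧ ∀ i < m, s'.arr 8 i ≠ 0) ∨
        (s'.reg 48 ≠ 0 ∧ s'.reg 40 < m ∧ s'.arr 8 (s'.reg 40) = 0)))
    (fun s' => m * (W + 1) + 1 - ∑ j ∈ range m, s'.arr 6 j) (by simp [Expr.cost]) ⟨I6, h48⟩
    ((Nat.sub_le _ _).trans hWN) (by omega) ?_) (by omega) (by omega) ?_
  · rintro s₇ F7 ⟨I7, h7⟩ hne
    simp only [Expr.eval] at hne
    obtain ⟨-, g1, g2⟩ := h7.resolve_left fun h => hne h.1
    have c7 : Ctx m k c s₇ := c6.frame F7 rfl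
    refine Ex.seq (b := 21) hN (findBest_spec hN hm c7 rfl g1 ((F7.reg 46 rfl).trans r46)
      ((F7.reg 47 rfl).trans r47)) (by omega) (by omega) ?_
    rintro s₈ ⟨j1, j2⟩ F8
    have a6 : s₈.arr 6 = s₇.arr 6 := F8.arr 6 rfl
    have a7 : s₈.arr 7 = s₇.arr 7 := F8.arr 7 rfl
    have a8 : s₈.arr 8 = s₇.arr 8 := F8.arr 8 rfl
    have c8 : Ctx m k c s₈ := c7.frame F8 rfl
    refine Ex.seq (b := 20) hN (bid_spec hN (F8.reg 40 rfl) rfl) (by omega) (by omega) ?_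
    rintro s₉ ⟨b6, b7, b8⟩ F9
    rw [a6] at b6
    rw [a7] at b7
    rw [a7, a8] at b8
    have c9 : Ctx m k c s₉ := c8.frame F9 rfl
    refine Ex.mono hN (findFree_spec hN hm c9.size) (by omega) ?_
    intro s' h' F'
    have e6 : s'.arr 6 = s₉.arr 6 := F'.arr 6 rfl
    have e7 : s'.arr 7 = s₉.arr 7 := F'.arr 7 rfl
    have e8 : s'.arr 8 = s₉.arr 8 := F'.arr 8 rfl
    have I9 := I7.step (fun i _ j _ => auctionWeight_le m bonus c i j) g1 g2 j1 j2 rfl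
    rw [← b6, ← b7, ← b8] at I9
    refine ⟨⟨by rw [e6, e7, e8]; exact I9, by rw [e8]; exact h'⟩, ?_⟩
    have h9 : _ ≤ m * (W + 1) := I9.sum_le
    have h10 := sum_update_succ j1 (s₇.arr 6)
    rw [← b6] at h10
    simp only [e6]
    omega
  · rintro s₇ ⟨⟨I7, h7⟩, h0⟩ F7
    simp only [Expr.eval] at h0
    obtain ⟨-, hall⟩ := h7.resolve_right fun h => h.1 h0
    have c7 : Ctx m k c s₇ := c6.frame F7 rfl
    obtain ⟨o1, o2, o3⟩ := I7.optimal hall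
    refine Ex.mono (a := 11) hN (storeAll_spec (a := 4) (d := 1) (n := m) hN (fun i => i)
      (fun i => s₇.arr 8 i - 1) (by simp [Expr.cost]) hm' (by omega) ?_ ?_) le_rfl ?_
    · intro s' hF; rw [Expr.eval, hF.reg 3 rfl, c7.size]
    · intro j s' _ hF hj
      refine ⟨hj, ?_⟩
      have : s'.arr 8 = s₇.arr 8 := hF.arr 8 (by simp [storeAll, Prog.for, Prog.wa]; omega)
      simp [Expr.eval, hj, this]
    · intro s' h' _
      have hv : ∀ i < m, s'.arr dst i = s₇.arr 8 i - 1 := fun i hi => by rw [h', writes_id hi]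
      have hlt : ∀ i < m, s'.arr dst i < m := fun i hi => by rw [hv i hi]; exact o1 i hi
      refine ⟨hlt, fun g hg => ?_⟩
      refine bonus_optimal hbonus hlt ?_ hg ?_
      · intro x hx y hy hxy
        rw [hv x hx, hv y hy] at hxy
        exact o2 hx hy hxy
      · refine (o3 g (fun i hi => (hg.1 i hi).1) hg.2).trans (le_of_eq ?_)
        congr 1
        apply sum_congr rfl
        intro i hi
        rw [hv i (mem_range.mp hi)]

end

end RAM

/-! ### The tests of the exhaustive searches -/

namespace ExactMatching

open Finset RAM

section Congr

variable {m : ℕ} {c : ℕ → ℕ → ℕ} {f f' g g' : ℕ → ℕ}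

theorem IsPM.congr (h : IsPM m c f) (hf : ∀ i < m, f' i = f i) : IsPM m c f' := by
  refine ⟨fun i hi => by rw [hf i hi]; exact h.1 i hi, fun i hi j hj hij => ?_⟩
  rw [hf i hi, hf j hj] at hij
  exact h.2 hi hj hij

theorem redCount_congr (hf : ∀ i < m, f' i = f i) : redCount m c f' = redCount m c f := by
  rw [redCount, redCount]
  congr 1
  apply filter_congr
  intro i hi
  rw [hf i (mem_range.mp hi)]

theorem diffs_congr (hf : ∀ i < m, f' i = f i) (hg : ∀ i < m, g' i = g i) :
    diffs m f' g' = diffs m f g := by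
  rw [diffs, diffs]
  congr 1
  apply filter_congr
  intro i hi
  rw [hf i (mem_range.mp hi), hg i (mem_range.mp hi)]

end Congr

/-- The modification of `f` described by the tuple `d`: the value at `d t` becomes `d (l + t)`. -/
def patch (f : ℕ → ℕ) (l : ℕ) (d : ℕ → ℕ) : ℕ → ℕ := writes d (fun t => d (l + t)) f l

theorem writes_congr {I V I' V' f f' : ℕ → ℕ} {n x : ℕ} (hI : ∀ i < n, I i = I' i)
    (hV : ∀ i < n, V i = V' i) (hf : f x = f' x) : writes I V f n x = writes I' V' f' n x := by
  induction n with
  | zero => exact hf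
  | succ n ih =>
    rw [writes, writes, hI n (by omega), hV n (by omega)]
    have := ih (fun i hi => hI i (by omega)) (fun i hi => hV i (by omega))
    by_cases h : x = I' n
    · rw [h, Function.update_self, Function.update_self]
    · rw [Function.update_of_ne h, Function.update_of_ne h, this]

theorem patch_congr {f : ℕ → ℕ} {l : ℕ} {d d' : ℕ → ℕ} (h : ∀ i < l + l, d i = d' i) :
    patch f l d = patch f l d' :=
  funext fun _ => writes_congr (fun i hi => h i (by omega)) (fun i hi => h _ (by omega)) rfl

theorem diffs_patch (m : ℕ) (f : ℕ → ℕ) (l : ℕ) (d : ℕ → ℕ) : diffs m f (patch f l d) ≤ l := by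
  rw [diffs]
  have : (range m).filter (fun i => f i ≠ patch f l d i) ⊆ (range l).image d := by
    intro x hx
    by_contra hn
    refine (mem_filter.mp hx).2 (writes_of_ne fun i hi h => hn ?_).symm
    exact mem_image.mpr ⟨i, mem_range.mpr hi, h.symm⟩
  exact (card_le_card this).trans (card_image_le.trans (card_range l).le)

theorem patch_lt {m l : ℕ} {f d : ℕ → ℕ} (hf : ∀ i < m, f i < m) (hd : ∀ i < l + l, d i < m) :
    ∀ i < m, patch f l d i < m := fun i hi =>
  writes_mem (P := fun x => x < m) (hf i hi) fun j hj => hd _ (by omega)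

/-- Every write puts the final value in place, so positions may repeat and unchanged positions may
be rewritten. -/
theorem writes_comp {I f g : ℕ → ℕ} {n x : ℕ} (h : g x = f x ∨ ∃ t < n, I t = x) :
    writes I (fun t => f (I t)) g n x = f x := by
  induction n with
  | zero => rcases h with h | ⟨t, ht, -⟩; exacts [h, by omega]
  | succ n ih =>
    rw [writes]
    by_cases hx : x = I n
    · rw [hx, Function.update_self]
    · rw [Function.update_of_ne hx]
      apply ih
      rcases h with h | ⟨t, ht, htx⟩
      · exact Or.inl h
      · refine Or.inr ⟨t, ?_, htx⟩
        rcases Nat.lt_succ_iff_lt_or_eq.mp ht with h | rfl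
        · exact h
        · exact absurd htx.symm hx

/-- The elements of a finite set of natural numbers in increasing order. -/
theorem exists_enum (T : Finset ℕ) : ∃ e : ℕ → ℕ, (∀ t < T.card, e t ∈ T) ∧
    (∀ x ∈ T, ∃ t < T.card, e t = x) ∧ ∀ t, t + 1 < T.card → e t < e (t + 1) := by
  refine ⟨fun t => if h : t < T.card then T.orderEmbOfFin rfl ⟨t, h⟩ else 0, ?_, ?_, ?_⟩
  · intro t ht
    simp only [ht, dif_pos]
    exact T.orderEmbOfFin_mem rfl _
  · intro x hx
    have : x ∈ Set.range (T.orderEmbOfFin rfl) := by rw [range_orderEmbOfFin]; exact hx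
    obtain ⟨⟨t, ht⟩, h⟩ := this
    exact ⟨t, ht, by simp only [ht, dif_pos]; exact h⟩
  · intro t ht
    simp only [ht, show t < T.card by omega, dif_pos]
    exact (T.orderEmbOfFin rfl).strictMono (by simp)

theorem exists_patch {m l : ℕ} (hm : 0 < m) {f g : ℕ → ℕ} (hg : ∀ i < m, g i < m)
    (hd : diffs m f g ≤ l) :
    ∃ d : ℕ → ℕ, (∀ i < l + l, d i < m) ∧ ∀ i < m, patch f l d i = g i := by
  rw [diffs] at hd
  set T := (range m).filter fun i => f i ≠ g i with hT
  obtain ⟨e, h1, h2, -⟩ := exists_enum T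
  -- Superfluous entries of the tuple point to position 0, which exists as m > 0, and rewrite it
  -- with its correct value.
  set e' : ℕ → ℕ := fun t => if t < T.card then e t else 0 with he'
  have hlt : ∀ t, e' t < m := by
    intro t
    simp only [he']
    split_ifs with h
    · exact mem_range.mp (mem_filter.mp (h1 t h)).1
    · exact hm
  refine ⟨fun t => if t < l then e' t else g (e' (t - l)), ?_, ?_⟩
  · intro i _
    simp only
    split_ifs
    · exact hlt i
    · exact hg _ (hlt _)
  · intro i hi
    rw [patch, writes_congr (I' := e') (V' := fun t => g (e' t)) (f' := f) ?_ ?_ rfl]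
    · apply writes_comp
      by_cases hfg : f i = g i
      · exact Or.inl hfg
      · obtain ⟨t, ht, h⟩ := h2 i (mem_filter.mpr ⟨mem_range.mpr hi, hfg⟩)
        exact Or.inr ⟨t, by omega, by simp only [he', ht, if_pos]; exact h⟩
    · intro t ht; simp only [ht, if_pos]
    · intro t ht
      simp only [show ¬ l + t < l by omega, if_false, Nat.add_sub_cancel_left]

/-- There are `t` rows and `t` columns without an edge. -/
def HasIndep (m : ℕ) (c : ℕ → ℕ → ℕ) (t : ℕ) : Prop :=
  ∃ X Y : Finset ℕ, X ⊆ range m ∧ Y ⊆ range m ∧ X.card = t ∧ Y.card = t ∧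
    ∀ x ∈ X, ∀ y ∈ Y, c x y = 0

/-- The tuple `d` lists `b + 1` rows and `b + 1` columns without an edge. -/
def IndepTuple (c : ℕ → ℕ → ℕ) (b : ℕ) (d : ℕ → ℕ) : Prop :=
  (∀ i < b + 1, ∀ j < b + 1, c (d i) (d (b + 1 + j)) = 0) ∧ (∀ i < b, d i < d (i + 1)) ∧
    ∀ i < b, d (b + 1 + i) < d (b + 1 + i + 1)

theorem card_image_of_increasing {b : ℕ} {d : ℕ → ℕ} (h : ∀ i < b, d i < d (i + 1)) :
    ((range (b + 1)).image d).card = b + 1 := by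
  have key : ∀ j, j ≤ b → ∀ i < j, d i < d j := by
    intro j
    induction j with
    | zero => intro _ i hi; omega
    | succ j ih =>
      intro hj i hi
      rcases Nat.lt_succ_iff_lt_or_eq.mp hi with h' | rfl
      · exact (ih (by omega) i h').trans (h j (by omega))
      · exact h i (by omega)
  rw [card_image_of_injOn, card_range]
  intro i hi j hj hij
  simp only [coe_range, Set.mem_Iio] at hi hj
  rcases lt_trichotomy i j with h' | h' | h'
  · have := key j (by omega) i h'; omega
  · exact h'
  · have := key i (by omega) j h'; omega

theorem IndepTuple.hasIndep {m : ℕ} {c : ℕ → ℕ → ℕ} {b : ℕ} {d : ℕ → ℕ} (h : IndepTuple c b d)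
    (hd : ∀ i < b + 1 + (b + 1), d i < m) : HasIndep m c (b + 1) := by
  refine ⟨(range (b + 1)).image d, (range (b + 1)).image fun j => d (b + 1 + j), ?_, ?_,
    card_image_of_increasing h.2.1, card_image_of_increasing h.2.2, ?_⟩
  · intro x hx
    obtain ⟨i, hi, rfl⟩ := mem_image.mp hx
    rw [mem_range] at *
    exact hd i (by omega)
  · intro x hx
    obtain ⟨i, hi, rfl⟩ := mem_image.mp hx
    rw [mem_range] at *
    exact hd _ (by omega)
  · intro x hx y hy
    obtain ⟨i, hi, rfl⟩ := mem_image.mp hx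
    obtain ⟨j, hj, rfl⟩ := mem_image.mp hy
    exact h.1 i (mem_range.mp hi) j (mem_range.mp hj)

/-- Larger sets are cut down to b+1 elements and listed in increasing order; monotonicity is how a
tuple certifies that its entries are distinct. -/
theorem noIndep_of_no_tuple {m : ℕ} {c : ℕ → ℕ → ℕ} {b : ℕ}
    (h : ∀ d : ℕ → ℕ, (∀ i < b + 1 + (b + 1), d i < m) → ¬ IndepTuple c b d) : NoIndep m c b := by
  intro X Y hX hY hXb hYb
  by_contra hcon
  push Not at hcon
  obtain ⟨X', hX', hXc⟩ := exists_subset_card_eq (Nat.succ_le_of_lt hXb)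
  obtain ⟨Y', hY', hYc⟩ := exists_subset_card_eq (Nat.succ_le_of_lt hYb)
  obtain ⟨e, e1, -, e3⟩ := exists_enum X'
  obtain ⟨u, u1, -, u3⟩ := exists_enum Y'
  rw [hXc] at e1 e3
  rw [hYc] at u1 u3
  refine h (fun t => if t < b + 1 then e t else u (t - (b + 1))) ?_ ⟨?_, ?_, ?_⟩
  · intro i hi
    split_ifs with hb
    · exact mem_range.mp (hX (hX' (e1 i hb)))
    · exact mem_range.mp (hY (hY' (u1 _ (by omega))))
  · intro i hi j hj
    simp only [hi, if_pos, show ¬ b + 1 + j < b + 1 by omega, if_false, Nat.add_sub_cancel_left]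
    exact hcon _ (hX' (e1 i hi)) _ (hY' (u1 j hj))
  · intro i hi
    simp only [show i < b + 1 by omega, show i + 1 < b + 1 by omega, if_pos]
    exact e3 i (by omega)
  · intro i hi
    simp only [show ¬ b + 1 + i < b + 1 by omega, show ¬ b + 1 + i + 1 < b + 1 by omega, if_false,
      show b + 1 + i + 1 - (b + 1) = i + 1 by omega, show b + 1 + i - (b + 1) = i by omega]
    exact u3 i (by omega)

end ExactMatching

/-! ### Programs which build and test a single candidate. -/

namespace RAM

open Finset ExactMatching

/-- Build the candidate described by the digits in the array 22. -/
def build : Prog :=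
  .seq (storeAll 50 (.var 3) 22 (.var 50) (.get 20 (.var 50)))
    (storeAll 50 (.var 51) 22 (.get 23 (.var 50)) (.get 23 (.add (.var 51) (.var 50))))

/-- The register 52 becomes zero if the array 22 is a perfect matching. -/
def check : Prog :=
  -- The array 24 becomes a table of inverses. When two rows share a column, one entry overwrites
  -- the other, and the first count detects it; the second count detects non-edges.
  .seq (.assign 52 (.lit 0)) (.seq (storeAll 50 (.var 3) 24 (.get 22 (.var 50)) (.var 50))
    (.seq (count 50 52 (.var 3) (neqE (.get 24 (.get 22 (.var 50))) (.var 50)))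
      (count 50 52 (.var 3) (eqE (codeE (.var 50) (.get 22 (.var 50))) (.lit 0)))))

/-- Count the red edges of the array 22 in the register 53. -/
def countRed : Prog :=
  .seq (.assign 53 (.lit 0)) (count 50 53 (.var 3) (eqE (codeE (.var 50) (.get 22 (.var 50))) (.lit 2)))

/-- Count the differences of the arrays 22 and 21, 20 and 21 in the registers 54, 55. -/
def countDiffs : Prog :=
  .seq (.assign 54 (.lit 0)) (.seq (count 50 54 (.var 3) (neqE (.get 22 (.var 50)) (.get 21 (.var 50))))
    (.seq (.assign 55 (.lit 0)) (count 50 55 (.var 3) (neqE (.get 20 (.var 50)) (.get 21 (.var 50))))))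

section

variable {N m k : ℕ} {c : ℕ → ℕ → ℕ} {s : State}

theorem build_spec (hN : 2 ≤ N) (hm : m ≤ N) (hs : s.reg 3 = m) {l d : ℕ} (hl : s.reg 51 = l)
    (hld : l ≤ N ^ d) :
    Ex N build s (d + 13) fun s' => ∀ i < m, s'.arr 22 i = patch (s.arr 20) l (s.arr 23) i := by
  refine Ex.seq (a := 10) (b := d + 10) hN (storeAll_spec (a := 3) (d := 1) (n := m) hN (fun i => i)
    (fun i => s.arr 20 i) (by simp [Expr.cost]) (by simpa using hm) (by omega) ?_ ?_)
    (by omega) (by omega) ?_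
  · intro s' hF; rw [Expr.eval, hF.reg 3 rfl, hs]
  · intro j s' _ hF hj; exact ⟨hj, by simp only [Expr.eval]; rw [hj, hF.arr 20 rfl]⟩
  intro s₁ h1 F1
  have a23 : s₁.arr 23 = s.arr 23 := F1.arr 23 rfl
  have r51 : s₁.reg 51 = l := (F1.reg 51 rfl).trans hl
  refine Ex.mono (a := d + 10) hN (storeAll_spec (a := 4) (d := d) (n := l) hN (fun t => s.arr 23 t)
    (fun t => s.arr 23 (l + t)) (by simp [Expr.cost]) hld (by omega) ?_ ?_) le_rfl ?_
  · intro s' hF; rw [Expr.eval, hF.reg 51 rfl, r51]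
  · intro j s' _ hF hj
    have e1 : s'.arr 23 = s.arr 23 := (hF.arr 23 rfl).trans a23
    have e2 : s'.reg 51 = l := (hF.reg 51 rfl).trans r51
    simp only [Expr.eval, hj, e1, e2, and_self]
  · intro s₂ h2 _ i hi
    rw [h2, patch]
    exact writes_congr (fun _ _ => rfl) (fun _ _ => rfl) (by rw [h1, writes_id hi])

theorem check_spec (hN : 2 ≤ N) (hm : m ≤ N) (hs : Ctx m k c s) (hlt : ∀ i < m, s.arr 22 i < m) :
    Ex N check s 20 fun s' => s'.reg 52 = 0 ↔ IsPM m c (s.arr 22) := by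
  have hm' : m ≤ N ^ 1 := by simpa using hm
  refine Ex.assign_seq (a := 1) (b := 19) hN (by simp [Expr.cost]) (by omega) (by omega) ?_
  set s₁ := s.setReg 52 _ with hs₁
  have c1 : Ctx m k c s₁ := hs.congr rfl rfl fun _ _ => rfl
  have r1 : s₁.reg 52 = 0 := by simp [hs₁, State.setReg, Expr.eval]
  set f := s.arr 22 with hf
  have f1 : s₁.arr 22 = f := rfl
  refine Ex.seq (a := 10) (b := 18) hN (storeAll_spec (a := 3) (d := 1) (n := m) hN f
    (fun i => i) (by simp [Expr.cost]) hm' (by omega) ?_ ?_) (by omega) (by omega) ?_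
  · intro s' hF; rw [Expr.eval, hF.reg 3 rfl, c1.size]
  · intro j s' _ hF hj; exact ⟨by simp only [Expr.eval]; rw [hj, hF.arr 22 rfl, f1], hj⟩
  intro s₂ h2 F2
  have c2 : Ctx m k c s₂ := c1.frame F2 rfl
  have r2 : s₂.reg 52 = 0 := (F2.reg 52 rfl).trans r1
  have f2 : s₂.arr 22 = f := F2.arr 22 rfl
  set u := s₂.arr 24 with hu
  refine Ex.seq (a := 13) (b := 17) hN (count_spec (a := 5) (d := 1) (n := m) hN (fun i => u (f i) ≠ i)
    (by norm_num) (by simp [neqE, Expr.cost]) hm' (by omega) ?_ ?_) (by omega) (by omega) ?_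
  · intro s' hF; rw [Expr.eval, hF.reg 3 rfl, c2.size]
  · intro i s' _ hF hi
    rw [eval_neqE]
    simp only [Expr.eval, hi]
    rw [hF.arr 24 rfl, hF.arr 22 rfl, f2]
  intro s₃ h3 F3
  have c3 : Ctx m k c s₃ := c2.frame F3 rfl
  have f3 : s₃.arr 22 = f := (F3.arr 22 rfl).trans f2
  refine Ex.mono (a := 17) hN (count_spec (a := 6) (d := 1) (n := m) hN (fun i => c i (f i) = 0)
    (by norm_num) (by simp [neqE, eqE, codeE, Expr.cost]) hm' (by omega) ?_ ?_) le_rfl ?_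
  · intro s' hF; rw [Expr.eval, hF.reg 3 rfl, c3.size]
  · intro i s' him hF hi
    have c' : Ctx m k c s' := c3.frame hF rfl
    have f' : s'.arr 22 = f := (hF.arr 22 rfl).trans f3
    rw [eval_eqE, eval_codeE]
    simp only [Expr.eval, hi, f']
    rw [c'.code i him _ (hlt i him)]
  intro s₄ h4 _
  rw [h4, h3, r2, zero_add, Nat.add_eq_zero_iff, card_eq_zero, card_eq_zero, filter_eq_empty_iff,
    filter_eq_empty_iff]
  constructor
  · rintro ⟨g1, g2⟩
    refine ⟨fun i hi => ⟨hlt i hi, g2 (mem_range.mpr hi)⟩, fun i hi j hj hij => ?_⟩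
    have e1 := g1 (mem_range.mpr hi)
    have e2 := g1 (mem_range.mpr hj)
    push Not at e1 e2
    rw [← e1, ← e2, hij]
  · intro h
    refine ⟨fun i hi => ?_, fun i hi => (h.1 i (mem_range.mp hi)).2⟩
    push Not
    rw [h2, writes_of_inj h.2 (mem_range.mp hi)]

theorem countRed_spec (hN : 2 ≤ N) (hm : m ≤ N) (hs : Ctx m k c s) (hlt : ∀ i < m, s.arr 22 i < m) :
    Ex N countRed s 18 fun s' => s'.reg 53 = redCount m c (s.arr 22) := by
  have hm' : m ≤ N ^ 1 := by simpa using hm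
  refine Ex.assign_seq (a := 1) (b := 17) hN (by simp [Expr.cost]) (by omega) (by omega) ?_
  set s₁ := s.setReg 53 _ with hs₁
  have c1 : Ctx m k c s₁ := hs.congr rfl rfl fun _ _ => rfl
  refine Ex.mono (a := 17) hN (count_spec (a := 6) (d := 1) (n := m) hN (fun i => c i (s.arr 22 i) = 2)
    (by norm_num) (by simp [neqE, eqE, codeE, Expr.cost]) hm' (by omega) ?_ ?_) le_rfl ?_
  · intro s' hF; rw [Expr.eval, hF.reg 3 rfl, c1.size]
  · intro i s' him hF hi
    have c' : Ctx m k c s' := c1.frame hF rfl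
    have f' : s'.arr 22 = s.arr 22 := hF.arr 22 rfl
    rw [eval_eqE, eval_codeE]
    simp only [Expr.eval, hi, f']
    rw [c'.code i him _ (hlt i him)]
  · intro s' h _
    rw [h, redCount]
    simp [hs₁, State.setReg, Expr.eval]

theorem countDiffs_spec (hN : 2 ≤ N) (hm : m ≤ N) (hs : s.reg 3 = m) :
    Ex N countDiffs s 20 fun s' => s'.reg 54 = diffs m (s.arr 22) (s.arr 21) ∧
      s'.reg 55 = diffs m (s.arr 20) (s.arr 21) := by
  have hm' : m ≤ N ^ 1 := by simpa using hm
  refine Ex.assign_seq (a := 1) (b := 19) hN (by simp [Expr.cost]) (by omega) (by omega) ?_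
  set s₁ := s.setReg 54 _ with hs₁
  have r1 : s₁.reg 54 = 0 := by simp [hs₁, State.setReg, Expr.eval]
  refine Ex.seq (a := 17) (b := 18) hN (count_spec (a := 5) (d := 1) (n := m) hN
    (fun i => s.arr 22 i ≠ s.arr 21 i)
    (by norm_num) (by simp [neqE, Expr.cost]) hm' (by omega) ?_ ?_) (by omega) (by omega) ?_
  · intro s' hF; rw [Expr.eval, hF.reg 3 rfl, ← hs]; rfl
  · intro i s' _ hF hi
    rw [eval_neqE]
    simp only [Expr.eval, hi]
    rw [hF.arr 22 rfl, hF.arr 21 rfl]; rfl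
  intro s₂ h2 F2
  refine Ex.assign_seq (a := 1) (b := 17) hN (by simp [Expr.cost]) (by omega) (by omega) ?_
  set s₃ := s₂.setReg 55 _ with hs₃
  have r3 : s₃.reg 55 = 0 := by simp [hs₃, State.setReg, Expr.eval]
  have r54 : s₃.reg 54 = s₂.reg 54 := by simp [hs₃, State.setReg]
  have a20 : s₃.arr 20 = s.arr 20 := F2.arr 20 rfl
  have a21 : s₃.arr 21 = s.arr 21 := F2.arr 21 rfl
  refine Ex.mono (a := 17) hN (count_spec (a := 5) (d := 1) (n := m) hN
    (fun i => s.arr 20 i ≠ s.arr 21 i)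
    (by norm_num) (by simp [neqE, Expr.cost]) hm' (by omega) ?_ ?_) le_rfl ?_
  · intro s' hF; rw [Expr.eval, hF.reg 3 rfl, ← hs]
    exact F2.reg 3 rfl
  · intro i s' _ hF hi
    rw [eval_neqE]
    simp only [Expr.eval, hi]
    rw [hF.arr 20 rfl, hF.arr 21 rfl, a20, a21]
  · intro s' h F'
    rw [h, F'.reg 54 rfl, r54, h2, r1, r3, zero_add, zero_add]
    exact ⟨rfl, rfl⟩

/-- Is the candidate a perfect matching closer to the array 21 than the distant array 20? -/
def closerTest : Prog :=
  -- Truncated subtraction expresses x < y as (x+1) - y = 0, so the sum vanishes exactly when all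
  -- three conditions hold.
  .seq build (.seq check (.seq countDiffs (.assign 12 (.sub (.lit 1) (.add (.var 52)
    (.add (.sub (.add (.var 51) (.lit 1)) (.var 55)) (.sub (.add (.var 54) (.lit 1)) (.var 55))))))))

/-- Is the candidate a solution? -/
def solutionTest : Prog :=
  .seq build (.seq check (.seq countRed (.assign 12 (.sub (.lit 1) (.add (.var 52)
    (neqE (.var 53) (.var 1)))))))

theorem closerTest_spec (hN : 2 ≤ N) (hm : m ≤ N) (hs : Ctx m k c s) {l d : ℕ} (hl : s.reg 51 = l)
    (hld : l ≤ N ^ d) (hlo : ∀ i < m, s.arr 20 i < m) (hd : ∀ i < l + l, s.arr 23 i < m) :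
    Ex N closerTest s (d + 25) fun s' =>
      (∀ i < m, s'.arr 22 i = patch (s.arr 20) l (s.arr 23) i) ∧
      (s'.reg 12 ≠ 0 ↔ IsPM m c (patch (s.arr 20) l (s.arr 23)) ∧
        l < diffs m (s.arr 20) (s.arr 21) ∧
        diffs m (patch (s.arr 20) l (s.arr 23)) (s.arr 21) < diffs m (s.arr 20) (s.arr 21)) := by
  have hlt := patch_lt hlo hd
  set f := patch (s.arr 20) l (s.arr 23) with hf
  refine Ex.seq (b := d + 24) hN (build_spec hN hm hs.size hl hld) (by omega) (by omega) ?_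
  intro s₁ h1 F1
  have c1 : Ctx m k c s₁ := hs.frame F1 rfl
  refine Ex.seq (b := d + 23) hN (check_spec hN hm c1 fun i hi => by rw [h1 i hi]; exact hlt i hi)
    (by omega) (by omega) ?_
  intro s₂ h2 F2
  have c2 : Ctx m k c s₂ := c1.frame F2 rfl
  refine Ex.seq (b := d + 22) hN (countDiffs_spec hN hm c2.size) (by omega) (by omega) ?_
  rintro s₃ ⟨h54, h55⟩ F3
  have r51 : s₃.reg 51 = l := by rw [F3.reg 51 rfl, F2.reg 51 rfl, F1.reg 51 rfl, hl]
  have r52 : s₃.reg 52 = 0 ↔ IsPM m c f := by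
    rw [F3.reg 52 rfl, h2]
    exact ⟨fun h => h.congr fun i hi => (h1 i hi).symm, fun h => h.congr h1⟩
  have a22 : s₃.arr 22 = s₁.arr 22 := by rw [F3.arr 22 rfl, F2.arr 22 rfl]
  rw [F2.arr 20 rfl, F2.arr 21 rfl, F1.arr 20 rfl, F1.arr 21 rfl] at h55
  rw [F2.arr 22 rfl, F2.arr 21 rfl, F1.arr 21 rfl,
    diffs_congr (f := f) (g := s.arr 21) h1 (fun _ _ => rfl)] at h54
  refine Ex.assign hN ?_ ⟨fun i hi => ?_, ?_⟩
  · calc _ ≤ 2 ^ 5 := by simp [Expr.cost]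
      _ ≤ _ := Nat.pow_le_pow_right (by norm_num) (by omega)
  · exact (congrFun a22 i).trans (h1 i hi)
  · rw [← r52]
    simp only [State.setReg, Expr.eval, Function.update_self, r51, h54, h55]
    omega

theorem solutionTest_spec (hN : 2 ≤ N) (hm : m ≤ N) (hs : Ctx m k c s) {l d : ℕ} (hl : s.reg 51 = l)
    (hld : l ≤ N ^ d) (hlo : ∀ i < m, s.arr 20 i < m) (hd : ∀ i < l + l, s.arr 23 i < m) :
    Ex N solutionTest s (d + 25) fun s' =>
      (∀ i < m, s'.arr 22 i = patch (s.arr 20) l (s.arr 23) i) ∧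
      (s'.reg 12 ≠ 0 ↔ IsPM m c (patch (s.arr 20) l (s.arr 23)) ∧
        redCount m c (patch (s.arr 20) l (s.arr 23)) = k) := by
  have hlt := patch_lt hlo hd
  set f := patch (s.arr 20) l (s.arr 23) with hf
  refine Ex.seq (b := d + 24) hN (build_spec hN hm hs.size hl hld) (by omega) (by omega) ?_
  intro s₁ h1 F1
  have c1 : Ctx m k c s₁ := hs.frame F1 rfl
  have hlt1 : ∀ i < m, s₁.arr 22 i < m := fun i hi => by rw [h1 i hi]; exact hlt i hi
  refine Ex.seq (b := d + 23) hN (check_spec hN hm c1 hlt1) (by omega) (by omega) ?_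
  intro s₂ h2 F2
  have c2 : Ctx m k c s₂ := c1.frame F2 rfl
  refine Ex.seq (b := d + 22) hN (countRed_spec hN hm c2
    fun i hi => by rw [F2.arr 22 rfl]; exact hlt1 i hi) (by omega) (by omega) ?_
  intro s₃ h53 F3
  have c3 : Ctx m k c s₃ := c2.frame F3 rfl
  have r52 : s₃.reg 52 = 0 ↔ IsPM m c f := by
    rw [F3.reg 52 rfl, h2]
    exact ⟨fun h => h.congr fun i hi => (h1 i hi).symm, fun h => h.congr h1⟩
  have a22 : s₃.arr 22 = s₁.arr 22 := by rw [F3.arr 22 rfl, F2.arr 22 rfl]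
  rw [F2.arr 22 rfl, redCount_congr (f := f) h1] at h53
  refine Ex.assign hN ?_ ⟨fun i hi => ?_, ?_⟩
  · calc _ ≤ 2 ^ 5 := by simp [neqE, Expr.cost]
      _ ≤ _ := Nat.pow_le_pow_right (by norm_num) (by omega)
  · exact (congrFun a22 i).trans (h1 i hi)
  · rw [← r52]
    simp only [neqE, State.setReg, Expr.eval, Function.update_self, h53, c3.target]
    omega

/-- Do the digits list rows and columns without an edge? -/
def indepTest : Prog :=
  .seq (.assign 52 (.lit 0)) (.seq (.for 56 (.var 6) (count 57 52 (.var 6)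
      (codeE (.get 23 (.var 56)) (.get 23 (.add (.var 6) (.var 57))))))
    (.seq (count 57 52 (.var 5)
        (.sub (.add (.get 23 (.var 57)) (.lit 1)) (.get 23 (.add (.var 57) (.lit 1)))))
      (.seq (count 57 52 (.var 5) (.sub (.add (.get 23 (.add (.var 6) (.var 57))) (.lit 1))
          (.get 23 (.add (.add (.var 6) (.var 57)) (.lit 1)))))
        (.assign 12 (.sub (.lit 1) (.var 52))))))

theorem indepTest_spec (hN : 2 ≤ N) (hs : Ctx m k c s) {b d : ℕ} (h5 : s.reg 5 = b)
    (h6 : s.reg 6 = b + 1) (hbd : b + 1 ≤ N ^ d) (hd : ∀ i < b + 1 + (b + 1), s.arr 23 i < m) :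
    Ex N indepTest s (d + d + 40) fun s' => s'.reg 12 ≠ 0 ↔ IndepTuple c b (s.arr 23) := by
  set u := s.arr 23 with hu
  refine Ex.assign_seq (a := 1) (b := d + d + 39) hN (by simp [Expr.cost]) (by omega) (by omega) ?_
  set s₁ := s.setReg 52 _ with hs₁
  have c1 : Ctx m k c s₁ := hs.congr rfl rfl fun _ _ => rfl
  have r1 : s₁.reg 52 = 0 := by simp [hs₁, State.setReg, Expr.eval]
  have r6 : s₁.reg 6 = b + 1 := h6
  have r5 : s₁.reg 5 = b := h5
  have u1 : s₁.arr 23 = u := rfl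
  refine Ex.seq (a := d + d + 30) (b := d + d + 38) hN (Ex.for (a := d + 15) (d := d) (n := b + 1) hN
    (fun i s' => s'.reg 52 = 0 ↔ ∀ i' < i, ∀ j < b + 1, c (u i') (u (b + 1 + j)) = 0)
    rfl ?_ hbd (by omega) ?_ ?_ ?_ ?_) (by omega) (by omega) ?_
  · calc _ ≤ 2 ^ 3 := by simp [Expr.cost]
      _ ≤ _ := Nat.pow_le_pow_right (by norm_num) (by omega)
  · intro s' hF; rw [Expr.eval, hF.reg 6 rfl, r6]
  · intro i s' v h
    simpa [State.setReg] using h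
  · simp [r1]
  · intro i s' hi hF hx hI
    have c' : Ctx m k c s' := c1.frame hF rfl
    have u' : s'.arr 23 = u := (hF.arr 23 rfl).trans u1
    have r6' : s'.reg 6 = b + 1 := (hF.reg 6 rfl).trans r6
    refine Ex.mono (a := d + 15) hN (count_spec (a := 5) (d := d) (n := b + 1) hN
      (fun j => c (u i) (u (b + 1 + j)) ≠ 0) (by norm_num) (by simp [codeE, Expr.cost]) hbd (by omega)
      ?_ ?_) le_rfl ?_
    · intro s'' hF'; rw [Expr.eval, hF'.reg 6 rfl, r6']
    · intro j s'' hj hF' hj'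
      have c'' : Ctx m k c s'' := c'.frame hF' rfl
      rw [eval_codeE]
      simp only [Expr.eval, hj']
      rw [hF'.arr 23 rfl, u', hF'.reg 56 rfl, hx, hF'.reg 6 rfl, r6',
        c''.code _ (hd i (by omega)) _ (hd _ (by omega))]
    · intro s'' h'' _
      rw [h'', Nat.add_eq_zero_iff, hI, card_eq_zero, filter_eq_empty_iff]
      constructor
      · rintro ⟨g1, g2⟩ i' hi' j hj
        rcases Nat.lt_succ_iff_lt_or_eq.mp hi' with h | rfl
        · exact g1 i' h j hj
        · have := g2 (mem_range.mpr hj)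
          push Not at this
          exact this
      · intro g
        refine ⟨fun i' hi' => g i' (by omega), fun j hj => ?_⟩
        push Not
        exact g i (by omega) j (mem_range.mp hj)
  intro s₂ h2 F2
  have u2 : s₂.arr 23 = u := (F2.arr 23 rfl).trans u1
  have r62 : s₂.reg 6 = b + 1 := (F2.reg 6 rfl).trans r6
  have r52 : s₂.reg 5 = b := (F2.reg 5 rfl).trans r5
  have hbd' : b ≤ N ^ d := by omega
  refine Ex.seq (a := d + 15) (b := d + d + 37) hN (count_spec (a := 5) (d := d) (n := b) hN
    (fun i => ¬ u i < u (i + 1)) (by norm_num) (by simp [Expr.cost]) hbd' (by omega)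
    ?_ ?_) (by omega) (by omega) ?_
  · intro s' hF; rw [Expr.eval, hF.reg 5 rfl, r52]
  · intro i s' hi hF hi'
    simp only [Expr.eval, hi']
    rw [hF.arr 23 rfl, u2]
    omega
  intro s₃ h3 F3
  have u3 : s₃.arr 23 = u := (F3.arr 23 rfl).trans u2
  have r63 : s₃.reg 6 = b + 1 := (F3.reg 6 rfl).trans r62
  have r53 : s₃.reg 5 = b := (F3.reg 5 rfl).trans r52
  refine Ex.seq (a := d + 15) (b := d + d + 36) hN (count_spec (a := 5) (d := d) (n := b) hN
    (fun i => ¬ u (b + 1 + i) < u (b + 1 + i + 1)) (by norm_num) (by simp [Expr.cost]) hbd' (by omega)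
    ?_ ?_) (by omega) (by omega) ?_
  · intro s' hF; rw [Expr.eval, hF.reg 5 rfl, r53]
  · intro i s' hi hF hi'
    simp only [Expr.eval, hi']
    rw [hF.arr 23 rfl, u3, hF.reg 6 rfl, r63]
    omega
  intro s₄ h4 F4
  refine Ex.assign hN ?_ ?_
  · calc _ ≤ 2 ^ 5 := by simp [Expr.cost]
      _ ≤ _ := Nat.pow_le_pow_right (by norm_num) (by omega)
  · simp only [State.setReg, Expr.eval, Function.update_self]
    have : 1 - s₄.reg 52 ≠ 0 ↔ s₄.reg 52 = 0 := by omega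
    rw [this, h4, h3, Nat.add_eq_zero_iff, Nat.add_eq_zero_iff, h2, card_eq_zero, card_eq_zero,
      filter_eq_empty_iff, filter_eq_empty_iff, IndepTuple, and_assoc]
    simp only [mem_range, not_not]

end

end RAM

/-! ### Solving the problem for two sides of equal positive size -/

namespace RAM

open Finset ExactMatching

/-- Compute the bipartite independence number `b` in the register 5. -/
def findIndep : Prog :=
  .seq (.assign 5 (.lit 0)) (.seq (.assign 6 (.lit 1)) (.seq (.assign 30 (.lit 2))
    (.seq (.assign 31 (.var 3)) (.seq (search indepTest)
      (.loop (.var 12) (.seq (.assign 5 (.add (.var 5) (.lit 1)))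
        (.seq (.assign 6 (.add (.var 6) (.lit 1)))
          (.seq (.assign 30 (.add (.var 30) (.lit 2))) (search indepTest)))))))))

/-- Move the perfect matchings in the arrays 20 and 21 towards each other. -/
def approach : Prog :=
  .seq (.assign 51 (.add (.var 6) (.var 6))) (.seq (.assign 30 (.add (.var 51) (.var 51)))
    (.seq (search closerTest) (.loop (.var 12) (.seq countRed
      (.seq (.branch (.sub (.var 53) (.var 1)) (storeAll 50 (.var 3) 21 (.var 50) (.get 22 (.var 50)))
          (storeAll 50 (.var 3) 20 (.var 50) (.get 22 (.var 50))))
        (search closerTest))))))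

/-- Search for a solution near the array 20. -/
def searchNear : Prog :=
  .seq (.assign 60 (.lit 1)) (.seq (.for 61 (.var 6) (.for 62 (.lit 40)
      (.assign 60 (.add (.var 60) (.var 60)))))
    (.seq (.assign 51 (.var 60)) (.seq (.assign 30 (.add (.var 51) (.var 51))) (search solutionTest))))

/-- Decide whether there is a solution, and find one in the array 22. -/
def solve : Prog :=
  .seq findIndep (.seq (auction 1 20) (.seq (auction 2 21) (.seq approach searchNear)))

section

variable {N m k : ℕ} {c : ℕ → ℕ → ℕ} {s : State} {b β : ℕ}

theorem lt_pow (hN : 2 ≤ N) (a : ℕ) : a < N ^ a := Nat.lt_pow_self (by omega)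

theorem search_indep_spec (hN : 2 ≤ N) (hm : m ≤ N) (hm1 : 1 ≤ m) (hbβ : b ≤ β) (hs : Ctx m k c s)
    (h5 : s.reg 5 = b) (h6 : s.reg 6 = b + 1) (h30 : s.reg 30 = b + 1 + (b + 1)) (h31 : s.reg 31 = m) :
    Ex N (search indepTest) s (5 * β + 73) fun s' =>
      (s'.reg 12 ≠ 0 ∧ HasIndep m c (b + 1)) ∨ (s'.reg 12 = 0 ∧ NoIndep m c b) := by
  have hb1 : b + 1 ≤ N ^ β := (Nat.succ_le_succ hbβ).trans (lt_pow hN β)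
  have hlen : b + 1 + (b + 1) ≤ N ^ (β + 1) := by rw [pow_succ]; nlinarith
  have hpow : m ^ (b + 1 + (b + 1)) ≤ N ^ (2 * β + 2) :=
    (Nat.pow_le_pow_left hm _).trans (Nat.pow_le_pow_right (by omega) (by omega))
  refine Ex.mono hN (search_spec (a := β + β + 40) (d := 2 * β + 2) (d' := β + 1) (B := m) hN
    (fun s' => Ctx m k c s' ∧ s'.reg 5 = b ∧ s'.reg 6 = b + 1 ∧ s'.reg 30 = b + 1 + (b + 1) ∧
      s'.reg 31 = m) (IndepTuple c b) (fun _ => HasIndep m c (b + 1)) hlen hm1 hpow rfl rfl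
    (fun s' h => ⟨h.2.2.2.1, h.2.2.2.2⟩) ?_ ?_ ?_ ⟨hs, h5, h6, h30, h31⟩) (by omega) ?_
  · rintro s' s'' ⟨g1, g2, g3, g4, g5⟩ hr ha
    refine ⟨g1.congr (hr 3 (by norm_num) (by norm_num) (by norm_num))
      (hr 1 (by norm_num) (by norm_num) (by norm_num)) ?_, ?_⟩
    · rintro a (rfl | rfl | rfl | rfl) <;> exact ha _ (by norm_num)
    · rw [hr 5 (by norm_num) (by norm_num) (by norm_num), hr 6 (by norm_num) (by norm_num) (by norm_num),
        hr 30 (by norm_num) (by norm_num) (by norm_num), hr 31 (by norm_num) (by norm_num) (by norm_num)]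
      exact ⟨g2, g3, g4, g5⟩
  · rintro u v huv ⟨g1, g2, g3⟩
    refine ⟨fun i hi j hj => ?_, fun i hi => ?_, fun i hi => ?_⟩
    · rw [← huv i (by omega), ← huv _ (by omega)]; exact g1 i hi j hj
    · rw [← huv i (by omega), ← huv _ (by omega)]; exact g2 i hi
    · rw [← huv _ (by omega), ← huv _ (by omega)]; exact g3 i hi
  · rintro s' ⟨g1, g2, g3, g4, g5⟩ hd
    refine Ex.mono hN (indepTest_spec hN g1 g2 g3 hb1 hd) le_rfl ?_
    intro s'' h F
    refine ⟨⟨g1.frame F rfl, (F.reg 5 rfl).trans g2, (F.reg 6 rfl).trans g3, (F.reg 30 rfl).trans g4,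
      (F.reg 31 rfl).trans g5⟩, fun h0 ht => h.mpr ht h0, fun h0 => (h.mp h0).hasIndep hd⟩
  · rintro s' ⟨-, h | h⟩ _
    · exact Or.inl h
    · exact Or.inr ⟨h.1, noIndep_of_no_tuple h.2⟩

/-- Each successful search exhibits b+1 rows and b+1 columns without an edge, hence b+1 ≤ β. The
loop therefore stops with b ≤ β, and its failed last search certifies `NoIndep m c b`. -/
theorem findIndep_spec (hN : 2 ≤ N) (hm : m ≤ N) (hm1 : 1 ≤ m) (hs : Ctx m k c s)
    (hβ : ∀ t, HasIndep m c t → t ≤ β) :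
    Ex N findIndep s (6 * β + 90) fun s' => s'.reg 31 = m ∧
      ∃ b ≤ β, s'.reg 6 = b + 1 ∧ NoIndep m c b := by
  refine Ex.assign_seq (a := 1) (b := 6 * β + 89) hN (by simp [Expr.cost]) (by omega) (by omega) ?_
  refine Ex.assign_seq (a := 1) (b := 6 * β + 88) hN (by simp [Expr.cost]) (by omega) (by omega) ?_
  refine Ex.assign_seq (a := 1) (b := 6 * β + 87) hN (by simp [Expr.cost]) (by omega) (by omega) ?_
  refine Ex.assign_seq (a := 1) (b := 6 * β + 86) hN (by simp [Expr.cost]) (by omega) (by omega) ?_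
  set s₁ := (((s.setReg 5 _).setReg 6 _).setReg 30 _).setReg 31 _ with hs₁
  have c1 : Ctx m k c s₁ := hs.congr rfl rfl fun _ _ => rfl
  have q5 : s₁.reg 5 = 0 := by simp [hs₁, State.setReg, Expr.eval]
  have q6 : s₁.reg 6 = 0 + 1 := by simp [hs₁, State.setReg, Expr.eval]
  have q30 : s₁.reg 30 = 0 + 1 + (0 + 1) := by simp [hs₁, State.setReg, Expr.eval]
  have q31 : s₁.reg 31 = m := by simp [hs₁, State.setReg, Expr.eval, hs.size]
  refine Ex.seq (b := 6 * β + 85) hN (search_indep_spec hN hm hm1 (Nat.zero_le β) c1 q5 q6 q30 q31)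
    (by omega) (by omega) ?_
  intro s₂ h2 F2
  refine Ex.mono hN (Ex.loop (a := 5 * β + 77) (d := β) (e := 6 * β + 85) hN
    (fun s' => ∃ b ≤ β, Ctx m k c s' ∧ s'.reg 5 = b ∧ s'.reg 6 = b + 1 ∧
      s'.reg 30 = b + 1 + (b + 1) ∧ s'.reg 31 = m ∧
      ((s'.reg 12 ≠ 0 ∧ HasIndep m c (b + 1)) ∨ (s'.reg 12 = 0 ∧ NoIndep m c b)))
    (fun s' => β - s'.reg 5) ?_ ?_ ?_ (by omega) ?_) le_rfl ?_
  · calc _ ≤ 2 ^ 1 := by simp [Expr.cost]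
      _ ≤ _ := Nat.pow_le_pow_right (by norm_num) (by omega)
  · exact ⟨0, Nat.zero_le _, c1.frame F2 rfl, (F2.reg 5 rfl).trans q5, (F2.reg 6 rfl).trans q6,
      (F2.reg 30 rfl).trans q30, (F2.reg 31 rfl).trans q31, h2⟩
  · exact (Nat.sub_le _ _).trans (lt_pow hN β).le
  · rintro s₃ - ⟨b, hb, c3, r5, r6, r30, r31, h3⟩ hne
    simp only [Expr.eval] at hne
    have hb1 := hβ _ (h3.resolve_right fun h => hne h.1).2
    refine Ex.assign_seq (a := 2) (b := 5 * β + 76) hN (by simp [Expr.cost]) (by omega) (by omega) ?_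
    refine Ex.assign_seq (a := 2) (b := 5 * β + 75) hN (by simp [Expr.cost]) (by omega) (by omega) ?_
    refine Ex.assign_seq (a := 2) (b := 5 * β + 74) hN (by simp [Expr.cost]) (by omega) (by omega) ?_
    set s₄ := ((s₃.setReg 5 _).setReg 6 _).setReg 30 _ with hs₄
    have c4 : Ctx m k c s₄ := c3.congr rfl rfl fun _ _ => rfl
    have t5 : s₄.reg 5 = b + 1 := by simp [hs₄, State.setReg, Expr.eval, r5]
    have t6 : s₄.reg 6 = b + 1 + 1 := by simp [hs₄, State.setReg, Expr.eval, r6]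
    have t30 : s₄.reg 30 = b + 1 + 1 + (b + 1 + 1) := by simp [hs₄, State.setReg, Expr.eval, r30]; omega
    have t31 : s₄.reg 31 = m := by simp [hs₄, State.setReg, r31]
    refine Ex.mono hN (search_indep_spec hN hm hm1 hb1 c4 t5 t6 t30 t31) (by omega) ?_
    intro s' h' F'
    refine ⟨⟨b + 1, hb1, c4.frame F' rfl, (F'.reg 5 rfl).trans t5, (F'.reg 6 rfl).trans t6,
      (F'.reg 30 rfl).trans t30, (F'.reg 31 rfl).trans t31, h'⟩, ?_⟩
    rw [F'.reg 5 rfl, t5, r5]; omega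
  · rintro s' ⟨⟨b, hb, _, _, r6, _, r31, h'⟩, h0⟩ _
    exact ⟨r31, b, hb, r6, (h'.resolve_left fun h => h.1 h0).2⟩

theorem search_closer_spec (hN : 2 ≤ N) (hm : m ≤ N) (hm1 : 1 ≤ m) (hbβ : b ≤ β) (hs : Ctx m k c s)
    (hb : NoIndep m c b) (h51 : s.reg 51 = 2 * b + 2) (h30 : s.reg 30 = 2 * b + 2 + (2 * b + 2))
    (h31 : s.reg 31 = m) (hlo : ∀ i < m, s.arr 20 i < m) :
    Ex N (search closerTest) s (6 * β + 70) fun s' =>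
      (s'.reg 12 ≠ 0 ∧ IsPM m c (s'.arr 22) ∧ 2 * b + 2 < diffs m (s.arr 20) (s.arr 21) ∧
        diffs m (s'.arr 22) (s.arr 21) < diffs m (s.arr 20) (s.arr 21) ∧
        diffs m (s.arr 20) (s'.arr 22) ≤ 2 * b + 2) ∨
      (s'.reg 12 = 0 ∧ (IsPM m c (s.arr 20) → IsPM m c (s.arr 21) →
        diffs m (s.arr 20) (s.arr 21) ≤ 2 * b + 2)) := by
  have hb1 : b + 1 ≤ N ^ β := (Nat.succ_le_succ hbβ).trans (lt_pow hN β)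
  have hl : 2 * b + 2 ≤ N ^ (β + 1) := by rw [pow_succ]; nlinarith
  have hlen : 2 * b + 2 + (2 * b + 2) ≤ N ^ (β + 2) := by rw [pow_succ]; nlinarith
  have hpow : m ^ (2 * b + 2 + (2 * b + 2)) ≤ N ^ (4 * β + 4) :=
    (Nat.pow_le_pow_left hm _).trans (Nat.pow_le_pow_right (by omega) (by omega))
  set lo := s.arr 20 with hlo'
  set hi := s.arr 21 with hhi'
  refine Ex.mono hN (search_spec (a := β + 1 + 25) (d := 4 * β + 4) (d' := β + 2) (B := m) hN
    (fun s' => Ctx m k c s' ∧ s'.reg 51 = 2 * b + 2 ∧ s'.reg 30 = 2 * b + 2 + (2 * b + 2) ∧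
      s'.reg 31 = m ∧ s'.arr 20 = lo ∧ s'.arr 21 = hi)
    (fun d => IsPM m c (patch lo (2 * b + 2) d) ∧ 2 * b + 2 < diffs m lo hi ∧
      diffs m (patch lo (2 * b + 2) d) hi < diffs m lo hi)
    (fun s' => IsPM m c (s'.arr 22) ∧ 2 * b + 2 < diffs m lo hi ∧
        diffs m (s'.arr 22) hi < diffs m lo hi ∧ diffs m lo (s'.arr 22) ≤ 2 * b + 2)
    hlen hm1 hpow rfl rfl
    (fun s' h => ⟨h.2.2.1, h.2.2.2.1⟩) ?_ ?_ ?_ ⟨hs, h51, h30, h31, rfl, rfl⟩) (by omega) ?_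
  · rintro s' s'' ⟨g1, g2, g3, g4, g5, g6⟩ hr ha
    refine ⟨g1.congr (hr 3 (by norm_num) (by norm_num) (by norm_num))
      (hr 1 (by norm_num) (by norm_num) (by norm_num)) ?_, ?_⟩
    · rintro a (rfl | rfl | rfl | rfl) <;> exact ha _ (by norm_num)
    · rw [hr 51 (by norm_num) (by norm_num) (by norm_num), hr 30 (by norm_num) (by norm_num) (by norm_num),
        hr 31 (by norm_num) (by norm_num) (by norm_num), ha 20 (by norm_num), ha 21 (by norm_num)]
      exact ⟨g2, g3, g4, g5, g6⟩
  · intro u v huv h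
    rwa [patch_congr huv] at h
  · rintro s' ⟨g1, g2, g3, g4, g5, g6⟩ hd
    refine Ex.mono hN (closerTest_spec hN hm g1 g2 hl (by rw [g5]; exact hlo) hd) le_rfl ?_
    rintro s'' ⟨h22, h⟩ F
    rw [g5, g6] at h
    rw [g5] at h22
    refine ⟨⟨g1.frame F rfl, (F.reg 51 rfl).trans g2, (F.reg 30 rfl).trans g3, (F.reg 31 rfl).trans g4,
      (F.arr 20 rfl).trans g5, (F.arr 21 rfl).trans g6⟩, fun h0 ht => h.mpr ht h0, fun h0 => ?_⟩
    obtain ⟨t1, t2, t3⟩ := h.mp h0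
    refine ⟨t1.congr h22, t2, ?_, ?_⟩
    · rwa [diffs_congr h22 fun _ _ => rfl]
    · rw [diffs_congr (fun _ _ => rfl) h22]; exact diffs_patch _ _ _ _
  · rintro s' ⟨-, h | h⟩ _
    · exact Or.inl h
    · refine Or.inr ⟨h.1, fun p1 p2 => ?_⟩
      by_contra hcon
      push Not at hcon
      obtain ⟨g, q1, q2, q3⟩ := exists_closer_pm hb p1 p2 hcon
      obtain ⟨d, d1, d2⟩ := exists_patch hm1 (fun i hi => (q1.1 i hi).1) q2
      refine h.2 d d1 ⟨q1.congr d2, hcon, ?_⟩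
      rwa [diffs_congr d2 fun _ _ => rfl]

/-- The state of the two perfect matchings in the arrays 20 and 21. -/
structure Bracket (m k b : ℕ) (c : ℕ → ℕ → ℕ) (s : State) : Prop extends Ctx m k c s where
  base : s.reg 31 = m
  width : s.reg 6 = b + 1
  low_lt : ∀ i < m, s.arr 20 i < m
  good : (∃ h, IsPM m c h ∧ redCount m c h = k) → IsPM m c (s.arr 20) ∧ IsPM m c (s.arr 21) ∧
    redCount m c (s.arr 20) ≤ k ∧ k ≤ redCount m c (s.arr 21)

theorem Bracket.congr {s' : State} (h : Bracket m k b c s) (hr : ∀ x, x = 1 ∨ x = 3 ∨ x = 6 ∨ x = 31 →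
    s'.reg x = s.reg x) (ha : ∀ a, a = 1 ∨ a = 3 ∨ a = 4 ∨ a = 5 ∨ a = 20 ∨ a = 21 → s'.arr a = s.arr a) :
    Bracket m k b c s' where
  toCtx := h.toCtx.congr (hr 3 (by simp)) (hr 1 (by simp)) fun a ha' => ha a (by tauto)
  base := (hr 31 (by simp)).trans h.base
  width := (hr 6 (by simp)).trans h.width
  low_lt := by rw [ha 20 (by simp)]; exact h.low_lt
  good := by rw [ha 20 (by simp), ha 21 (by simp)]; exact h.good

theorem Bracket.frame {s' : State} {p : Prog} (h : Bracket m k b c s) (hF : Frame p s s')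
    (hp : (p.wr 3 || p.wr 1 || p.wr 6 || p.wr 31 || p.wa 1 || p.wa 3 || p.wa 4 || p.wa 5 || p.wa 20 ||
      p.wa 21) = false) : Bracket m k b c s' := by
  simp only [Bool.or_eq_false_iff] at hp
  refine h.congr ?_ ?_
  · rintro a (rfl | rfl | rfl | rfl) <;> exact hF.reg _ (by tauto)
  · rintro a (rfl | rfl | rfl | rfl | rfl | rfl) <;> exact hF.arr _ (by tauto)

/-- A candidate with more than k red edges replaces the upper matching, leaving a distance of at
most 2b+2, which is below the old one. Any other candidate replaces the lower matching and is nearer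
to the upper one by choice. The distance starts at most m, so there are at most m rounds. -/
theorem approach_spec (hN : 2 ≤ N) (hm : m ≤ N) (hm1 : 1 ≤ m) (hbβ : b ≤ β) (hs : Bracket m k b c s)
    (hb : NoIndep m c b) :
    Ex N approach s (6 * β + 90) fun s' => Bracket m k b c s' ∧
      ((∃ h, IsPM m c h ∧ redCount m c h = k) → diffs m (s'.arr 20) (s'.arr 21) ≤ 2 * b + 2) := by
  have hm' : m ≤ N ^ 1 := by simpa using hm
  refine Ex.assign_seq (a := 2) (b := 6 * β + 89) hN (by simp [Expr.cost]) (by omega) (by omega) ?_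
  refine Ex.assign_seq (a := 2) (b := 6 * β + 88) hN (by simp [Expr.cost]) (by omega) (by omega) ?_
  set s₁ := (s.setReg 51 _).setReg 30 _ with hs₁
  have b1 : Bracket m k b c s₁ := hs.congr
    (by rintro x (rfl | rfl | rfl | rfl) <;> rfl) fun _ _ => rfl
  have q51 : s₁.reg 51 = 2 * b + 2 := by
    simp [hs₁, State.setReg, Expr.eval, hs.width]; omega
  have q30 : s₁.reg 30 = 2 * b + 2 + (2 * b + 2) := by
    simp [hs₁, State.setReg, Expr.eval, hs.width]; omega
  refine Ex.seq (b := 6 * β + 87) hN (search_closer_spec hN hm hm1 hbβ b1.toCtx hb q51 q30 b1.base b1.low_lt)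
    (by omega) (by omega) ?_
  intro s₂ h2 F2
  have a20 : s₂.arr 20 = s₁.arr 20 := F2.arr 20 rfl
  have a21 : s₂.arr 21 = s₁.arr 21 := F2.arr 21 rfl
  rw [← a20, ← a21] at h2
  refine Ex.mono hN (Ex.loop (a := 6 * β + 73) (d := 1) (e := 6 * β + 87) hN
    (fun s' => Bracket m k b c s' ∧ s'.reg 51 = 2 * b + 2 ∧ s'.reg 30 = 2 * b + 2 + (2 * b + 2) ∧
      ((s'.reg 12 ≠ 0 ∧ IsPM m c (s'.arr 22) ∧ 2 * b + 2 < diffs m (s'.arr 20) (s'.arr 21) ∧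
        diffs m (s'.arr 22) (s'.arr 21) < diffs m (s'.arr 20) (s'.arr 21) ∧
        diffs m (s'.arr 20) (s'.arr 22) ≤ 2 * b + 2) ∨
      (s'.reg 12 = 0 ∧ (IsPM m c (s'.arr 20) → IsPM m c (s'.arr 21) →
        diffs m (s'.arr 20) (s'.arr 21) ≤ 2 * b + 2))))
    (fun s' => diffs m (s'.arr 20) (s'.arr 21)) ?_ ⟨b1.frame F2 rfl, (F2.reg 51 rfl).trans q51,
      (F2.reg 30 rfl).trans q30, h2⟩ ((diffs_le _ _ _).trans hm') (by omega) ?_) le_rfl ?_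
  · calc _ ≤ 2 ^ 1 := by simp [Expr.cost]
      _ ≤ _ := Nat.pow_le_pow_right (by norm_num) (by omega)
  · rintro s₃ - ⟨b3, r51, r30, h3⟩ hne
    simp only [Expr.eval] at hne
    obtain ⟨-, p1, p2, p3, p4⟩ := h3.resolve_right fun h => hne h.1
    refine Ex.seq (a := 18) (b := 6 * β + 72) hN (countRed_spec hN hm b3.toCtx fun i hi => (p1.1 i hi).1)
      (by omega) (by omega) ?_
    intro s₄ h53 F4
    have b4 : Bracket m k b c s₄ := b3.frame F4 rfl
    have e20 : s₄.arr 20 = s₃.arr 20 := F4.arr 20 rfl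
    have e21 : s₄.arr 21 = s₃.arr 21 := F4.arr 21 rfl
    have e22 : s₄.arr 22 = s₃.arr 22 := F4.arr 22 rfl
    -- replace one of the two matchings
    refine Ex.seq (a := 12) (b := 6 * β + 71)
      (Q := fun s' => Bracket m k b c s' ∧ diffs m (s'.arr 20) (s'.arr 21) <
        diffs m (s₃.arr 20) (s₃.arr 21)) hN ?_ (by omega) (by omega) ?_
    · refine Ex.branch (a := 2) (b := 11) hN (by simp [Expr.cost]) (by omega) (by omega) ?_ ?_
      · intro hk
        simp only [Expr.eval, h53, b4.target] at hk
        refine Ex.mono (a := 10) hN (storeAll_spec (a := 3) (d := 1) (n := m) hN (fun i => i)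
          (fun i => s₃.arr 22 i) (by simp [Expr.cost]) hm' (by omega) ?_ ?_) (by omega) ?_
        · intro s' hF; rw [Expr.eval, hF.reg 3 rfl, b4.size]
        · intro j s' _ hF hj; exact ⟨hj, by simp only [Expr.eval]; rw [hj, hF.arr 22 rfl, e22]⟩
        · intro s' h' F'
          have hv : ∀ i < m, s'.arr 21 i = s₃.arr 22 i := fun i hi => by rw [h', writes_id hi]
          have e20' : s'.arr 20 = s₃.arr 20 := (F'.arr 20 rfl).trans e20
          refine ⟨⟨b4.toCtx.frame F' rfl, (F'.reg 31 rfl).trans b4.base, (F'.reg 6 rfl).trans b4.width,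
            by rw [e20']; exact b3.low_lt, fun hex => ?_⟩, ?_⟩
          · obtain ⟨g1, g2, g3, g4⟩ := b3.good hex
            rw [e20', redCount_congr hv]
            exact ⟨g1, p1.congr hv, g3, by omega⟩
          · rw [e20', diffs_congr (fun _ _ => rfl) hv]; omega
      · intro hk
        simp only [Expr.eval, h53, b4.target] at hk
        refine Ex.mono (a := 10) hN (storeAll_spec (a := 3) (d := 1) (n := m) hN (fun i => i)
          (fun i => s₃.arr 22 i) (by simp [Expr.cost]) hm' (by omega) ?_ ?_) (by omega) ?_
        · intro s' hF; rw [Expr.eval, hF.reg 3 rfl, b4.size]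
        · intro j s' _ hF hj; exact ⟨hj, by simp only [Expr.eval]; rw [hj, hF.arr 22 rfl, e22]⟩
        · intro s' h' F'
          have hv : ∀ i < m, s'.arr 20 i = s₃.arr 22 i := fun i hi => by rw [h', writes_id hi]
          have e21' : s'.arr 21 = s₃.arr 21 := (F'.arr 21 rfl).trans e21
          refine ⟨⟨b4.toCtx.frame F' rfl, (F'.reg 31 rfl).trans b4.base, (F'.reg 6 rfl).trans b4.width,
            fun i hi => by rw [hv i hi]; exact (p1.1 i hi).1, fun hex => ?_⟩, ?_⟩
          · obtain ⟨g1, g2, g3, g4⟩ := b3.good hex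
            rw [e21', redCount_congr hv]
            exact ⟨p1.congr hv, g2, by omega, g4⟩
          · rw [e21', diffs_congr hv (fun _ _ => rfl)]; omega
    · rintro s₅ ⟨b5, d5⟩ F5
      have r51' : s₅.reg 51 = 2 * b + 2 := ((F5.reg 51 rfl).trans (F4.reg 51 rfl)).trans r51
      have r30' : s₅.reg 30 = 2 * b + 2 + (2 * b + 2) :=
        ((F5.reg 30 rfl).trans (F4.reg 30 rfl)).trans r30
      refine Ex.mono hN (search_closer_spec hN hm hm1 hbβ b5.toCtx hb r51' r30' b5.base b5.low_lt)
        (by omega) ?_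
      intro s' h' F'
      have a20 : s'.arr 20 = s₅.arr 20 := F'.arr 20 rfl
      have a21 : s'.arr 21 = s₅.arr 21 := F'.arr 21 rfl
      rw [a20, a21]
      exact ⟨⟨b5.frame F' rfl, (F'.reg 51 rfl).trans r51', (F'.reg 30 rfl).trans r30', h'⟩, d5⟩
  · rintro s' ⟨⟨b', _, _, h'⟩, h0⟩ _
    refine ⟨b', fun hex => ?_⟩
    obtain ⟨g1, g2, -, -⟩ := b'.good hex
    exact (h'.resolve_left fun h => h.1 h0).2 g1 g2

/-- By `exists_near_pm` and `nearBound_le`, a solvable instance has a solution which is a patch of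
the lower matching with l = 2^(40(b+1)) entries; l is computed by repeated doubling. The m^(2l)
tuples account for the dominant exponent. -/
theorem searchNear_spec (hN : 2 ≤ N) (hm : m ≤ N) (hm1 : 1 ≤ m) (hbβ : b ≤ β) (hs : Bracket m k b c s)
    (hb : NoIndep m c b)
    (hnear : (∃ h, IsPM m c h ∧ redCount m c h = k) → diffs m (s.arr 20) (s.arr 21) ≤ 2 * b + 2) :
    Ex N searchNear s (2 * 2 ^ (40 * (β + 1)) + 80 * β + 200) fun s' =>
      (s'.reg 12 ≠ 0 ∧ IsPM m c (s'.arr 22) ∧ redCount m c (s'.arr 22) = k) ∨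
      (s'.reg 12 = 0 ∧ ¬ ∃ h, IsPM m c h ∧ redCount m c h = k) := by
  set E := 2 ^ (40 * (β + 1)) with hE
  set l := 2 ^ (40 * (b + 1)) with hl
  have hlE : l ≤ E := Nat.pow_le_pow_right (by norm_num) (by omega)
  have hlN : l ≤ N ^ (40 * β + 40) :=
    hlE.trans (by rw [hE]; exact (Nat.pow_le_pow_left hN _).trans (le_of_eq (by ring_nf)))
  have hlen : l + l ≤ N ^ (40 * β + 41) := by rw [pow_succ]; nlinarith
  have hpow : m ^ (l + l) ≤ N ^ (2 * E) :=
    (Nat.pow_le_pow_left hm _).trans (Nat.pow_le_pow_right (by omega) (by omega))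
  have hb1 : b + 1 ≤ N ^ β := (Nat.succ_le_succ hbβ).trans (lt_pow hN β)
  refine Ex.assign_seq (a := 1) (b := 2 * E + 80 * β + 199) hN (by simp [Expr.cost]) (by omega) (by omega) ?_
  set s₁ := s.setReg 60 _ with hs₁
  have b1 : Bracket m k b c s₁ := hs.congr
    (by rintro x (rfl | rfl | rfl | rfl) <;> rfl) fun _ _ => rfl
  refine Ex.seq (a := β + 30) (b := 2 * E + 80 * β + 198) (Q := fun s' => s'.reg 60 = l) hN
    (Ex.mono (a := β + 30) hN (Ex.for (a := 20) (d := β) (n := b + 1) hN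
      (fun i s' => s'.reg 60 = 2 ^ (40 * i))
      rfl (by simp [Expr.cost]) hb1 (by omega) ?_ ?_ ?_ ?_) le_rfl fun s' h _ => h)
      (by omega) (by omega) ?_
  · intro s' hF; rw [Expr.eval, hF.reg 6 rfl, b1.width]
  · intro i s' v h
    simpa [State.setReg] using h
  · simp [hs₁, State.setReg, Expr.eval]
  · intro i s' hi hF hx hI
    refine Ex.mono (a := 20) hN (Ex.for (a := 3) (d := 6) (n := 40) hN
      (fun j s' => s'.reg 60 = 2 ^ (40 * i + j))
      rfl (by simp [Expr.cost]) ?_ (by omega) (fun _ _ => rfl) ?_ (by simpa using hI) ?_) le_rfl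
      (fun s' h _ => by rw [h]; ring_nf)
    · exact const_le_pow hN (by norm_num)
    · intro i s' v h
      simpa [State.setReg] using h
    · intro j s'' _ _ _ h
      refine Ex.assign hN (by simp [Expr.cost]) ?_
      simp only [State.setReg, Expr.eval, Function.update_self, h]
      rw [← add_assoc, pow_succ]; ring
  intro s₂ r60 F2
  have b2 : Bracket m k b c s₂ := b1.frame F2 rfl
  refine Ex.assign_seq (a := 1) (b := 2 * E + 80 * β + 197) hN (by simp [Expr.cost]) (by omega) (by omega) ?_
  refine Ex.assign_seq (a := 2) (b := 2 * E + 80 * β + 196) hN (by simp [Expr.cost]) (by omega) (by omega) ?_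
  set s₃ := (s₂.setReg 51 _).setReg 30 _ with hs₃
  have b3 : Bracket m k b c s₃ := b2.congr
    (by rintro x (rfl | rfl | rfl | rfl) <;> rfl) fun _ _ => rfl
  have q51 : s₃.reg 51 = l := by simp [hs₃, State.setReg, Expr.eval, r60]
  have q30 : s₃.reg 30 = l + l := by simp [hs₃, State.setReg, Expr.eval, r60]
  set lo := s.arr 20 with hlo
  set hi := s.arr 21 with hhi
  have a20 : s₃.arr 20 = lo := F2.arr 20 rfl
  refine Ex.mono hN (search_spec (a := 40 * β + 40 + 25) (d := 2 * E) (d' := 40 * β + 41) (B := m) hN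
    (fun s' => Bracket m k b c s' ∧ s'.reg 51 = l ∧ s'.reg 30 = l + l ∧ s'.arr 20 = lo)
    (fun d => IsPM m c (patch lo l d) ∧ redCount m c (patch lo l d) = k)
    (fun s' => IsPM m c (s'.arr 22) ∧ redCount m c (s'.arr 22) = k)
    hlen hm1 hpow rfl rfl
    (fun s' h => ⟨h.2.2.1, h.1.base⟩) ?_ ?_ ?_ ⟨b3, q51, q30, a20⟩) (by omega) ?_
  · rintro s' s'' ⟨g1, g2, g3, g4⟩ hr ha
    refine ⟨g1.congr ?_ ?_, ?_⟩
    · rintro a (rfl | rfl | rfl | rfl) <;> exact hr _ (by norm_num) (by norm_num) (by norm_num)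
    · rintro a (rfl | rfl | rfl | rfl | rfl | rfl) <;> exact ha _ (by norm_num)
    · rw [hr 51 (by norm_num) (by norm_num) (by norm_num), hr 30 (by norm_num) (by norm_num) (by norm_num),
        ha 20 (by norm_num)]
      exact ⟨g2, g3, g4⟩
  · intro u v huv h
    rwa [patch_congr huv] at h
  · rintro s' ⟨g1, g2, g3, g4⟩ hd
    refine Ex.mono hN (solutionTest_spec hN hm g1.toCtx g2 hlN g1.low_lt hd) le_rfl ?_
    rintro s'' ⟨h22, h⟩ F
    rw [g4] at h h22
    refine ⟨⟨g1.frame F rfl, (F.reg 51 rfl).trans g2, (F.reg 30 rfl).trans g3,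
      (F.arr 20 rfl).trans g4⟩, fun h0 ht => h.mpr ht h0, fun h0 => ?_⟩
    obtain ⟨t1, t2⟩ := h.mp h0
    exact ⟨t1.congr h22, by rwa [redCount_congr h22]⟩
  · rintro s' ⟨-, h | h⟩ _
    · exact Or.inl h
    · refine Or.inr ⟨h.1, fun hex => ?_⟩
      obtain ⟨g1, g2, g3, g4⟩ := hs.good hex
      obtain ⟨u, u1, u2⟩ := hex
      obtain ⟨v, v1, v2, v3⟩ := exists_near_pm hb g1 g2 u1 (hnear ⟨u, u1, u2⟩) g3 g4 u2
      obtain ⟨d, d1, d2⟩ := exists_patch hm1 (fun i hi => (v1.1 i hi).1) (v3.trans (nearBound_le b))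
      exact h.2 d d1 ⟨v1.congr d2, by rwa [redCount_congr d2]⟩

/-- The auction rewarding blue edges minimizes and the one rewarding red edges maximizes the red
count. If a solution exists, both return perfect matchings, and k lies between their counts. -/
theorem solve_spec (hN : 2 ≤ N) (hm : m ≤ N) (hm1 : 1 ≤ m) (hs : Ctx m k c s)
    (hc : ∀ i < m, ∀ j < m, c i j ≤ 2) (hβ : ∀ t, HasIndep m c t → t ≤ β) :
    Ex N solve s (2 * 2 ^ (40 * (β + 1)) + 100 * β + 300) fun s' =>
      (s'.reg 12 ≠ 0 ∧ IsPM m c (s'.arr 22) ∧ redCount m c (s'.arr 22) = k) ∨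
      (s'.reg 12 = 0 ∧ ¬ ∃ h, IsPM m c h ∧ redCount m c h = k) := by
  set E := 2 ^ (40 * (β + 1)) with hE
  refine Ex.seq (b := 2 * E + 100 * β + 299) hN (findIndep_spec hN hm hm1 hs hβ) (by omega) (by omega) ?_
  rintro s₁ ⟨r31, b, hb, r6, hno⟩ F1
  have c1 : Ctx m k c s₁ := hs.frame F1 rfl
  refine Ex.seq (b := 2 * E + 100 * β + 298) hN (auction_spec hN hm c1 one_ne_zero le_rfl) (by omega) (by omega) ?_
  rintro s₂ ⟨lt2, h2⟩ F2
  have c2 : Ctx m k c s₂ := c1.frame F2 rfl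
  refine Ex.seq (b := 2 * E + 100 * β + 297) hN (auction_spec hN hm c2 two_ne_zero (by norm_num))
    (by omega) (by omega) ?_
  rintro s₃ ⟨lt3, h3⟩ F3
  have c3 : Ctx m k c s₃ := c2.frame F3 rfl
  have a20 : s₃.arr 20 = s₂.arr 20 := F3.arr 20 rfl
  have b3 : Bracket m k b c s₃ := by
    refine ⟨c3, ?_, ?_, by rw [a20]; exact lt2, ?_⟩
    · rw [F3.reg 31 rfl, F2.reg 31 rfl, r31]
    · rw [F3.reg 6 rfl, F2.reg 6 rfl, r6]
    · rintro ⟨g, g1, g2⟩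
      obtain ⟨p1, p2⟩ := h2 g g1
      obtain ⟨q1, q2⟩ := h3 g g1
      rw [a20]
      have e1 := redCount_add_blue hc g1
      have e2 := redCount_add_blue hc p1
      refine ⟨p1, q1, by omega, ?_⟩
      rw [← g2]; exact q2
  refine Ex.seq (b := 2 * E + 100 * β + 296) hN (approach_spec hN hm hm1 hb b3 hno) (by omega) (by omega) ?_
  rintro s₄ ⟨b4, h4⟩ F4
  exact Ex.mono hN (searchNear_spec hN hm hm1 hb b4 hno h4) (by omega) fun s' h _ => h

end

end RAM

/-! ### Instances and their coloured matrices -/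

namespace BipartiteEM

open Finset ExactMatching

/-- The values of `f` below `r` are, without repetition, the elements of `S` below `i`. -/
structure Lists {n : ℕ} (S : Set (Fin n)) (i r : ℕ) (f : ℕ → ℕ) : Prop where
  inj : Set.InjOn f (Set.Iio r)
  mem : ∀ u, (∃ j < r, f j = u) ↔ u < i ∧ ∃ h : u < n, (⟨u, h⟩ : Fin n) ∈ S

theorem Lists.zero {n : ℕ} (S : Set (Fin n)) (f : ℕ → ℕ) : Lists S 0 0 f :=
  ⟨fun x hx => absurd hx (by simp), fun u => by simp⟩

theorem Lists.skip {n : ℕ} {S : Set (Fin n)} {i r : ℕ} {f : ℕ → ℕ} (h : Lists S i r f) (hi : i < n)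
    (hS : (⟨i, hi⟩ : Fin n) ∉ S) : Lists S (i + 1) r f := by
  refine ⟨h.inj, fun u => ?_⟩
  rw [h.mem]
  constructor
  · rintro ⟨h1, h2⟩; exact ⟨by omega, h2⟩
  · rintro ⟨h1, h2, h3⟩
    refine ⟨?_, h2, h3⟩
    rcases Nat.lt_succ_iff_lt_or_eq.mp h1 with h4 | rfl
    · exact h4
    · exact absurd h3 hS

theorem Lists.snoc {n : ℕ} {S : Set (Fin n)} {i r : ℕ} {f : ℕ → ℕ} (h : Lists S i r f) (hi : i < n)
    (hS : (⟨i, hi⟩ : Fin n) ∈ S) : Lists S (i + 1) (r + 1) (Function.update f r i) := by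
  have hlt : ∀ j < r, f j < i := fun j hj => ((h.mem _).mp ⟨j, hj, rfl⟩).1
  have hup : ∀ j < r, Function.update f r i j = f j := fun j hj =>
    Function.update_of_ne (by omega) _ _
  constructor
  · intro x hx y hy hxy
    simp only [Set.mem_Iio] at hx hy
    rcases Nat.lt_succ_iff_lt_or_eq.mp hx with h1 | rfl <;>
      rcases Nat.lt_succ_iff_lt_or_eq.mp hy with h2 | rfl
    · rw [hup x h1, hup y h2] at hxy
      exact h.inj h1 h2 hxy
    · rw [hup x h1, Function.update_self] at hxy
      have := hlt x h1; omega
    · rw [hup y h2, Function.update_self] at hxy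
      have := hlt y h2; omega
    · rfl
  · intro u
    constructor
    · rintro ⟨j, hj, rfl⟩
      rcases Nat.lt_succ_iff_lt_or_eq.mp hj with h1 | rfl
      · rw [hup j h1]
        obtain ⟨h2, h3⟩ := (h.mem _).mp ⟨j, h1, rfl⟩
        exact ⟨by omega, h3⟩
      · rw [Function.update_self]
        exact ⟨by omega, hi, hS⟩
    · rintro ⟨h1, h2⟩
      rcases Nat.lt_succ_iff_lt_or_eq.mp h1 with h3 | rfl
      · obtain ⟨j, h4, h5⟩ := (h.mem _).mpr ⟨h3, h2⟩
        exact ⟨j, by omega, by rw [hup j h4, h5]⟩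
      · exact ⟨r, by omega, Function.update_self _ _ _⟩

/-- `α` enumerates `S` without repetition by the numbers below `r`. -/
structure Enum {n : ℕ} (S : Set (Fin n)) (r : ℕ) (α : ℕ → Fin n) : Prop where
  inj : Set.InjOn α (Set.Iio r)
  mem : ∀ u, u ∈ S ↔ ∃ j < r, α j = u

theorem Lists.exists_enum {n r : ℕ} {S : Set (Fin n)} {f : ℕ → ℕ} (hn : 0 < n) (h : Lists S n r f) :
    ∃ α, Enum S r α ∧ ∀ j < r, f j = α j := by
  have hlt : ∀ j < r, f j < n := fun j hj => ((h.mem _).mp ⟨j, hj, rfl⟩).1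
  -- The remainder only supplies an element of `Fin n` for indices beyond r; below r it changes
  -- nothing.
  refine ⟨fun j => ⟨f j % n, Nat.mod_lt _ hn⟩, ⟨?_, fun u => ?_⟩, fun j hj =>
    (Nat.mod_eq_of_lt (hlt j hj)).symm⟩
  · intro x hx y hy hxy
    simp only [Fin.mk.injEq] at hxy
    rw [Nat.mod_eq_of_lt (hlt x hx), Nat.mod_eq_of_lt (hlt y hy)] at hxy
    exact h.inj hx hy hxy
  · have h1 := h.mem u
    simp only [Fin.is_lt, true_and, Fin.eta, exists_const] at h1
    rw [← h1]
    refine exists_congr fun j => and_congr_right fun hj => ?_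
    rw [Fin.ext_iff]
    simp only
    rw [Nat.mod_eq_of_lt (hlt j hj)]

theorem Enum.ncard {n r : ℕ} {S : Set (Fin n)} {α : ℕ → Fin n} (h : Enum S r α) : S.ncard = r := by
  have : S = α '' Set.Iio r := by
    ext u; rw [h.mem]; rfl
  rw [this, h.inj.ncard_image, ← coe_Iio, Set.ncard_coe_finset, Nat.card_Iio]

variable {I : BipartiteEM} {m : ℕ} {α β : ℕ → Fin I.n} {f : ℕ → ℕ}

theorem code_le (u v : Fin I.n) : I.code u v ≤ 2 := by
  unfold code; split_ifs <;> omega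

theorem code_ne_zero {u v : Fin I.n} : I.code u v ≠ 0 ↔ I.G.Adj u v := by
  unfold code; split_ifs <;> simp_all

theorem code_eq_two {u v : Fin I.n} : I.code u v = 2 ↔ I.G.Adj u v ∧ s(u, v) ∈ I.red := by
  unfold code; split_ifs <;> simp_all

theorem input_matrix (u v : Fin I.n) : I.input.arr 1 (u * I.n + v) = I.code u v := by
  have h : (u : ℕ) * I.n + v < I.n * I.n := by
    have := u.2; have := v.2; nlinarith
  have hn : 0 < I.n := u.pos
  simp only [input, one_ne_zero, if_false, if_true, dif_pos h]
  congr 1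
  · ext; simp [Fin.divNat, Nat.add_comm (_ * _), Nat.add_mul_div_right _ _ hn, Nat.div_eq_of_lt v.2]
  · ext; simp [Fin.modNat, Nat.add_comm (_ * _), Nat.mod_eq_of_lt v.2]

theorem mem_A_iff_of_adj {u v : Fin I.n} (h : I.G.Adj u v) : u ∈ I.A ↔ v ∉ I.A := by
  rcases I.bipartite.mem_of_adj h with ⟨h1, h2⟩ | ⟨h1, h2⟩
  · exact ⟨fun _ => h2, fun _ => h1⟩
  · exact ⟨fun h => absurd h h1, fun h => absurd h2 h⟩

/-- Edge-free rows and columns form an independent set, as vertices of the same side are never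
adjacent. The supremum defining `beta` is over a set bounded by n, so it really is an upper bound.
-/
theorem le_beta (hα : Enum I.A m α) (hβ : Enum I.Aᶜ m β) {t : ℕ}
    (ht : HasIndep m (fun i j => I.code (α i) (β j)) t) : t ≤ I.beta := by
  obtain ⟨X, Y, hX, hY, cX, cY, hXY⟩ := ht
  have mX : ∀ x ∈ X, x < m := fun x hx => mem_range.mp (hX hx)
  have mY : ∀ x ∈ Y, x < m := fun x hx => mem_range.mp (hY hx)
  have aX : ∀ x ∈ X, α x ∈ I.A := fun x hx => (hα.mem _).mpr ⟨x, mX x hx, rfl⟩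
  have aY : ∀ x ∈ Y, β x ∉ I.A := fun x hx => (hβ.mem _).mpr ⟨x, mY x hx, rfl⟩
  have hna : ∀ x ∈ X, ∀ y ∈ Y, ¬ I.G.Adj (α x) (β y) := fun x hx y hy h =>
    code_ne_zero.mpr h (hXY x hx y hy)
  refine le_csSup ⟨I.n, ?_⟩ ⟨α '' X ∪ β '' Y, ?_, ?_, ?_⟩
  · rintro b ⟨S, -, rfl, -⟩
    simpa using Set.ncard_le_card (S ∩ I.A)
  · rintro _ (⟨x, hx, rfl⟩ | ⟨x, hx, rfl⟩) _ (⟨y, hy, rfl⟩ | ⟨y, hy, rfl⟩) _ h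
    · exact (mem_A_iff_of_adj h).mp (aX x hx) (aX y hy)
    · exact hna x hx y hy h
    · exact hna y hy x hx h.symm
    · exact aY x hx ((mem_A_iff_of_adj h).mpr (aY y hy))
  · have : (α '' (X : Set ℕ) ∪ β '' Y) ∩ I.A = α '' X := by
      ext u; constructor
      · rintro ⟨h | ⟨x, hx, rfl⟩, h2⟩
        · exact h
        · exact absurd h2 (aY x hx)
      · rintro ⟨x, hx, rfl⟩; exact ⟨Or.inl ⟨x, hx, rfl⟩, aX x hx⟩
    rw [this, (hα.inj.mono fun x hx => mX x hx).ncard_image, Set.ncard_coe_finset, cX]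
  · have : (α '' (X : Set ℕ) ∪ β '' Y) ∩ I.Aᶜ = β '' Y := by
      ext u; constructor
      · rintro ⟨⟨x, hx, rfl⟩ | h, h2⟩
        · exact absurd (aX x hx) h2
        · exact h
      · rintro ⟨x, hx, rfl⟩; exact ⟨Or.inr ⟨x, hx, rfl⟩, aY x hx⟩
    rw [this, (hβ.inj.mono fun x hx => mY x hx).ncard_image, Set.ncard_coe_finset, cY]

/-- Each matching edge has exactly one end in A, so the edges are indexed by the rows without
repetition. -/
theorem ncard_red_eq (hα : Enum I.A m α) {M : I.G.Subgraph} (hM : M.IsPerfectMatching)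
    (h : ∀ i < m, M.Adj (α i) (β (f i))) :
    (M.edgeSet ∩ I.red).ncard = redCount m (fun i j => I.code (α i) (β j)) f := by
  have hA : ∀ i < m, α i ∈ I.A := fun i hi => (hα.mem _).mpr ⟨i, hi, rfl⟩
  have huniq : ∀ {u v w}, M.Adj u v → M.Adj u w → v = w := fun h1 h2 =>
    (hM.1 (M.edge_vert h1)).unique h1 h2
  have himg : M.edgeSet ∩ I.red = (fun i => s(α i, β (f i))) ''
      (((range m).filter fun i => I.code (α i) (β (f i)) = 2 : Finset ℕ) : Set ℕ) := by
    ext e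
    constructor
    · induction e using Sym2.ind with
      | _ u v =>
        rintro ⟨h1, h2⟩
        rw [SimpleGraph.Subgraph.mem_edgeSet] at h1
        wlog hu : u ∈ I.A generalizing u v
        · rw [Sym2.eq_swap]
          refine this v u h1.symm (by rwa [Sym2.eq_swap]) ?_
          by_contra hv
          exact hu ((mem_A_iff_of_adj h1.adj_sub).mpr hv)
        obtain ⟨i, hi, rfl⟩ := (hα.mem _).mp hu
        obtain rfl := huniq h1 (h i hi)
        refine ⟨i, ?_, rfl⟩
        simp only [coe_filter, mem_range, Set.mem_ofPred_eq]
        exact ⟨hi, code_eq_two.mpr ⟨h1.adj_sub, h2⟩⟩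
    · rintro ⟨i, hi, rfl⟩
      simp only [coe_filter, mem_range, Set.mem_ofPred_eq] at hi
      exact ⟨h i hi.1, (code_eq_two.mp hi.2).2⟩
  rw [himg, Set.InjOn.ncard_image, Set.ncard_coe_finset]
  · rfl
  · intro x hx y hy hxy
    simp only [coe_filter, mem_range, Set.mem_ofPred_eq] at hx hy
    rcases Sym2.eq_iff.mp hxy with ⟨h1, -⟩ | ⟨h1, -⟩
    · exact hα.inj hx.1 hy.1 h1
    · exact absurd (h1 ▸ hA x hx.1) ((mem_A_iff_of_adj (h y hy.1).adj_sub).mp (hA y hy.1))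

theorem exists_isPM (hα : Enum I.A m α) (hβ : Enum I.Aᶜ m β) {M : I.G.Subgraph} (hM : I.IsSolution M) :
    ∃ f, IsPM m (fun i j => I.code (α i) (β j)) f ∧
      redCount m (fun i j => I.code (α i) (β j)) f = I.k := by
  have h1 : ∀ i, ∃ j, i < m → j < m ∧ M.Adj (α i) (β j) := by
    intro i
    by_cases hi : i < m
    · obtain ⟨w, hw, -⟩ := hM.1.1 (hM.1.2 (α i))
      obtain ⟨j, hj, rfl⟩ := (hβ.mem w).mp
        ((mem_A_iff_of_adj hw.adj_sub).mp ((hα.mem _).mpr ⟨i, hi, rfl⟩))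
      exact ⟨j, fun _ => ⟨hj, hw⟩⟩
    · exact ⟨0, fun h => absurd h hi⟩
  choose f hf using h1
  refine ⟨f, ⟨fun i hi => ⟨(hf i hi).1, code_ne_zero.mpr (hf i hi).2.adj_sub⟩, ?_⟩, ?_⟩
  · intro x hx y hy hxy
    have e1 := (hf x hx).2.symm
    have e2 := (hf y hy).2.symm
    rw [← hxy] at e2
    exact hα.inj hx hy ((hM.1.1 (M.edge_vert e1)).unique e1 e2)
  · rw [← ncard_red_eq hα hM.1 fun i hi => (hf i hi).2]
    exact hM.2

/-- The partner map is injective and exchanges the two sides. -/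
theorem ncard_eq_of_isSolution {M : I.G.Subgraph} (hM : I.IsSolution M) :
    I.A.ncard = I.Aᶜ.ncard := by
  have h1 : ∀ u, ∃ v, M.Adj u v := fun u => (hM.1.1 (hM.1.2 u)).exists
  choose σ hσ using h1
  have hinj : Function.Injective σ := by
    intro u v huv
    have e1 := (hσ u).symm
    have e2 := (hσ v).symm
    rw [← huv] at e2
    exact (hM.1.1 (M.edge_vert e1)).unique e1 e2
  refine le_antisymm (Set.ncard_le_ncard_of_injOn σ (fun u hu => ?_) hinj.injOn)
    (Set.ncard_le_ncard_of_injOn σ (fun u hu => ?_) hinj.injOn)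
  · exact (mem_A_iff_of_adj (hσ u).adj_sub).mp hu
  · by_contra hv
    exact hu ((mem_A_iff_of_adj (hσ u).adj_sub).mpr hv)

/-- Since f is onto the columns, the pairs α i, β (f i) exhaust all vertices. A map that swaps the
members of each pair is an involution along edges, and its graph is the matching. -/
theorem exists_isSolution (hα : Enum I.A m α) (hβ : Enum I.Aᶜ m β)
    (hf : IsPM m (fun i j => I.code (α i) (β j)) f)
    (hk : redCount m (fun i j => I.code (α i) (β j)) f = I.k) {P : ℕ → ℕ}
    (h1 : ∀ i < m, P (α i) = β (f i)) (h2 : ∀ i < m, P (β (f i)) = α i) :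
    ∃ M : I.G.Subgraph, I.IsSolution M ∧ ∀ u v : Fin I.n, M.Adj u v ↔ P u = v := by
  have hsurj : ∀ j < m, ∃ i < m, f i = j := by
    have hmaps : Set.MapsTo f (range m) (range m) := fun i hi =>
      mem_coe.mpr (mem_range.mpr (hf.1 i (mem_range.mp hi)).1)
    have := surjOn_of_injOn_of_card_le f hmaps
      (hf.2.mono fun x hx => by simpa using hx) le_rfl
    intro j hj
    obtain ⟨i, hi, rfl⟩ := this (by simpa using hj)
    exact ⟨i, by simpa using hi, rfl⟩
  have hcase : ∀ u, ∃ i < m, u = α i ∨ u = β (f i) := by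
    intro u
    by_cases hu : u ∈ I.A
    · obtain ⟨i, hi, rfl⟩ := (hα.mem u).mp hu
      exact ⟨i, hi, Or.inl rfl⟩
    · obtain ⟨j, hj, rfl⟩ := (hβ.mem u).mp hu
      obtain ⟨i, hi, rfl⟩ := hsurj j hj
      exact ⟨i, hi, Or.inr rfl⟩
  have hadj : ∀ i < m, I.G.Adj (α i) (β (f i)) := fun i hi => code_ne_zero.mp (hf.1 i hi).2
  have hsymm : ∀ u v : Fin I.n, P u = v → P v = u := by
    intro u v huv
    obtain ⟨i, hi, rfl | rfl⟩ := hcase u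
    · rw [← huv, h1 i hi, h2 i hi]
    · rw [← huv, h2 i hi, h1 i hi]
  have hsub : ∀ u v : Fin I.n, P u = v → I.G.Adj u v := by
    intro u v huv
    obtain ⟨i, hi, rfl | rfl⟩ := hcase u
    · rw [h1 i hi] at huv
      rw [← Fin.ext huv]; exact hadj i hi
    · rw [h2 i hi] at huv
      rw [← Fin.ext huv]; exact (hadj i hi).symm
  let M : I.G.Subgraph :=
    { verts := Set.univ
      Adj := fun u v => P u = v
      adj_sub := fun {u v} h => hsub u v h
      edge_vert := fun _ => trivial
      symm := ⟨fun u v h => hsymm u v h⟩ }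
  have hM : M.IsPerfectMatching := by
    refine ⟨fun u _ => ?_, fun _ => trivial⟩
    obtain ⟨i, hi, rfl | rfl⟩ := hcase u
    · exact ⟨β (f i), h1 i hi, fun v hv => Fin.ext (Eq.trans (Eq.symm hv) (h1 i hi))⟩
    · exact ⟨α i, h2 i hi, fun v hv => Fin.ext (Eq.trans (Eq.symm hv) (h2 i hi))⟩
  exact ⟨M, ⟨hM, by rw [ncard_red_eq (f := f) hα hM fun i hi => h1 i hi, hk]⟩, fun u v => Iff.rfl⟩

/-- The empty graph is treated separately because the searches need a positive base m; its only
perfect matching is empty. -/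
theorem isAnswer_of_isEmpty (hn : I.n = 0) {s : RAM.State}
    (hs : (I.k = 0 ∧ s.reg 2 = 1) ∨ (I.k ≠ 0 ∧ s.reg 2 = 0)) : I.IsAnswer s := by
  have : IsEmpty (Fin I.n) := by rw [hn]; infer_instance
  have h0 : ∀ M : I.G.Subgraph, (M.edgeSet ∩ I.red).ncard = 0 := fun M => by
    rw [Set.eq_empty_of_isEmpty (M.edgeSet ∩ I.red), Set.ncard_empty]
  rcases hs with ⟨h1, h2⟩ | ⟨h1, h2⟩
  · exact Or.inl ⟨h2, ⊤, ⟨⟨fun u => isEmptyElim u, fun u => isEmptyElim u⟩, by rw [h0, h1]⟩,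
      fun u => isEmptyElim u⟩
  · exact Or.inr ⟨h2, fun ⟨M, hM⟩ => h1 (hM.2.symm.trans (h0 M))⟩

end BipartiteEM

/-! ### The complete program -/

namespace RAM

open Finset ExactMatching BipartiteEM

/-- Store the beginning `u * n` of the row of every vertex `u` in the array 3. -/
def rowStarts : Prog :=
  .for 71 (.var 0) (.seq (.store 3 (.var 71) (.var 70)) (.assign 70 (.add (.var 70) (.var 0))))

/-- List the vertices of the two sides in the arrays 4 and 5, count them in the registers 3 and 4. -/
def splitSides : Prog :=
  .for 71 (.var 0) (.branch (.get 0 (.var 71))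
    (.seq (.store 4 (.var 3) (.var 71)) (.assign 3 (.add (.var 3) (.lit 1))))
    (.seq (.store 5 (.var 4) (.var 71)) (.assign 4 (.add (.var 4) (.lit 1)))))

/-- Translate the solution in the array 22 to a map from vertices to partners. -/
def output : Prog :=
  .seq (storeAll 71 (.var 3) 2 (.get 4 (.var 71)) (.get 5 (.get 22 (.var 71))))
    (.seq (storeAll 71 (.var 3) 2 (.get 5 (.get 22 (.var 71))) (.get 4 (.var 71)))
      (.assign 2 (.lit 1)))

/-- Solve an instance of Exact Matching on a bipartite graph. -/
def exactMatching : Prog :=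
  .branch (.var 0)
    (.seq rowStarts (.seq splitSides
      (.branch (neqE (.var 3) (.var 4)) .nop
        (.seq solve (.branch (.var 12) output .nop)))))
    (.branch (.var 1) .nop (.assign 2 (.lit 1)))

section

variable {N : ℕ} {I : BipartiteEM} {s : State}

theorem rowStarts_spec (hN : 2 ≤ N) (hn : s.reg 0 ≤ N) (h70 : s.reg 70 = 0) :
    Ex N rowStarts s 12 fun s' => ∀ u < s.reg 0, s'.arr 3 u = u * s.reg 0 := by
  refine Ex.mono hN (Ex.for (a := 4) (d := 1) (n := s.reg 0) hN
    (fun i s' => s'.reg 70 = i * s.reg 0 ∧ ∀ u < i, s'.arr 3 u = u * s.reg 0)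
    rfl (by simp [Expr.cost]) (by simpa using hn) le_rfl (fun s' hF => hF.reg 0 rfl) ?_
    (by simp [h70]) ?_) (by omega) fun s' h _ => h.2
  · intro i s' v h
    simpa [State.setReg] using h
  · rintro i s' hi hF hx ⟨h1, h2⟩
    refine Ex.store_seq (a := 3) (b := 3) hN (by simp [Expr.cost]) (by omega) (by omega) ?_
    refine Ex.assign hN (by simp [Expr.cost]) ?_
    have h0 : s'.reg 0 = s.reg 0 := hF.reg 0 rfl
    constructor
    · simp [State.setReg, State.setArr, Expr.eval, h1, h0]; ring
    · intro u hu
      simp only [State.setReg, State.setArr, Expr.eval, Function.update_self, hx, h1]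
      rcases Nat.lt_succ_iff_lt_or_eq.mp hu with h | rfl
      · rw [Function.update_of_ne (by omega), h2 u h]
      · rw [Function.update_self]

theorem splitSides_spec (hN : 2 ≤ N) (hn : I.n ≤ N) (h0 : s.reg 0 = I.n) (h3 : s.reg 3 = 0)
    (h4 : s.reg 4 = 0) (ha : s.arr 0 = I.input.arr 0) :
    Ex N splitSides s 13 fun s' => Lists I.A I.n (s'.reg 3) (s'.arr 4) ∧
      Lists I.Aᶜ I.n (s'.reg 4) (s'.arr 5) := by
  refine Ex.for (a := 5) (d := 1) (n := I.n) hN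
    (fun i s' => Lists I.A i (s'.reg 3) (s'.arr 4) ∧ Lists I.Aᶜ i (s'.reg 4) (s'.arr 5))
    rfl (by simp [Expr.cost]) (by simpa using hn) (by omega)
    (fun s' hF => (hF.reg 0 rfl).trans h0) ?_ ?_ ?_
  · intro i s' v h
    simpa [State.setReg] using h
  · rw [h3, h4]; exact ⟨Lists.zero _ _, Lists.zero _ _⟩
  · rintro i s' hi hF hx ⟨hA, hB⟩
    have hv : s'.arr 0 i ≠ 0 ↔ (⟨i, hi⟩ : Fin I.n) ∈ I.A := by
      rw [hF.arr 0 rfl, ha]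
      simp [input, hi]
    refine Ex.branch hN (a := 2) (b := 4) (by simp [Expr.cost]) (by omega) (by omega) ?_ ?_
    · intro h
      simp only [Expr.eval, hx] at h
      refine Ex.store_seq (a := 3) (b := 3) hN (by simp [Expr.cost]) (by omega) (by omega) ?_
      refine Ex.assign hN (by simp [Expr.cost]) ?_
      simpa [State.setReg, State.setArr, Expr.eval, hx] using
        And.intro (hA.snoc hi (hv.mp h)) (hB.skip hi fun h' => h' (hv.mp h))
    · intro h
      simp only [Expr.eval, hx] at h
      have hno : (⟨i, hi⟩ : Fin I.n) ∉ I.A := fun h' => hv.mpr h' h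
      refine Ex.store_seq (a := 3) (b := 3) hN (by simp [Expr.cost]) (by omega) (by omega) ?_
      refine Ex.assign hN (by simp [Expr.cost]) ?_
      simpa [State.setReg, State.setArr, Expr.eval, hx] using
        And.intro (hA.skip hi hno) (hB.snoc hi hno)

/-- The two passes write to disjoint sets of cells, so the second does not destroy the entries of
the first. -/
theorem output_spec (hN : 2 ≤ N) {m : ℕ} (hm : m ≤ N) (h3 : s.reg 3 = m)
    (ha : Set.InjOn (s.arr 4) (Set.Iio m))
    (hb : Set.InjOn (fun i => s.arr 5 (s.arr 22 i)) (Set.Iio m))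
    (hab : ∀ i < m, ∀ j < m, s.arr 4 i ≠ s.arr 5 (s.arr 22 j)) :
    Ex N output s 16 fun s' => s'.reg 2 = 1 ∧
      (∀ i < m, s'.arr 2 (s.arr 4 i) = s.arr 5 (s.arr 22 i)) ∧
      ∀ i < m, s'.arr 2 (s.arr 5 (s.arr 22 i)) = s.arr 4 i := by
  refine Ex.seq (b := 15) hN (storeAll_spec (a := 4) (d := 1) (n := m) hN (s.arr 4)
    (fun i => s.arr 5 (s.arr 22 i)) (by simp [Expr.cost]) (by simpa using hm) le_rfl
    (fun s' hF => (hF.reg 3 rfl).trans h3) ?_) (by omega) (by omega) ?_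
  · intro j s' _ hF hx
    simp only [Expr.eval, hx]
    rw [hF.arr 4 rfl, hF.arr 5 rfl, hF.arr 22 rfl]
    exact ⟨rfl, rfl⟩
  intro s₁ e1 F1
  refine Ex.seq (b := 14) hN (storeAll_spec (a := 4) (d := 1) (n := m) hN
    (fun i => s.arr 5 (s.arr 22 i)) (s.arr 4) (by simp [Expr.cost]) (by simpa using hm) le_rfl
    (fun s' hF => (hF.reg 3 rfl).trans ((F1.reg 3 rfl).trans h3)) ?_) (by omega) (by omega) ?_
  · intro j s' _ hF hx
    simp only [Expr.eval, hx]
    rw [hF.arr 4 rfl, hF.arr 5 rfl, hF.arr 22 rfl, F1.arr 4 rfl, F1.arr 5 rfl, F1.arr 22 rfl]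
    exact ⟨rfl, rfl⟩
  intro s₂ e2 F2
  refine Ex.assign hN (by simp [Expr.cost]) ⟨by simp [State.setReg, Expr.eval], ?_, ?_⟩
  · intro i hi
    change s₂.arr 2 _ = _
    rw [e2, writes_of_ne fun j hj => hab i hi j hj, e1, writes_of_inj ha hi]
  · intro i hi
    change s₂.arr 2 _ = _
    rw [e2]
    exact writes_of_inj hb hi

theorem exactMatching_spec (I : BipartiteEM) :
    Ex (max I.n 2) exactMatching I.input (2 * 2 ^ (40 * (I.beta + 1)) + 100 * I.beta + 310)
      I.IsAnswer := by
  set N := max I.n 2 with hNdef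
  have hN : 2 ≤ N := le_max_right _ _
  have hn : I.n ≤ N := le_max_left _ _
  set E := 2 ^ (40 * (I.beta + 1)) with hE
  have i0 : I.input.reg 0 = I.n := rfl
  have i1 : I.input.reg 1 = I.k := rfl
  refine Ex.branch hN (a := 1) (b := 2 * E + 100 * I.beta + 309) (by simp [Expr.cost]) (by omega)
    (by omega) ?_ ?_
  · intro hpos
    simp only [Expr.eval, i0] at hpos
    refine Ex.seq (b := 2 * E + 100 * I.beta + 308) hN
      (rowStarts_spec hN (by rw [i0]; exact hn) rfl) (by omega) (by omega) ?_
    intro s₁ r1 F1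
    rw [i0] at r1
    refine Ex.seq (b := 2 * E + 100 * I.beta + 307) hN
      (splitSides_spec hN hn (F1.reg 0 rfl) (F1.reg 3 rfl) (F1.reg 4 rfl) (F1.arr 0 rfl))
      (by omega) (by omega) ?_
    rintro s₂ ⟨lA, lB⟩ F2
    obtain ⟨α, hα, eα⟩ := lA.exists_enum (Nat.pos_of_ne_zero hpos)
    obtain ⟨β, hβ, eβ⟩ := lB.exists_enum (Nat.pos_of_ne_zero hpos)
    refine Ex.branch hN (a := 4) (b := 2 * E + 100 * I.beta + 306) (by simp [neqE, Expr.cost])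
      (by omega) (by omega) ?_ ?_
    · intro hne
      -- With sides of different sizes there is no perfect matching, and the register 2, still zero,
      -- already gives that answer.
      refine Ex.nop hN (Or.inr ⟨?_, ?_⟩)
      · rw [F2.reg 2 rfl, F1.reg 2 rfl]; rfl
      · rintro ⟨M, hM⟩
        have := ncard_eq_of_isSolution hM
        rw [hα.ncard, hβ.ncard] at this
        exact ((eval_neqE _ _ _).mp hne) this
    · intro heq
      have heq : s₂.reg 3 = s₂.reg 4 := by
        by_contra h; exact (eval_neqE s₂ (.var 3) (.var 4)).mpr h heq
      rw [← heq] at hβ lB eβ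
      generalize hm : s₂.reg 3 = m at *
      have hm1 : 1 ≤ m := by
        by_cases h : (⟨0, Nat.pos_of_ne_zero hpos⟩ : Fin I.n) ∈ I.A
        · obtain ⟨j, hj, -⟩ := (hα.mem _).mp h; omega
        · obtain ⟨j, hj, -⟩ := (hβ.mem _).mp h; omega
      have hmN : m ≤ N := by
        rw [← hα.ncard]
        exact (by simpa using Set.ncard_le_card I.A : I.A.ncard ≤ I.n).trans hn
      have ctx : Ctx m I.k (fun i j => I.code (α i) (β j)) s₂ := by
        refine ⟨hm, (F2.reg 1 rfl).trans (F1.reg 1 rfl), fun i hi j hj => ?_⟩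
        rw [colour, F2.arr 1 rfl, F1.arr 1 rfl, F2.arr 3 rfl, eα i hi, eβ j hj, r1 _ (α i).2]
        exact input_matrix _ _
      refine Ex.seq (b := 2 * E + 100 * I.beta + 305) hN
        (solve_spec hN hmN hm1 ctx (fun i _ j _ => code_le _ _) fun t ht => le_beta hα hβ ht)
        (by omega) (by omega) ?_
      intro s₃ h3 F3
      have h2 : s₃.reg 2 = 0 := by
        rw [F3.reg 2 rfl, F2.reg 2 rfl, F1.reg 2 rfl]; rfl
      refine Ex.branch hN (a := 1) (b := 2 * E + 100 * I.beta + 304) (by simp [Expr.cost])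
        (by omega) (by omega) ?_ ?_
      · intro h12
        rcases h3 with ⟨-, g1, g2⟩ | ⟨g1, -⟩
        swap
        · exact absurd g1 h12
        have e4 : ∀ i < m, s₃.arr 4 i = α i := fun i hi => by rw [F3.arr 4 rfl, eα i hi]
        have e5 : ∀ i < m, s₃.arr 5 (s₃.arr 22 i) = β (s₃.arr 22 i) := fun i hi => by
          rw [F3.arr 5 rfl, eβ _ (g1.1 i hi).1]
        refine Ex.mono hN (output_spec hN hmN ((F3.reg 3 rfl).trans hm) ?_ ?_ ?_) (by omega) ?_
        · rw [F3.arr 4 rfl]; exact lA.inj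
        · intro x hx y hy hxy
          simp only [e5 x hx, e5 y hy] at hxy
          exact g1.2 hx hy (hβ.inj (g1.1 x hx).1 (g1.1 y hy).1 (Fin.ext hxy))
        · intro i hi j hj h
          rw [e4 i hi, e5 j hj] at h
          have h' := Fin.ext h
          have hb : β (s₃.arr 22 j) ∈ I.Aᶜ := (hβ.mem _).mpr ⟨_, (g1.1 j hj).1, rfl⟩
          exact hb (h' ▸ (hα.mem _).mpr ⟨i, hi, rfl⟩)
        · rintro s₄ ⟨q1, q2, q3⟩ _
          refine Or.inl ⟨q1, exists_isSolution hα hβ g1 g2 (fun i hi => ?_) fun i hi => ?_⟩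
          · rw [← e4 i hi, q2 i hi, e5 i hi]
          · rw [← e5 i hi, q3 i hi, e4 i hi]
      · intro h12
        refine Ex.nop hN ?_
        rcases h3 with ⟨g1, -⟩ | ⟨-, g1⟩
        · exact absurd h12 g1
        · exact Or.inr ⟨h2, fun ⟨M, hM⟩ => g1 (exists_isPM hα hβ hM)⟩
  · intro h0
    refine Ex.branch hN (a := 1) (b := 2) (by simp [Expr.cost]) (by omega) (by omega) ?_ ?_
    · intro h1
      exact Ex.nop hN (isAnswer_of_isEmpty h0 (Or.inr ⟨h1, rfl⟩))
    · intro h1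
      refine Ex.assign hN (by simp [Expr.cost]) (isAnswer_of_isEmpty h0 (Or.inl ⟨h1, ?_⟩))
      simp [State.setReg, Expr.eval]

end

end RAM

theorem mainTheorem2 :
    ∃ (p : RAM.Prog) (f : ℕ → ℕ) (c C : ℕ),
      (∀ b : ℕ, f b ≤ 2 ^ (c * (b + 1))) ∧
      ∀ I : BipartiteEM, ∃ (s : RAM.State) (t : ℕ),
        RAM.Runs p I.input s t ∧ t ≤ (max I.n 2) ^ (C * f I.beta) ∧ I.IsAnswer s := by
  refine ⟨RAM.exactMatching, fun b => 2 ^ (40 * (b + 1)), 40, 1000, fun b => le_rfl, fun I => ?_⟩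
  obtain ⟨s, t, h1, h2, h3⟩ := RAM.exactMatching_spec I
  refine ⟨s, t, h1, h2.trans (Nat.pow_le_pow_right (by omega) ?_), h3⟩
  -- The terms linear in β are absorbed by the factor 1000, since β + 1 ≤ f(β).
  have : I.beta + 1 ≤ 2 ^ (40 * (I.beta + 1)) :=
    Nat.lt_two_pow_self.le.trans (Nat.pow_le_pow_right (by norm_num) (by omega))
  change _ ≤ 1000 * 2 ^ (40 * (I.beta + 1))
  omega
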